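/- **Model.** The machine is a randomized real RAM. A program is a fixed finite structured program (assignments, conditionals, while loops) over a constant number of registers and a constant number of arrays. Every register and array cell holds one real number. Expressions are built from natural-number constants, registers and array cells by $+,-,\times,/,\sqrt{\cdot}$ and $\lfloor\cdot\rfloor$; tests compare two real numbers; and a random instruction draws a uniform integer from $\{0,\dots,N\}$ for a computed natural number $N$. Each elementary command and each test takes one unit of time. With $S$ memory cells means that every array has $S$ cells, and a program that accesses another cell, divides by zero, or takes the square root of a negative number fails and never halts. **Distance.** A curve of length $m$ in $\mathbb R^d$ is a sequence of $m$ points of $\mathbb R^d$. An alignment of curves $P=(p_1,\dots,p_{m_1})$ and $Q=(q_1,\dots,q_{m_2})$ is a sequence of index pairs from $(1,1)$ to $(m_1,m_2)$ in which each pair arises from the previous one by increasing the first index, the second index, or both, by $1$. The dynamic time warping distance is $d_{DTW}(P,Q)=\min_\tau\sum_{(i,j)\in\tau}\|p_i-q_j\|_2$, the minimum over all alignments $\tau$. **Theorem.** There are a preprocessing program, a query program, and an absolute constant $c$ such that the following holds for all integers $n,m,d\ge 1$, all reals $0<\varepsilon\le 1$ and $r>0$, and all curves $C_1,\dots,C_n$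 of length $m$ in $\mathbb R^d$. For some number $S\le n\cdot(c/\varepsilon)^{m(d+1)}$, both programs run with $S$ memory cells (this includes their working space), and: 1. Started with $n,m,d,\varepsilon,r$ and the coordinates of $C_1,\dots,C_n$ in the memory, which is zero otherwise, the preprocessing halts after an expected number of at most $n\cdot(c/\varepsilon)^{m(d+1)}$ steps. 2. Whatever the random choices of the preprocessing and of earlier queries were, each query, given by a curve $Q$ of length $m$ in $\mathbb R^d$ and started from the memory contents that the preprocessing and the earlier queries left, halts after at most $c\cdot md$ steps; and if some $C_i$ satisfies $d_{DTW}(Q,C_i)\le r$, then it returns an index $j$ with $d_{DTW}(Q,C_j)\le(1+\varepsilon)r$. That is, there is a data structure for $(1+\varepsilon,r)$-approximate near neighbors among curves under dynamic time warping with $n\cdot O(1/\varepsilon)^{m(d+1)}$ space, $n\cdot O(1/\varepsilon)^{m(d+1)}$ expected preprocessing time, and $O(md)$ query time. -/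

import Mathlib

open scoped ENNReal

noncomputable section

/-! ## Curves, alignments and dynamic time warping -/

/-- A curve of length `m` in `d`-dimensional Euclidean space. -/
abbrev Curve (m d : ℕ) : Type := Fin m → EuclideanSpace ℝ (Fin d)

/-- The three moves of an alignment: advance on the first curve, on the second, or on both. -/
def AlignStep {m₁ m₂ : ℕ} (p q : Fin m₁ × Fin m₂) : Prop :=
  (q.1.val = p.1.val + 1 ∧ q.2.val = p.2.val) ∨
  (q.1.val = p.1.val ∧ q.2.val = p.2.val + 1) ∨
  (q.1.val = p.1.val + 1 ∧ q.2.val = p.2.val + 1)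

/-- An alignment is a sequence of index pairs that starts at the pair of first indices, ends at
the pair of last indices, and proceeds by the moves `AlignStep` (indices start at `0`). -/
def IsAlignment {m₁ m₂ : ℕ} (τ : List (Fin m₁ × Fin m₂)) : Prop :=
  (∃ p, τ.head? = some p ∧ p.1.val = 0 ∧ p.2.val = 0) ∧
  (∃ p, τ.getLast? = some p ∧ p.1.val + 1 = m₁ ∧ p.2.val + 1 = m₂) ∧
  τ.IsChain AlignStep

/-- The time warping cost of a sequence of index pairs. -/
def dtwCost {m₁ m₂ d : ℕ} (P : Curve m₁ d) (Q : Curve m₂ d) (τ : List (Fin m₁ × Fin m₂)) : ℝ :=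
  (τ.map fun p => dist (P p.1) (Q p.2)).sum

/-- The dynamic time warping distance: the least cost of an alignment (for nonempty curves there
are finitely many alignments, and at least one). -/
def dtw {m₁ m₂ d : ℕ} (P : Curve m₁ d) (Q : Curve m₂ d) : ℝ :=
  sInf {x | ∃ τ, IsAlignment τ ∧ x = dtwCost P Q τ}

/-! ## A randomized real RAM with bounded memory

Programs are structured programs over finitely many real registers and finitely many arrays, each
with `S` cells that hold one real number each. Every elementary command and every test takes one
unit of time. (A program is a fixed finite object, so the expressions in its commands have constant
size and it mentions a constant number of registers and arrays.)
An access outside of the `S` cells, a division by zero, and the square root of a negative number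
crash the machine; a crashed machine never halts. -/

namespace RAM

/-- The contents of the registers and of the arrays: `mem a i` is cell `i` of array `a`. -/
structure Store where
  reg : ℕ → ℝ
  mem : ℕ → ℕ → ℝ

/-- Expressions: natural constants, registers, array cells, arithmetic, square root and floor. -/
inductive Expr where
  | const (k : ℕ)
  | reg (x : ℕ)
  | cell (a : ℕ) (i : Expr)
  | add (e f : Expr)
  | sub (e f : Expr)
  | mul (e f : Expr)
  | div (e f : Expr)
  | sqrt (e : Expr)
  | floor (e : Expr)

/-- Programs. `rand x e` draws register `x` uniformly from `{0, …, N}`, where `N` is the value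
of `e`. -/
inductive Cmd where
  | skip
  | assign (x : ℕ) (e : Expr)
  | write (a : ℕ) (i e : Expr)
  | rand (x : ℕ) (e : Expr)
  | seq (c₁ c₂ : Cmd)
  | ifLe (e f : Expr) (c₁ c₂ : Cmd)
  | whileLt (e f : Expr) (c : Cmd)

/-- The natural number equal to `v`, if there is one. -/
def asNat (v : ℝ) : Option ℕ := if v = (⌊v⌋₊ : ℝ) then some ⌊v⌋₊ else none

/-- The cell that `v` addresses in an array of `S` cells, if there is one. -/
def address (S : ℕ) (v : ℝ) : Option ℕ := (asNat v).filter (· < S)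

/-- The value of an expression (`none` if the evaluation crashes). -/
def Expr.eval (S : ℕ) (s : Store) : Expr → Option ℝ
  | .const k => some (k : ℝ)
  | .reg x => some (s.reg x)
  | .cell a i => (i.eval S s).bind fun v => (address S v).map (s.mem a)
  | .add e f => (e.eval S s).bind fun v => (f.eval S s).map fun w => v + w
  | .sub e f => (e.eval S s).bind fun v => (f.eval S s).map fun w => v - w
  | .mul e f => (e.eval S s).bind fun v => (f.eval S s).map fun w => v * w
  | .div e f => (e.eval S s).bind fun v => (f.eval S s).bind fun w =>
      if w = 0 then none else some (v / w)
  | .sqrt e => (e.eval S s).bind fun v => if v < 0 then none else some (Real.sqrt v)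
  | .floor e => (e.eval S s).map fun v => (⌊v⌋ : ℝ)

/-- Overwrite register `x`. -/
def Store.setReg (s : Store) (x : ℕ) (v : ℝ) : Store :=
  { s with reg := Function.update s.reg x v }

/-- Overwrite cell `i` of array `a`. -/
def Store.setCell (s : Store) (a i : ℕ) (v : ℝ) : Store :=
  { s with mem := Function.update s.mem a (Function.update (s.mem a) i v) }

/-- Configurations: either a list of commands that remain to be executed, in this order, together
with the current store, or the crashed configuration. -/
inductive Config where
  | run (todo : List Cmd) (s : Store)
  | crash

/-- A configuration is halted if nothing remains to be executed. -/
def Config.Halted (c : Config) : Prop := ∃ s, c = .run [] s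

/-- One step of the machine; halted and crashed configurations do not change any more. -/
def step (S : ℕ) : Config → PMF Config
  | .crash => PMF.pure .crash
  | .run [] s => PMF.pure (.run [] s)
  | .run (.skip :: k) s => PMF.pure (.run k s)
  | .run (.assign x e :: k) s =>
      match e.eval S s with
      | some v => PMF.pure (.run k (s.setReg x v))
      | none => PMF.pure .crash
  | .run (.write a i e :: k) s =>
      match (i.eval S s).bind (address S), e.eval S s with
      | some j, some v => PMF.pure (.run k (s.setCell a j v))
      | _, _ => PMF.pure .crash
  | .run (.rand x e :: k) s =>
      match (e.eval S s).bind asNat with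
      | some N => (PMF.uniformOfFintype (Fin (N + 1))).map
          fun u : Fin (N + 1) => .run k (s.setReg x ((u : ℕ) : ℝ))
      | none => PMF.pure .crash
  | .run (.seq c₁ c₂ :: k) s => PMF.pure (.run (c₁ :: c₂ :: k) s)
  | .run (.ifLe e f c₁ c₂ :: k) s =>
      match e.eval S s, f.eval S s with
      | some v, some w => PMF.pure (.run ((if v ≤ w then c₁ else c₂) :: k) s)
      | _, _ => PMF.pure .crash
  | .run (.whileLt e f c :: k) s =>
      match e.eval S s, f.eval S s with
      | some v, some w => PMF.pure (.run (if v < w then c :: .whileLt e f c :: k else k) s)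
      | _, _ => PMF.pure .crash

/-- The distribution of the configuration after `t` steps. -/
def steps (S : ℕ) : ℕ → Config → PMF Config
  | 0, c => PMF.pure c
  | t + 1, c => (step S c).bind (steps S t)

/-- The expected number `∑ t, ℙ(not halted after t steps)` of steps until the machine halts. -/
def expectedTime (S : ℕ) (c : Config) : ℝ≥0∞ :=
  ∑' t : ℕ, (steps S t c).toOuterMeasure {c' | ¬ c'.Halted}

end RAM

/-! ## Data structures for near neighbors among curves -/

/-- The coordinates of a curve, in consecutive cells that held `old` before. -/
def curveArray {m d : ℕ} (Q : Curve m d) (old : ℕ → ℝ) (a : ℕ) : ℝ :=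
  if h : a < m * d then
    Q (finProdFinEquiv.symm ⟨a, h⟩).1 (finProdFinEquiv.symm ⟨a, h⟩).2
  else old a

/-- The coordinates of a family of curves, one curve after the other, followed by zeros. -/
def inputArray {n m d : ℕ} (C : Fin n → Curve m d) (a : ℕ) : ℝ :=
  if h : a < n * (m * d) then
    curveArray (C (finProdFinEquiv.symm ⟨a, h⟩).1) (fun _ => 0) (finProdFinEquiv.symm ⟨a, h⟩).2
  else 0

/-- The store in which the preprocessing starts: `n, m, d, ε, r` are in registers `0` to `4`, the
input curves in array `0`, and everything else is zero. -/
def inputStore {n m d : ℕ} (C : Fin n → Curve m d) (ε r : ℝ) : RAM.Store where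
  reg
    | 0 => n
    | 1 => m
    | 2 => d
    | 3 => ε
    | 4 => r
    | _ => 0
  mem
    | 0 => inputArray C
    | _ => fun _ => 0

/-- Write a query curve to the beginning of array `1`. -/
def loadQuery {m d : ℕ} (Q : Curve m d) (s : RAM.Store) : RAM.Store :=
  { s with mem := Function.update s.mem 1 (curveArray Q (s.mem 1)) }

/-- The configuration in which the preprocessing starts. -/
def prepStart {n m d : ℕ} (prep : RAM.Cmd) (C : Fin n → Curve m d) (ε r : ℝ) : RAM.Config :=
  .run [prep] (inputStore C ε r)

/-- The configuration in which a query starts. -/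
def queryStart {m d : ℕ} (query : RAM.Cmd) (Q : Curve m d) (s : RAM.Store) : RAM.Config :=
  .run [query] (loadQuery Q s)

/-- The stores that can be met between queries: those that the preprocessing leaves behind, under
some outcome of the random choices, and then those that a query leaves behind. -/
inductive IsDataStructure {n m d : ℕ} (S : ℕ) (prep query : RAM.Cmd) (C : Fin n → Curve m d)
    (ε r : ℝ) : RAM.Store → Prop
  | built (t : ℕ) (s : RAM.Store)
      (h : .run [] s ∈ (RAM.steps S t (prepStart prep C ε r)).support) :
      IsDataStructure S prep query C ε r s
  | queried (t : ℕ) (Q : Curve m d) (s s' : RAM.Store) (hs : IsDataStructure S prep query C ε r s)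
      (h : .run [] s' ∈ (RAM.steps S t (queryStart query Q s)).support) :
      IsDataStructure S prep query C ε r s'

/-- The requirement on the answer, left in register `0`, to a near-neighbor query `Q` under the
distance measure `δ`: if some input curve is within distance `r` of `Q`, the answer is the index
of an input curve within distance `(1 + ε) * r`. -/
def CorrectAnswer {n m d : ℕ} (δ : Curve m d → Curve m d → ℝ) (C : Fin n → Curve m d) (ε r : ℝ)
    (Q : Curve m d) (s : RAM.Store) : Prop :=
  (∃ i, δ Q (C i) ≤ r) → ∃ j : Fin n, s.reg 0 = ((j : ℕ) : ℝ) ∧ δ Q (C j) ≤ (1 + ε) * r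

/-- The programs `prep` and `query`, run with `S` memory cells, are a data structure for the
`(1 + ε, r)`-approximate near-neighbor problem for the curves `C` under `δ`, with expected
preprocessing time at most `E` and, whatever the random choices were, query time at most `T`. -/
structure SolvesANNC {n m d : ℕ} (δ : Curve m d → Curve m d → ℝ) (prep query : RAM.Cmd)
    (C : Fin n → Curve m d) (ε r : ℝ) (S : ℕ) (E : ℝ≥0∞) (T : ℕ) : Prop where
  preprocessing : RAM.expectedTime S (prepStart prep C ε r) ≤ E
  answers : ∀ s, IsDataStructure S prep query C ε r s → ∀ Q : Curve m d,
    ∀ c ∈ (RAM.steps S T (queryStart query Q s)).support,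
      ∃ s', c = .run [] s' ∧ CorrectAnswer δ C ε r Q s'

end

noncomputable section

namespace RAM

/-! ## Total correctness with time bounds for deterministic programs -/

/-! Queries are rounded down to a grid of width `δ = ε * r / (8 * m * √d)`. Rounding moves a point
by at most `δ * √d`, and an alignment has fewer than `2 * m` pairs, so the cost of every alignment
changes by at most `ε * r / 4`. It therefore suffices to store, with each input curve, the grid
curves that arise by rounding the queries within distance `r`, and to answer a query by looking up
its rounding. Grid curves with an alignment of cost at most `r + ε * r / 2` are accepted, which
leaves room for the rounding error on both sides (`exists_neighbor`).

The relevant grid curves are enumerated by arithmetic coding. A number `y` in `[0, 1)` is decoded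
into the moves of an alignment and, for each new grid point, into its offset from the rounded input
point that it is paired with. An offset of absolute value `z` in one coordinate owns a share `E / (2
(E + z) (E + z + 1)) ≥ exp (-2 (z + 1) / E) / (2 E)` of the interval, where `E` is about `1 / ε`.
Along a cheap alignment the offsets add up to `O(m d E)`, so each relevant pair of an alignment and
a grid curve owns an interval of length at least `1 / W` with `W = O(1 / ε) ^ (m d)`, and this
interval contains some `t / W`. Trying all `t < W` thus finds every relevant grid curve
(`Walk.run_complete`, `one_le_weight_mul`). Conversely, each walk yields a grid curve together with
the cost of a genuine alignment to it (`Walk.run_sound`).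

Lookup in constant time needs no hashing, as a register holds an arbitrarily large integer and
floors give remainders. Grid curves are coded as integers, and the whole dictionary consists of the
values of three polynomials at one large integer `B`: reducing them modulo `B - x` recovers their
values at the key `x` (`IsDict.insert`, `IsDict.lookup`). Hence `n * (m * d)` cells suffice. The
programs draw no random numbers, so the bound on the expected time is a bound on the time itself. -/

theorem steps_add (S a b : ℕ) (c : Config) :
    steps S (a + b) c = (steps S a c).bind (steps S b) := by
  induction a generalizing c with
  | zero => simp [steps]
  | succ a ih =>
    rw [Nat.succ_add_eq_add_succ, Nat.add_succ]
    simp only [steps, PMF.bind_bind]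
    congr 1
    funext c'
    exact ih c'

theorem steps_halted (S t : ℕ) (s : Store) :
    steps S t (.run [] s) = PMF.pure (.run [] s) := by
  induction t with
  | zero => rfl
  | succ t ih => simp [steps, step, ih]

/-- The command `c` leads from `s` to `s'` in exactly `t` steps. -/
def Runs (S : ℕ) (c : Cmd) (s : Store) (t : ℕ) (s' : Store) : Prop :=
  ∀ k, steps S t (.run (c :: k) s) = PMF.pure (.run k s')

/-- Started in `s`, the command `c` halts within `T` steps in a store that satisfies `Q`. -/
def Term (S : ℕ) (c : Cmd) (s : Store) (T : ℕ) (Q : Store → Prop) : Prop :=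
  ∃ t ≤ T, ∃ s', Q s' ∧ Runs S c s t s'

variable {S : ℕ} {s : Store} {T T₁ T₂ : ℕ} {Q Q' : Store → Prop} {c c₁ c₂ : Cmd} {e f : Expr}

theorem Term.mono (h : Term S c s T₁ Q) (hT : T₁ ≤ T) (hQ : ∀ s', Q s' → Q' s') :
    Term S c s T Q' := by
  obtain ⟨t, ht, s', hs, hr⟩ := h
  exact ⟨t, ht.trans hT, s', hQ _ hs, hr⟩

theorem Term.skip (h : Q s) : Term S .skip s (T + 1) Q :=
  ⟨1, by omega, s, h, fun k => by simp [steps, step]⟩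

theorem Term.assign {x : ℕ} {v : ℝ} (he : e.eval S s = some v) (h : Q (s.setReg x v)) :
    Term S (.assign x e) s (T + 1) Q :=
  ⟨1, by omega, _, h, fun k => by simp [steps, step, he]⟩

theorem Term.write {a j : ℕ} {v : ℝ} (hj : e.eval S s = some (j : ℝ)) (hS : j < S)
    (he : f.eval S s = some v) (h : Q (s.setCell a j v)) :
    Term S (.write a e f) s (T + 1) Q :=
  ⟨1, by omega, _, h, fun k => by simp [steps, step, he, hj, address, asNat, hS, Option.filter]⟩

theorem Term.seq (h : Term S c₁ s T₁ fun s' => Term S c₂ s' T₂ Q) :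
    Term S (.seq c₁ c₂) s (T₁ + T₂ + 1) Q := by
  obtain ⟨t, ht, s₁, ⟨u, hu, s₂, hQ, hr₂⟩, hr₁⟩ := h
  refine ⟨t + u + 1, by omega, s₂, hQ, fun k => ?_⟩
  simp [steps, step, steps_add, hr₁ _, hr₂ _]

theorem Term.ifLe {v w : ℝ} (he : e.eval S s = some v) (hf : f.eval S s = some w)
    (h₁ : v ≤ w → Term S c₁ s T Q) (h₂ : w < v → Term S c₂ s T Q) :
    Term S (.ifLe e f c₁ c₂) s (T + 1) Q := by
  by_cases hvw : v ≤ w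
  · obtain ⟨t, ht, s', hQ, hr⟩ := h₁ hvw
    exact ⟨t + 1, by omega, s', hQ, fun k => by simp [steps, step, he, hf, hvw, hr _]⟩
  · obtain ⟨t, ht, s', hQ, hr⟩ := h₂ (not_le.1 hvw)
    exact ⟨t + 1, by omega, s', hQ, fun k => by simp [steps, step, he, hf, hvw, hr _]⟩

theorem Term.while_done {v w : ℝ} (he : e.eval S s = some v) (hf : f.eval S s = some w)
    (hvw : w ≤ v) (hQ : Q s) : Term S (.whileLt e f c) s (T + 1) Q :=
  ⟨1, by omega, s, hQ, fun k => by simp [steps, step, he, hf, hvw.not_gt]⟩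

theorem Term.while_step {v w : ℝ} (he : e.eval S s = some v) (hf : f.eval S s = some w)
    (hvw : v < w) (h : Term S c s T₁ fun s' => Term S (.whileLt e f c) s' T₂ Q) :
    Term S (.whileLt e f c) s (T₁ + T₂ + 1) Q := by
  obtain ⟨t, ht, s₁, ⟨u, hu, s₂, hQ, hr₂⟩, hr₁⟩ := h
  refine ⟨t + u + 1, by omega, s₂, hQ, fun k => ?_⟩
  simp [steps, step, steps_add, he, hf, hvw, hr₁ _, hr₂ _]

/-- A counting loop, with an invariant indexed by the number of completed rounds. -/
theorem Term.for_loop (I : ℕ → Store → Prop) (N x : ℕ) (he : ∀ k s, I k s → s.reg x = k)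
    (hf : ∀ k s, I k s → f.eval S s = some (N : ℝ))
    (hc : ∀ k s, k < N → I k s → Term S c s T (I (k + 1))) (h : I 0 s) :
    Term S (.whileLt (.reg x) f c) s (N * (T + 1) + 1) (I N) := by
  -- Here `j` counts the remaining rounds.
  have key : ∀ j k s, k + j = N → I k s →
      Term S (.whileLt (.reg x) f c) s (j * (T + 1) + 1) (I N) := by
    intro j
    induction j with
    | zero =>
      intro k s hk hI
      obtain rfl : k = N := by omega
      exact Term.while_done (v := k) (by simp [Expr.eval, he k s hI]) (hf k s hI) le_rfl hI
    | succ j ih =>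
      intro k s hk hI
      have hkN : k < N := by omega
      refine Term.mono (Term.while_step (v := k) (by simp [Expr.eval, he k s hI]) (hf k s hI)
        (by exact_mod_cast hkN)
        ((hc k s hkN hI).mono le_rfl fun s' hs' => ih (k + 1) s' (by omega) hs'))
        (by rw [Nat.succ_mul]; omega) fun _ h => h
  exact key N 0 s (by omega) h

/-- Execute a list of commands. -/
def block : List Cmd → Cmd
  | [] => .skip
  | c :: l => .seq c (block l)

theorem Term.nil (h : Q s) : Term S (block []) s (T + 1) Q := Term.skip h

theorem Term.cons {l : List Cmd} (h : Term S c s T₁ fun s' => Term S (block l) s' T₂ Q) :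
    Term S (block (c :: l)) s (T₁ + T₂ + 1) Q := Term.seq h

theorem Term.assign_cons {l : List Cmd} {x : ℕ} {v : ℝ} (he : e.eval S s = some v)
    (h : Term S (block l) (s.setReg x v) T Q) :
    Term S (block (.assign x e :: l)) s (T + 2) Q :=
  (Term.cons (T₁ := 1) (Term.assign he h)).mono (by omega) fun _ h => h

theorem Term.write_cons {l : List Cmd} {a j : ℕ} {v : ℝ} (hj : e.eval S s = some (j : ℝ))
    (hS : j < S) (he : f.eval S s = some v) (h : Term S (block l) (s.setCell a j v) T Q) :
    Term S (block (.write a e f :: l)) s (T + 2) Q :=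
  (Term.cons (T₁ := 1) (Term.write hj hS he h)).mono (by omega) fun _ h => h

/-! ### From `Term` to the semantics -/

theorem Term.steps_eq (h : Term S c s T Q) :
    ∃ s', Q s' ∧ ∀ t, T ≤ t → steps S t (.run [c] s) = PMF.pure (.run [] s') := by
  obtain ⟨t, ht, s', hQ, hr⟩ := h
  refine ⟨s', hQ, fun u hu => ?_⟩
  obtain ⟨v, rfl⟩ := Nat.exists_eq_add_of_le (ht.trans hu)
  simp [steps_add, hr _, steps_halted]

/-- Halted configurations are absorbing: after `T` further steps, any halted outcome must be the one
that is certain by then. -/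
theorem Term.of_mem_support (h : Term S c s T Q) {t : ℕ} {s' : Store}
    (hs : Config.run [] s' ∈ (steps S t (.run [c] s)).support) : Q s' := by
  obtain ⟨s₁, hQ, hT⟩ := h.steps_eq
  have h1 : Config.run [] s' ∈ (steps S (t + T) (.run [c] s)).support := by
    rw [steps_add, PMF.mem_support_bind_iff]
    exact ⟨_, hs, by simp [steps_halted]⟩
  rw [hT _ (by omega)] at h1
  simp only [PMF.support_pure, Set.mem_singleton_iff, Config.run.injEq, true_and] at h1
  exact h1 ▸ hQ

/-- The first `T` summands are probabilities, hence at most one, and all later ones vanish. -/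
theorem Term.expectedTime_le (h : Term S c s T Q) : expectedTime S (.run [c] s) ≤ T := by
  obtain ⟨s₁, -, hT⟩ := h.steps_eq
  have h0 : ∀ t, t ∉ Finset.range T →
      (steps S t (.run [c] s)).toOuterMeasure {c' | ¬ c'.Halted} = 0 := by
    intro t ht
    rw [hT t (by simpa using ht), PMF.toOuterMeasure_apply_eq_zero_iff]
    simp [Config.Halted]
  rw [expectedTime, tsum_eq_sum h0]
  refine (Finset.sum_le_card_nsmul _ _ 1 fun t _ => ?_).trans (by simp)
  rw [PMF.toOuterMeasure_apply]
  refine (ENNReal.tsum_le_tsum fun c' => Set.indicator_le_self _ _ c').trans ?_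
  rw [PMF.tsum_coe]

/-! ### Evaluation -/

instance : Add Expr := ⟨.add⟩
instance : Sub Expr := ⟨.sub⟩
instance : Mul Expr := ⟨.mul⟩
instance : Div Expr := ⟨.div⟩

theorem eval_const (k : ℕ) : (Expr.const k).eval S s = some (k : ℝ) := rfl

theorem eval_reg (x : ℕ) : (Expr.reg x).eval S s = some (s.reg x) := rfl

theorem eval_add {v w : ℝ} (he : e.eval S s = some v) (hf : f.eval S s = some w) :
    (e + f).eval S s = some (v + w) := by
  change (Expr.add e f).eval S s = _
  simp [Expr.eval, he, hf]

theorem eval_sub {v w : ℝ} (he : e.eval S s = some v) (hf : f.eval S s = some w) :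
    (e - f).eval S s = some (v - w) := by
  change (Expr.sub e f).eval S s = _
  simp [Expr.eval, he, hf]

theorem eval_mul {v w : ℝ} (he : e.eval S s = some v) (hf : f.eval S s = some w) :
    (e * f).eval S s = some (v * w) := by
  change (Expr.mul e f).eval S s = _
  simp [Expr.eval, he, hf]

theorem eval_div {v w : ℝ} (he : e.eval S s = some v) (hf : f.eval S s = some w) (hw : w ≠ 0) :
    (e / f).eval S s = some (v / w) := by
  change (Expr.div e f).eval S s = _
  simp [Expr.eval, he, hf, hw]

theorem eval_sqrt {v : ℝ} (he : e.eval S s = some v) (hv : 0 ≤ v) :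
    (Expr.sqrt e).eval S s = some (Real.sqrt v) := by
  simp [Expr.eval, he, hv.not_gt]

theorem eval_floor {v : ℝ} (he : e.eval S s = some v) :
    (Expr.floor e).eval S s = some ((⌊v⌋ : ℤ) : ℝ) := by
  simp [Expr.eval, he]

theorem eval_cell {a k : ℕ} (he : e.eval S s = some (k : ℝ)) (hk : k < S) :
    (Expr.cell a e).eval S s = some (s.mem a k) := by
  simp [Expr.eval, he, address, asNat, hk]

theorem reg_setReg (x y : ℕ) (v : ℝ) :
    (s.setReg x v).reg y = if y = x then v else s.reg y := by
  simp [Store.setReg, Function.update_apply]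

theorem mem_setReg (x : ℕ) (v : ℝ) : (s.setReg x v).mem = s.mem := rfl

theorem reg_setCell (a j : ℕ) (v : ℝ) : (s.setCell a j v).reg = s.reg := rfl

theorem mem_setCell (a b j : ℕ) (v : ℝ) :
    (s.setCell a j v).mem b = if b = a then Function.update (s.mem a) j v else s.mem b := by
  simp only [Store.setCell, Function.update_apply]

end RAM

end

noncomputable section

namespace RAM

/-! ## Decoding a number from the unit interval -/

/-- The interval `[0, 1)` has a subinterval of length `w` on which `A` holds. -/
def Fair (w : ℝ) (A : ℝ → Prop) : Prop :=
  ∃ lo, 0 ≤ lo ∧ lo + w ≤ 1 ∧ ∀ y, lo ≤ y → y < lo + w → A y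

theorem Fair.mono {w w' : ℝ} {A A' : ℝ → Prop} (h : Fair w A) (hw : w' ≤ w)
    (hA : ∀ y, 0 ≤ y → y < 1 → A y → A' y) : Fair w' A' := by
  obtain ⟨lo, h0, h1, h⟩ := h
  exact ⟨lo, h0, by linarith, fun y hy hy' =>
    hA y (by linarith) (by linarith) (h y hy (by linarith))⟩

/-- The first multiple of `1 / W` that is not below `lo` is still in the half-open interval. This is
what replaces random sources by an enumeration. -/
theorem Fair.exists_grid {w : ℝ} {A : ℝ → Prop} (h : Fair w A) {W : ℕ} (hW : 0 < W)
    (hw : 1 ≤ w * W) : ∃ t : ℕ, t < W ∧ A (t / W) := by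
  obtain ⟨lo, h0, h1, h⟩ := h
  have hW' : (0 : ℝ) < W := by exact_mod_cast hW
  have hc := Nat.ceil_lt_add_one (mul_nonneg h0 hW'.le)
  have hc' := Nat.le_ceil (lo * W)
  have hlt : (⌈lo * W⌉₊ : ℝ) < (lo + w) * W := by nlinarith
  refine ⟨⌈lo * W⌉₊, ?_, h _ ?_ ?_⟩
  · have : (⌈lo * W⌉₊ : ℝ) < W := by nlinarith
    exact_mod_cast this
  · rwa [le_div_iff₀ hW']
  · rwa [div_lt_iff₀ hW']

/-- The absolute value of the digit that `y` starts with. -/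
def magnitude (E : ℕ) (y : ℝ) : ℤ := ⌊E * (2 * y - ⌊2 * y⌋) / (1 - (2 * y - ⌊2 * y⌋))⌋

/-- The digit that `y` starts with, replaced by zero if its absolute value exceeds `K`. -/
def digit (E K : ℕ) (y : ℝ) : ℤ :=
  (1 - 2 * ⌊2 * y⌋) * (if magnitude E y ≤ K then magnitude E y else 0)

/-- What remains of `y` when its first digit has been removed. -/
def shift (E : ℕ) (y : ℝ) : ℝ :=
  ((2 * y - ⌊2 * y⌋) * (E + magnitude E y) - magnitude E y) * (E + magnitude E y + 1) / E

theorem magnitude_nonneg {E : ℕ} (y : ℝ) : 0 ≤ magnitude E y := by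
  have h1 := Int.floor_le (2 * y)
  have h2 := Int.lt_floor_add_one (2 * y)
  exact Int.floor_nonneg.2 (div_nonneg (mul_nonneg (Nat.cast_nonneg _) (by linarith))
    (by linarith))

/-- With `x` the fractional part of `2 * y` and `z` its magnitude, the floor inequalities say `z /
(E + z) ≤ x < (z + 1) / (E + z + 1)`, and `shift` rescales exactly this interval to `[0, 1)`.
Truncation of digits at `K` plays no role. -/
theorem shift_mem {E : ℕ} (hE : 0 < E) (y : ℝ) : 0 ≤ shift E y ∧ shift E y < 1 := by
  have h1 := Int.floor_le (2 * y)
  have h2 := Int.lt_floor_add_one (2 * y)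
  have h0 : (0 : ℝ) ≤ magnitude E y := by exact_mod_cast magnitude_nonneg (E := E) y
  have hE' : (0 : ℝ) < E := by exact_mod_cast hE
  have h3 : (magnitude E y : ℝ) ≤ _ := Int.floor_le _
  have h4 := Int.lt_floor_add_one (E * (2 * y - ⌊2 * y⌋) / (1 - (2 * y - ⌊2 * y⌋)) : ℝ)
  change _ < (magnitude E y : ℝ) + 1 at h4
  have hx : 0 < 1 - (2 * y - ⌊2 * y⌋) := by linarith
  unfold shift
  generalize (magnitude E y : ℝ) = z at *
  generalize (2 * y - ⌊2 * y⌋ : ℝ) = x at *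
  rw [le_div_iff₀ hx] at h3
  rw [div_lt_iff₀ hx] at h4
  constructor
  · have : 0 ≤ x * (E + z) - z := by linarith
    positivity
  · rw [div_lt_one hE']
    have : x * (E + z + 1) < z + 1 := by linarith
    nlinarith

theorem abs_digit_le {E K : ℕ} {y : ℝ} (h0 : 0 ≤ y) (h1 : y < 1) : |digit E K y| ≤ K := by
  have hb : 0 ≤ ⌊2 * y⌋ := Int.floor_nonneg.2 (by linarith)
  have hb' : ⌊2 * y⌋ < 2 := Int.floor_lt.2 (by push_cast; linarith)
  have hz := magnitude_nonneg (E := E) y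
  unfold digit
  have hs : |1 - 2 * ⌊2 * y⌋| = 1 := by
    obtain h | h : ⌊2 * y⌋ = 0 ∨ ⌊2 * y⌋ = 1 := by omega
    all_goals simp [h]
  rw [abs_mul, hs, one_mul]
  split_ifs with h
  · rwa [abs_of_nonneg hz]
  · simp

theorem iterate_shift_mem {E : ℕ} (hE : 0 < E) {y : ℝ} (h0 : 0 ≤ y) (h1 : y < 1) (l : ℕ) :
    0 ≤ (shift E)^[l] y ∧ (shift E)^[l] y < 1 := by
  cases l with
  | zero => exact ⟨h0, h1⟩
  | succ l => rw [Function.iterate_succ_apply']; exact shift_mem hE _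

/-- The integer part `b` of `2 * y` encodes the sign. The fractional parts with magnitude `z` form
an interval from `z / (E + z)` to `(z + 1) / (E + z + 1)`, of length `g`, which `shift` maps
affinely onto `[0, 1)`. The preimage of an interval of length `w` therefore has length `w * g / 2`,
where the sign accounts for the factor `1 / 2`. -/
theorem Fair.digit {E K : ℕ} (hE : 0 < E) {w : ℝ} {A : ℝ → Prop} (h : Fair w A) (u : ℤ)
    (hu : |u| ≤ K) :
    Fair (w * (E / (2 * (E + |(u : ℝ)|) * (E + |(u : ℝ)| + 1))))
      (fun y => digit E K y = u ∧ A (shift E y)) := by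
  obtain ⟨lo, h0, h1, h⟩ := h
  have hE' : (0 : ℝ) < E := by exact_mod_cast hE
  obtain ⟨b, hb, hbu⟩ : ∃ b : ℤ, (b = 0 ∨ b = 1) ∧ u = (1 - 2 * b) * |u| := by
    rcases le_total 0 u with hu | hu
    · exact ⟨0, Or.inl rfl, by simp [abs_of_nonneg hu]⟩
    · exact ⟨1, Or.inr rfl, by simp [abs_of_nonpos hu]⟩
  obtain ⟨z, hz⟩ : ∃ z : ℝ, |(u : ℝ)| = z := ⟨_, rfl⟩
  have hz' : ((|u| : ℤ) : ℝ) = z := by rw [← hz]; push_cast; rfl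
  have hz0 : 0 ≤ z := by rw [← hz]; positivity
  rw [hz]
  obtain ⟨hbr, hbr'⟩ : (0 : ℝ) ≤ b ∧ (b : ℝ) ≤ 1 := by rcases hb with rfl | rfl <;> simp
  have e1 : 0 < E + z := by positivity
  have e2 : 0 < E + z + 1 := by positivity
  set g : ℝ := E / ((E + z) * (E + z + 1)) with hg
  have hg0 : 0 < g := by positivity
  have hsplit : z / (E + z) + g = (z + 1) / (E + z + 1) := by
    rw [hg]; field_simp; ring
  have hle : z / (E + z) + g < 1 := by
    rw [hsplit, div_lt_one e2]
    linarith
  have hzE : 0 ≤ z / (E + z) := by positivity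
  have hw : w * (E / (2 * (E + z) * (E + z + 1))) = w * g / 2 := by
    rw [hg]; field_simp
  rw [hw]
  refine ⟨(b + z / (E + z) + lo * g) / 2, by positivity, ?_, fun y hy hy' => ?_⟩
  · have : (lo + w) * g ≤ g := mul_le_of_le_one_left hg0.le h1
    linarith
  have hylo : lo ≤ (2 * y - b - z / (E + z)) / g := by rw [le_div_iff₀ hg0]; linarith
  have hyhi : (2 * y - b - z / (E + z)) / g < lo + w := by
    rw [div_lt_iff₀ hg0]; linarith
  have hA := h _ hylo hyhi
  have hx0 : z / (E + z) ≤ 2 * y - b := by nlinarith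
  have hx1 : 2 * y - b < z / (E + z) + g := by
    have : (2 * y - b - z / (E + z)) / g < 1 := by linarith
    rw [div_lt_one hg0] at this
    linarith
  have hfl : ⌊2 * y⌋ = b := by
    rw [Int.floor_eq_iff]
    constructor <;> linarith
  have hmag : magnitude E y = |u| := by
    unfold magnitude
    rw [hfl, Int.floor_eq_iff, hz']
    generalize 2 * y - (b : ℝ) = x at *
    have hx : 0 < 1 - x := by linarith
    rw [le_div_iff₀ hx, div_lt_iff₀ hx]
    rw [div_le_iff₀ e1] at hx0
    constructor
    · linarith
    · have hxx : x < (z + 1) / (E + z + 1) := hx1.trans_eq hsplit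
      rw [lt_div_iff₀ e2] at hxx
      linarith
  refine ⟨?_, ?_⟩
  · unfold RAM.digit
    rw [hfl, hmag, if_pos hu, ← hbu]
  · convert hA using 1
    unfold shift
    rw [hfl, hmag, hz', hg]
    field_simp

/-- In exponential form, the shares of several digits multiply to a function of the sum of the
digits. The bound is `1 + t ≤ exp t` with `t = (z + 1) / E`, squared. -/
theorem digit_length_ge {E : ℕ} (hE : 0 < E) {z : ℝ} (hz : 0 ≤ z) :
    (2 * (E : ℝ))⁻¹ * Real.exp (-(2 * (z + 1) / E)) ≤ E / (2 * (E + z) * (E + z + 1)) := by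
  have hE' : (0 : ℝ) < E := by exact_mod_cast hE
  have h := Real.add_one_le_exp ((z + 1) / E)
  have h2 : ((z + 1) / E + 1) ^ 2 ≤ Real.exp (2 * (z + 1) / E) := by
    calc ((z + 1) / E + 1) ^ 2 ≤ Real.exp ((z + 1) / E) ^ 2 := by gcongr
      _ = _ := by rw [← Real.exp_nat_mul]; congr 1; push_cast; ring
  rw [Real.exp_neg, ← mul_inv]
  have h3 : 2 * (E + z) * (E + z + 1) ≤ E * (2 * E * Real.exp (2 * (z + 1) / E)) := by
    calc 2 * (E + z) * (E + z + 1) ≤ 2 * (E + z + 1) * (E + z + 1) :=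
          mul_le_mul_of_nonneg_right (by linarith) (by positivity)
      _ = E * (2 * E * ((z + 1) / E + 1) ^ 2) := by field_simp; ring
      _ ≤ _ := by gcongr
  rw [inv_le_comm₀ (by positivity) (by positivity), inv_div, div_le_iff₀ hE']
  linarith

theorem Fair.digits {E K : ℕ} (hE : 0 < E) {w : ℝ} (hw : 0 ≤ w) {A : ℝ → Prop} (h : Fair w A)
    (u : ℕ → ℤ) (d : ℕ) (hu : ∀ l < d, |u l| ≤ K) :
    Fair (w * ((2 * (E : ℝ))⁻¹ ^ d *
        Real.exp (-(2 * ((∑ l ∈ Finset.range d, |(u l : ℝ)|) + d) / E))))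
      (fun y => (∀ l < d, RAM.digit E K ((shift E)^[l] y) = u l) ∧ A ((shift E)^[d] y)) := by
  induction d generalizing w A with
  | zero => simpa using h
  | succ d ih =>
    -- The last digit is put in front of `A` before the induction hypothesis puts the earlier digits
    -- in front of both.
    have h1 := (h.digit (K := K) hE (u d) (hu d (by omega)))
    refine (ih (by positivity) h1 fun l hl => hu l (by omega)).mono ?_ ?_
    · have h2 := digit_length_ge hE (abs_nonneg (u d : ℝ))
      have h3 : -(2 * ((∑ l ∈ Finset.range (d + 1), |(u l : ℝ)|) + ((d + 1 : ℕ) : ℝ)) / E) =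
          -(2 * (|(u d : ℝ)| + 1) / E) +
          -(2 * ((∑ l ∈ Finset.range d, |(u l : ℝ)|) + d) / E) := by
        rw [Finset.sum_range_succ]; push_cast; ring
      rw [h3, Real.exp_add]
      calc _ = w * ((2 * (E : ℝ))⁻¹ * Real.exp (-(2 * (|(u d : ℝ)| + 1) / E))) *
            ((2 * (E : ℝ))⁻¹ ^ d *
              Real.exp (-(2 * ((∑ l ∈ Finset.range d, |(u l : ℝ)|) + d) / E))) := by ring
        _ ≤ _ := by gcongr
    · rintro y - - ⟨hy, hy', hyA⟩
      refine ⟨fun l hl => ?_, by rwa [Function.iterate_succ_apply']⟩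
      rcases Nat.lt_succ_iff_lt_or_eq.1 hl with hl | rfl
      · exact hy l hl
      · exact hy'

theorem Fair.third {w : ℝ} {A : ℝ → Prop} (h : Fair w A) (b : ℤ) (hb : 0 ≤ b) (hb' : b ≤ 2) :
    Fair (w * 3⁻¹) (fun y => ⌊3 * y⌋ = b ∧ A (3 * y - ⌊3 * y⌋)) := by
  obtain ⟨lo, h0, h1, h⟩ := h
  have hbr : (0 : ℝ) ≤ b := by exact_mod_cast hb
  have hbr' : (b : ℝ) ≤ 2 := by exact_mod_cast hb'
  refine ⟨(b + lo) / 3, by positivity, by linarith, fun y hy hy' => ?_⟩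
  have hfl : ⌊3 * y⌋ = b := by
    rw [Int.floor_eq_iff]
    constructor <;> linarith
  exact ⟨hfl, by rw [hfl]; exact h _ (by linarith) (by linarith)⟩

end RAM

end

noncomputable section

namespace RAM

/-! ## Walking along an alignment -/

/-- The parameters of the walks: curves have `m` points in dimension `d`, the grid has width `δ`,
and digits are drawn with scale `E` and bound `K`. -/
structure WalkParams where
  m : ℕ
  d : ℕ
  E : ℕ
  K : ℕ
  δ : ℝ

/-- A walk is at point `a` of an input curve and at point `j` of a grid curve with coordinates
`X`; `fresh` tells whether point `j` has still to be drawn, and `y` is the random source. -/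
structure Walk where
  a : ℕ
  j : ℕ
  fresh : Bool
  y : ℝ
  cost : ℝ
  X : ℕ → ℝ

/-- The distance between point `a` of the curve `p` and point `j` of the curve `X`. -/
def pointDist (d : ℕ) (p X : ℕ → ℝ) (j a : ℕ) : ℝ :=
  Real.sqrt (∑ l ∈ Finset.range d, (p (a * d + l) - X (j * d + l)) ^ 2)

variable (P : WalkParams) (p : ℕ → ℝ)

/-- The coordinates after the first `l` coordinates of a fresh point have been drawn. -/
def Walk.draw (st : Walk) (l : ℕ) : ℕ → ℝ :=
  if st.fresh then fun k =>
    if st.j * P.d ≤ k ∧ k < st.j * P.d + l then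
      P.δ * ((⌊p (st.a * P.d + (k - st.j * P.d)) / P.δ⌋ +
        digit P.E P.K ((shift P.E)^[k - st.j * P.d] st.y) : ℤ) : ℝ)
    else st.X k
  else st.X

/-- The random source after the first `l` coordinates of a fresh point have been drawn. -/
def Walk.source (st : Walk) (l : ℕ) : ℝ := if st.fresh then (shift P.E)^[l] st.y else st.y

/-- Draw the current point if it is fresh, and account for the current pair of points. -/
def Walk.visit (st : Walk) : Walk where
  a := st.a
  j := st.j
  fresh := st.fresh
  y := st.source P P.d
  cost := st.cost + pointDist P.d p (st.draw P p P.d) st.j st.a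
  X := st.draw P p P.d

/-- Proceed to the next pair of points, or leave the input curve at the last pair. -/
def Walk.move (m : ℕ) (st : Walk) : Walk :=
  if m ≤ st.j + 1 then { st with a := st.a + 1, fresh := false }
  else if m ≤ st.a + 1 then { st with j := st.j + 1, fresh := true }
  else if ⌊3 * st.y⌋ ≤ 0 then
    { st with a := st.a + 1, fresh := false, y := 3 * st.y - ⌊3 * st.y⌋ }
  else if ⌊3 * st.y⌋ ≤ 1 then
    { st with j := st.j + 1, fresh := true, y := 3 * st.y - ⌊3 * st.y⌋ }
  else
    { st with a := st.a + 1, j := st.j + 1, fresh := true, y := 3 * st.y - ⌊3 * st.y⌋ }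

/-- Walk until the end of the input curve, for at most the given number of rounds. -/
def Walk.run : ℕ → Walk → Walk
  | 0, st => st
  | f + 1, st => if st.a < P.m then Walk.run f ((st.visit P p).move P.m) else st

/-- The start of the walk with source `y`. -/
def Walk.start (y : ℝ) (X : ℕ → ℝ) : Walk := ⟨0, 0, true, y, 0, X⟩

/-- The list `τ` completes an alignment from the pair `(j, a)` on. -/
inductive Path (m : ℕ) : ℕ → ℕ → List (Fin m × Fin m) → Prop
  | last {j a : ℕ} (hj : j < m) (ha : a < m) (hj' : j + 1 = m) (ha' : a + 1 = m) :
      Path m j a [(⟨j, hj⟩, ⟨a, ha⟩)]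
  | cons {j a j' a' : ℕ} {τ : List (Fin m × Fin m)} (hj : j < m) (ha : a < m)
      (hs : (j' = j + 1 ∧ a' = a) ∨ (j' = j ∧ a' = a + 1) ∨ (j' = j + 1 ∧ a' = a + 1))
      (h : Path m j' a' τ) : Path m j a ((⟨j, hj⟩, ⟨a, ha⟩) :: τ)

/-! ### Paths and alignments. -/

theorem Path.lt {m j a : ℕ} {τ : List (Fin m × Fin m)} (h : Path m j a τ) : j < m ∧ a < m := by
  cases h <;> exact ⟨‹_›, ‹_›⟩

/-- Each step raises the sum of the two indices by at least one, and this sum ends at `2 * m - 2`.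
-/
theorem Path.length_le {m j a : ℕ} {τ : List (Fin m × Fin m)} (h : Path m j a τ) :
    τ.length + j + a + 1 ≤ 2 * m := by
  induction h with
  | last hj ha hj' ha' => simp; omega
  | cons hj ha hs h ih => simp; omega

theorem Path.head {m j a : ℕ} {τ : List (Fin m × Fin m)} (h : Path m j a τ) :
    ∃ p τ', τ = p :: τ' ∧ p.1.val = j ∧ p.2.val = a := by
  cases h <;> exact ⟨_, _, rfl, rfl, rfl⟩

theorem Path.isAlignment {m : ℕ} {τ : List (Fin m × Fin m)} (h : Path m 0 0 τ) :
    IsAlignment τ := by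
  have key : ∀ {j a : ℕ} {τ : List (Fin m × Fin m)}, Path m j a τ →
      (∃ p, τ.getLast? = some p ∧ p.1.val + 1 = m ∧ p.2.val + 1 = m) ∧
      τ.IsChain AlignStep := by
    intro j a τ h
    induction h with
    | last hj ha hj' ha' => exact ⟨⟨_, rfl, hj', ha'⟩, by simp⟩
    | @cons j a j' a' τ hj ha hs h ih =>
      obtain ⟨q, τ', rfl, rfl, rfl⟩ := h.head
      refine ⟨?_, ?_⟩
      · rw [List.getLast?_cons_cons]; exact ih.1
      · exact List.isChain_cons_cons.2 ⟨hs, ih.2⟩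
  obtain ⟨q, τ', rfl, h1, h2⟩ := h.head
  exact ⟨⟨q, rfl, h1, h2⟩, (key h).1, (key h).2⟩

theorem path_of_isAlignment {m : ℕ} {τ : List (Fin m × Fin m)} (h : IsAlignment τ) :
    Path m 0 0 τ := by
  have key : ∀ (τ : List (Fin m × Fin m)) (p : Fin m × Fin m),
      (∃ q, (p :: τ).getLast? = some q ∧ q.1.val + 1 = m ∧ q.2.val + 1 = m) →
      (p :: τ).IsChain AlignStep → Path m p.1 p.2 (p :: τ) := by
    intro τ
    induction τ with
    | nil =>
      rintro p ⟨q, hq, h1, h2⟩ -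
      obtain rfl : p = q := by simpa using hq
      exact Path.last p.1.2 p.2.2 h1 h2
    | cons p' τ ih =>
      rintro p hl hc
      rw [List.getLast?_cons_cons] at hl
      rw [List.isChain_cons_cons] at hc
      exact Path.cons p.1.2 p.2.2 hc.1 (ih p' hl hc.2)
  obtain ⟨⟨q, hq, h1, h2⟩, hl, hc⟩ := h
  cases τ with
  | nil => simp at hq
  | cons q' τ =>
    obtain rfl : q' = q := by simpa using hq
    have := key τ q' hl hc
    rwa [h1, h2] at this

/-- The cost of a list of index pairs, for curves given by their coordinates. -/
def pathCost (d : ℕ) (p X : ℕ → ℝ) {m : ℕ} (τ : List (Fin m × Fin m)) : ℝ :=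
  (τ.map fun q => pointDist d p X q.1 q.2).sum

theorem pointDist_congr {d : ℕ} {p X X' : ℕ → ℝ} {j a : ℕ}
    (h : ∀ k < (j + 1) * d, X k = X' k) : pointDist d p X j a = pointDist d p X' j a := by
  unfold pointDist
  congr 1
  refine Finset.sum_congr rfl fun l hl => ?_
  rw [h _ (by rw [Finset.mem_range] at hl; rw [Nat.succ_mul]; omega)]

/-- The number of coordinates that a walk has drawn. -/
def Walk.drawn (st : Walk) (d : ℕ) : ℕ := if st.fresh then st.j * d else (st.j + 1) * d

/-! ### Soundness and completeness of walks. -/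

variable {P p}

theorem Walk.draw_of_lt {st : Walk} {k : ℕ} (hk : k < st.drawn P.d) (l : ℕ) :
    st.draw P p l k = st.X k := by
  unfold Walk.draw Walk.drawn at *
  split_ifs at hk ⊢ with h
  · simp [hk]
  · rfl

theorem Walk.draw_eq {st : Walk} {k : ℕ} (hk : st.drawn P.d ≤ k) (hk' : k < (st.j + 1) * P.d) :
    st.fresh = true ∧ st.draw P p P.d k =
      P.δ * ((⌊p (st.a * P.d + (k - st.j * P.d)) / P.δ⌋ +
        digit P.E P.K ((shift P.E)^[k - st.j * P.d] st.y) : ℤ) : ℝ) := by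
  rw [Nat.succ_mul] at hk'
  unfold Walk.draw Walk.drawn at *
  split_ifs at hk ⊢ with h
  · simp only [h, if_pos (And.intro hk hk'), and_self]
  · rw [Nat.succ_mul] at hk; omega

/-- Every move of a walk before the last pair is a step of an alignment. -/
theorem Walk.move_spec {m : ℕ} {st : Walk} (hj : st.j < m) (ha : st.a < m) (h0 : 0 ≤ st.y)
    (h1 : st.y < 1) :
    (st.move m).X = st.X ∧ (st.move m).cost = st.cost ∧
    0 ≤ (st.move m).y ∧ (st.move m).y < 1 ∧
    (∀ d, (st.move m).drawn d = (st.j + 1) * d) ∧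
    ((st.j + 1 = m ∧ st.a + 1 = m ∧ (st.move m).a = m) ∨
      ((st.move m).j < m ∧ (st.move m).a < m ∧
      (((st.move m).j = st.j + 1 ∧ (st.move m).a = st.a) ∨
        ((st.move m).j = st.j ∧ (st.move m).a = st.a + 1) ∨
        ((st.move m).j = st.j + 1 ∧ (st.move m).a = st.a + 1)))) := by
  have h2 := Int.floor_le (3 * st.y)
  have h3 := Int.lt_floor_add_one (3 * st.y)
  unfold Walk.move
  split_ifs
  · refine ⟨rfl, rfl, h0, h1, by simp [Walk.drawn], ?_⟩
    grind
  · refine ⟨rfl, rfl, h0, h1, by simp [Walk.drawn], ?_⟩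
    grind
  all_goals
    refine ⟨rfl, rfl, by simp only; linarith, by simp only; linarith, by simp [Walk.drawn],
      Or.inr ?_⟩
    grind

/-- Coordinates that have been drawn are never overwritten, so the cost accumulated on the way is
the cost with respect to the final curve. The coordinates stay below `H` because digits are
truncated at `K`. Each round before the last pair raises `a + j`, so the rounds granted by `hf`
reach the end. -/
theorem Walk.run_sound (hE : 0 < P.E) {H : ℤ}
    (hH : ∀ k < P.m * P.d, |⌊p k / P.δ⌋| + P.K ≤ H) (f : ℕ) (st : Walk) (hj : st.j < P.m)
    (ha : st.a < P.m) (hf : 2 * P.m ≤ st.a + st.j + f + 1) (h0 : 0 ≤ st.y) (h1 : st.y < 1)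
    (hX : ∀ k < st.drawn P.d, ∃ z : ℤ, |z| ≤ H ∧ st.X k = P.δ * z) :
    (∀ k < st.drawn P.d, (st.run P p f).X k = st.X k) ∧
    (∀ k < P.m * P.d, ∃ z : ℤ, |z| ≤ H ∧ (st.run P p f).X k = P.δ * z) ∧
    ∃ τ, Path P.m st.j st.a τ ∧
      (st.run P p f).cost = st.cost + pathCost P.d p (st.run P p f).X τ := by
  induction f generalizing st with
  | zero => omega
  | succ f ih =>
    have hY : ∀ k < (st.j + 1) * P.d,
        ∃ z : ℤ, |z| ≤ H ∧ (st.visit P p).X k = P.δ * z := by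
      intro k hk
      by_cases hkd : k < st.drawn P.d
      · obtain ⟨z, hz, he⟩ := hX k hkd
        exact ⟨z, hz, by rw [← he]; exact Walk.draw_of_lt hkd _⟩
      · obtain ⟨hfr, he⟩ := Walk.draw_eq (P := P) (p := p) (not_lt.1 hkd) hk
        refine ⟨_, ?_, he⟩
        have hkj : st.j * P.d ≤ k := by
          rw [Walk.drawn, if_pos hfr] at hkd; omega
        rw [Nat.succ_mul] at hk
        have hb : st.a * P.d + (k - st.j * P.d) < P.m * P.d := by
          have : (st.a + 1) * P.d ≤ P.m * P.d := Nat.mul_le_mul_right _ ha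
          rw [Nat.succ_mul] at this
          omega
        obtain ⟨g0, g1⟩ := iterate_shift_mem hE h0 h1 (k - st.j * P.d)
        have := abs_digit_le (E := P.E) (K := P.K) g0 g1
        have := hH _ hb
        exact (abs_add_le _ _).trans (by omega)
    have hy : 0 ≤ (st.visit P p).y ∧ (st.visit P p).y < 1 := by
      change 0 ≤ st.source P P.d ∧ st.source P P.d < 1
      unfold Walk.source
      split_ifs
      · exact iterate_shift_mem hE h0 h1 _
      · exact ⟨h0, h1⟩
    obtain ⟨eX, ec, ey, ey', ed, hm⟩ := Walk.move_spec (st := st.visit P p) hj ha hy.1 hy.2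
    have hd : st.drawn P.d ≤ (st.j + 1) * P.d := by
      unfold Walk.drawn
      split_ifs
      · exact Nat.mul_le_mul_right _ (Nat.le_succ _)
      · exact le_rfl
    rw [Walk.run, if_pos ha]
    obtain ⟨hj', ha', hend⟩ | ⟨hj', ha', hs⟩ := hm
    -- After the last pair `a = m`, and the remaining rounds are idle.
    · have hrun : ∀ f, Walk.run P p f ((st.visit P p).move P.m) = (st.visit P p).move P.m := by
        intro f
        cases f with
        | zero => rfl
        | succ f => rw [Walk.run, if_neg (by omega)]
      rw [hrun, eX]
      refine ⟨fun k hk => Walk.draw_of_lt hk _, fun k hk => hY k ?_, _,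
        Path.last hj ha hj' ha', ?_⟩
      · exact hk.trans_eq (by rw [show st.j + 1 = P.m from hj'])
      · rw [ec]
        simp [pathCost, Walk.visit]
    · have hvj : (st.visit P p).j = st.j := rfl
      have hva : (st.visit P p).a = st.a := rfl
      obtain ⟨i1, i2, τ, i3, i4⟩ := ih _ hj' ha' (by omega) ey ey' (by
        intro k hk
        rw [ed] at hk
        rw [eX]
        exact hY k hk)
      rw [ed] at i1
      refine ⟨fun k hk => ?_, i2, _, Path.cons hj ha hs i3, ?_⟩
      · rw [i1 k (hk.trans_le hd), eX]
        exact Walk.draw_of_lt hk _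
      · rw [i4, ec]
        simp only [pathCost, List.map_cons, List.sum_cons, ← add_assoc]
        congr 1
        change st.cost + _ = _
        congr 1
        refine pointDist_congr fun k hk => ?_
        rw [i1 k hk, eX]
        rfl

/-- The length of the interval is built up backwards along `τ`: a factor `1 / 3` per pair for the
move, a factor `κ` per grid point that has still to be drawn, and an exponential factor for the size
of its digits, charged by `hZ` to the distance `D` at the pair where the point is drawn. At all
other pairs the exponential factor is given away. The property of `y` speaks of all walks at the
given position, since the earlier history does not affect how `y` is decoded. -/
theorem Walk.run_complete (hE : 0 < P.E) (Z : ℕ → ℤ) (D : ℕ → ℕ → ℝ) {μ : ℝ}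
    (hD : ∀ j a, 0 ≤ μ * D j a)
    (hZ : ∀ j < P.m, ∀ a < P.m, ∑ l ∈ Finset.range P.d,
      |((Z (j * P.d + l) - ⌊p (a * P.d + l) / P.δ⌋ : ℤ) : ℝ)| ≤ μ * D j a + P.d)
    {j a : ℕ} {τ : List (Fin P.m × Fin P.m)} (hτ : Path P.m j a τ)
    (hK : μ * (τ.map fun q => D q.1 q.2).sum + P.d ≤ P.K) (fresh : Bool) :
    Fair ((3⁻¹ : ℝ) ^ τ.length *
        (((2 * P.E : ℝ)⁻¹ * Real.exp (-(4 / P.E))) ^ P.d) ^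
          (P.m - 1 - j + if fresh then 1 else 0) *
        Real.exp (-(2 * μ * (τ.map fun q => D q.1 q.2).sum / P.E)))
      (fun y => ∀ (f : ℕ) (st : Walk), st.j = j → st.a = a → st.fresh = fresh → st.y = y →
        2 * P.m ≤ a + j + f + 1 →
        (∀ k < st.drawn P.d, st.X k = P.δ * Z k) →
        (∀ k < P.m * P.d, (st.run P p f).X k = P.δ * Z k) ∧
        (st.run P p f).cost = st.cost + pathCost P.d p (fun k => P.δ * Z k) τ) := by
  have hE' : (0 : ℝ) < P.E := by exact_mod_cast hE
  have hsum : ∀ τ : List (Fin P.m × Fin P.m),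
      0 ≤ μ * (τ.map fun q => D q.1 q.2).sum := by
    intro τ
    rw [← List.sum_map_mul_left]
    refine List.sum_nonneg fun x hx => ?_
    obtain ⟨q, -, rfl⟩ := List.mem_map.1 hx
    exact hD _ _
  set κ : ℝ := ((2 * P.E : ℝ)⁻¹ * Real.exp (-(4 / P.E))) ^ P.d with hκ
  have hκ0 : 0 < κ := by positivity
  -- Drawing a point.
  have visit : ∀ (j a : ℕ) (hj : j < P.m) (ha : a < P.m) (hK : μ * D j a + P.d ≤ P.K)
      (fresh : Bool) (w : ℝ) (hw : 0 ≤ w) (A : ℝ → Prop), Fair w A →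
      Fair (w * (κ ^ (if fresh then 1 else 0) * Real.exp (-(2 * μ * D j a / P.E))))
        (fun y => ∀ st : Walk, st.j = j → st.a = a → st.fresh = fresh → st.y = y →
          (∀ k < st.drawn P.d, st.X k = P.δ * Z k) →
          (∀ k < (j + 1) * P.d, (st.visit P p).X k = P.δ * Z k) ∧
          A (st.visit P p).y) := by
    intro j a hj ha hK fresh w hw A hA
    cases fresh with
    | false =>
      refine hA.mono ?_ ?_
      · have : Real.exp (-(2 * μ * D j a / P.E)) ≤ 1 := by
          rw [Real.exp_le_one_iff]
          have := hD j a
          rw [mul_assoc]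
          have : 0 ≤ 2 * (μ * D j a) / P.E := by positivity
          linarith
        simp only [Bool.false_eq_true, if_false, pow_zero, one_mul]
        exact mul_le_of_le_one_right hw this
      · rintro y - - hy st rfl rfl hfr rfl hX
        refine ⟨fun k hk => ?_, ?_⟩
        · have hk' : k < st.drawn P.d := by simpa [Walk.drawn, hfr] using hk
          rw [← hX k hk']
          exact Walk.draw_of_lt hk' _
        · simpa [Walk.visit, Walk.source, hfr] using hy
    | true =>
      have hb := hZ j hj a ha
      refine (hA.digits (K := P.K) hE hw
        (fun l => Z (j * P.d + l) - ⌊p (a * P.d + l) / P.δ⌋) P.d ?_).mono ?_ ?_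
      · intro l hl
        have h1 := Finset.single_le_sum (f := fun l =>
          |((Z (j * P.d + l) - ⌊p (a * P.d + l) / P.δ⌋ : ℤ) : ℝ)|) (fun _ _ => abs_nonneg _)
          (Finset.mem_range.2 hl)
        have h2 := (h1.trans hb).trans hK
        exact_mod_cast h2
      · simp only [if_true, pow_one]
        -- One summand `d` is the rounding error in `hZ`, the other comes from the `+ d` in
        -- `Fair.digits`. Together they give the factor `exp (-(4 / E)) ^ d` in `κ`.
        have e1 : κ * Real.exp (-(2 * μ * D j a / P.E)) =
            (2 * P.E : ℝ)⁻¹ ^ P.d * Real.exp (-(2 * ((μ * D j a + P.d) + P.d) / P.E)) := by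
          rw [hκ, mul_pow, ← Real.exp_nat_mul, mul_assoc, ← Real.exp_add]
          congr 2
          ring
        rw [e1]
        gcongr
      · rintro y - - ⟨hy, hyA⟩ st rfl rfl hfr rfl hX
        refine ⟨fun k hk => ?_, ?_⟩
        · by_cases hkd : k < st.drawn P.d
          · rw [← hX k hkd]
            exact Walk.draw_of_lt hkd _
          · have he := (Walk.draw_eq (P := P) (p := p) (not_lt.1 hkd) hk).2
            have hkj : st.j * P.d ≤ k := by
              rw [Walk.drawn, if_pos hfr] at hkd; omega
            rw [Nat.succ_mul] at hk
            change st.draw P p P.d k = _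
            rw [he, hy _ (by omega)]
            simp [Nat.add_sub_cancel' hkj]
        · simpa [Walk.visit, Walk.source, hfr] using hyA
  induction hτ generalizing fresh with
  | @last j a hj ha hj' ha' =>
    have hfair : Fair 1 (fun y => 0 ≤ y ∧ y < 1) :=
      ⟨0, le_rfl, by norm_num, fun y h h' => ⟨h, by simpa using h'⟩⟩
    simp only [List.map_cons, List.map_nil, List.sum_cons, List.sum_nil, add_zero] at hK ⊢
    refine (visit j a hj ha hK fresh 1 zero_le_one _ hfair).mono ?_ ?_
    · rw [show P.m - 1 - j = 0 by omega, zero_add, one_mul]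
      refine mul_le_mul_of_nonneg_right ?_ (Real.exp_pos _).le
      refine mul_le_of_le_one_left (by positivity) ?_
      norm_num
    · rintro y h0 h1 hy f st rfl rfl hfr rfl hf hX
      obtain ⟨hX', hy'⟩ := hy st rfl rfl hfr rfl hX
      have hmv : (st.visit P p).move P.m =
          { st.visit P p with a := st.a + 1, fresh := false } := by
        unfold Walk.move
        rw [if_pos (show P.m ≤ (st.visit P p).j + 1 from hj'.ge)]
        rfl
      obtain ⟨f, rfl⟩ : ∃ g, f = g + 1 := ⟨f - 1, by omega⟩
      have hrun : Walk.run P p (f + 1) st = (st.visit P p).move P.m := by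
        rw [Walk.run, if_pos ha]
        cases f with
        | zero => rfl
        | succ f => rw [Walk.run, if_neg (by rw [hmv]; simp only; omega)]
      rw [hrun, hmv]
      refine ⟨fun k hk => hX' k (by rwa [hj']), ?_⟩
      simp only [pathCost, List.map_cons, List.map_nil, List.sum_cons, List.sum_nil, add_zero]
      change st.cost + _ = _
      congr 1
      exact pointDist_congr hX'
  | @cons j a j' a' τ hj ha hs h ih =>
    simp only [List.map_cons, List.sum_cons] at hK ⊢
    have hK1 : μ * D j a + P.d ≤ P.K := by
      have := hsum τ
      rw [mul_add] at hK
      linarith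
    have hK2 : μ * (τ.map fun q => D q.1 q.2).sum + P.d ≤ P.K := by
      have := hD j a
      rw [mul_add] at hK
      linarith
    obtain ⟨hj'm, ha'm⟩ := h.lt
    -- The effect of the move.
    have hmove : ∃ b : ℤ, 0 ≤ b ∧ b ≤ 2 ∧ ∀ st : Walk, st.j = j → st.a = a →
        ⌊3 * st.y⌋ = b → j + 1 < P.m → a + 1 < P.m →
        (st.move P.m).j = j' ∧ (st.move P.m).a = a' ∧
        (st.move P.m).fresh = decide (j' = j + 1) ∧
        (st.move P.m).y = 3 * st.y - ⌊3 * st.y⌋ := by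
      obtain ⟨rfl, rfl⟩ | ⟨rfl, rfl⟩ | ⟨rfl, rfl⟩ := hs
      · refine ⟨1, by norm_num, by norm_num, ?_⟩
        rintro st rfl rfl hb h1 h2
        simp [Walk.move, hb, not_le.2 h1, not_le.2 h2]
      · refine ⟨0, by norm_num, by norm_num, ?_⟩
        rintro st rfl rfl hb h1 h2
        simp [Walk.move, hb, not_le.2 h1, not_le.2 h2]
      · refine ⟨2, by norm_num, by norm_num, ?_⟩
        rintro st rfl rfl hb h1 h2
        simp [Walk.move, hb, not_le.2 h1, not_le.2 h2]
    obtain ⟨b, hb0, hb2, hb⟩ := hmove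
    have hmv : Fair (3⁻¹ ^ τ.length * κ ^ (P.m - 1 - j' + if j' = j + 1 then 1 else 0) *
        Real.exp (-(2 * μ * (τ.map fun q => D q.1 q.2).sum / P.E)) * 3⁻¹)
        (fun y => ∀ (f : ℕ) (st : Walk), st.j = j → st.a = a → st.y = y → 2 * P.m ≤ a + j + f + 2 →
          (∀ k < (j + 1) * P.d, st.X k = P.δ * Z k) →
          (∀ k < P.m * P.d, ((st.move P.m).run P p f).X k = P.δ * Z k) ∧
          ((st.move P.m).run P p f).cost =
            st.cost + pathCost P.d p (fun k => P.δ * Z k) τ) := by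
      have ih' := ih hK2 (decide (j' = j + 1))
      simp only [decide_eq_true_eq] at ih'
      have main : ∀ (y : ℝ) (f : ℕ) (st : Walk), st.j = j → st.a = a →
          (∀ k < (j + 1) * P.d, st.X k = P.δ * Z k) →
          2 * P.m ≤ a + j + f + 2 → st.j < P.m → st.a < P.m →
          (st.move P.m).j = j' → (st.move P.m).a = a' →
          (st.move P.m).fresh = decide (j' = j + 1) → (st.move P.m).y = y →
          (∀ (f : ℕ) (st : Walk), st.j = j' → st.a = a' → st.fresh = decide (j' = j + 1) → st.y = y →
            2 * P.m ≤ a' + j' + f + 1 →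
            (∀ k < st.drawn P.d, st.X k = P.δ * Z k) →
            (∀ k < P.m * P.d, (st.run P p f).X k = P.δ * Z k) ∧
            (st.run P p f).cost = st.cost + pathCost P.d p (fun k => P.δ * Z k) τ) →
          (∀ k < P.m * P.d, ((st.move P.m).run P p f).X k = P.δ * Z k) ∧
          ((st.move P.m).run P p f).cost =
            st.cost + pathCost P.d p (fun k => P.δ * Z k) τ := by
        intro y f st ej ea hX hf hjm ham mj ma mf my hy
        have mX : (st.move P.m).X = st.X ∧ (st.move P.m).cost = st.cost := by
          unfold Walk.move
          split_ifs <;> exact ⟨rfl, rfl⟩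
        have := hy f (st.move P.m) mj ma mf my (by omega) (by
          intro k hk
          rw [mX.1]
          refine hX k (hk.trans_le ?_)
          unfold Walk.drawn
          rw [mf, mj]
          by_cases hjj : j' = j + 1
          · simp [hjj]
          · have : j' = j := by omega
            simp [this])
        rwa [mX.2] at this
      -- Away from the last row and column the move is read from the source. Otherwise it is forced
      -- and leaves the source alone, and the factor `1 / 3` is given away.
      by_cases hforced : j + 1 < P.m ∧ a + 1 < P.m
      · refine (ih'.third b hb0 hb2).mono le_rfl ?_
        rintro y - - ⟨hyb, hyA⟩ f st ej ea rfl hf hX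
        obtain ⟨mj, ma, mf, my⟩ := hb st ej ea hyb hforced.1 hforced.2
        exact main _ f st ej ea hX hf (by omega) (by omega) mj ma mf my hyA
      · refine ih'.mono (mul_le_of_le_one_right (by positivity) (by norm_num)) ?_
        rintro y - - hyA f st ej ea rfl hf hX
        refine main _ f st ej ea hX hf (by omega) (by omega) ?_ ?_ ?_ ?_ hyA
        all_goals
          subst ej ea
          unfold Walk.move
          split_ifs with h1 h2
          all_goals simp
          all_goals omega
    refine (visit j a hj ha hK1 fresh _ (by positivity) _ hmv).mono ?_ ?_
    · have e1 : Real.exp (-(2 * μ * (D j a + (τ.map fun q => D q.1 q.2).sum) / P.E)) =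
          Real.exp (-(2 * μ * D j a / P.E)) *
          Real.exp (-(2 * μ * (τ.map fun q => D q.1 q.2).sum / P.E)) := by
        rw [← Real.exp_add]
        congr 1
        ring
      -- Once point `j` has been visited, the points after `j` remain to be drawn, whichever move
      -- comes next.
      have e2 : P.m - 1 - j' + (if j' = j + 1 then 1 else 0) = P.m - 1 - j := by
        split_ifs <;> omega
      rw [e2, List.length_cons, pow_succ, pow_add]
      refine le_of_eq ?_
      rw [e1]
      ring
    · rintro y h0 h1 hy f st rfl rfl hfr rfl hf hX
      obtain ⟨hX', hA⟩ := hy st rfl rfl hfr rfl hX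
      obtain ⟨f, rfl⟩ : ∃ g, f = g + 1 := ⟨f - 1, by omega⟩
      obtain ⟨r1, r2⟩ := hA f (st.visit P p) rfl rfl rfl (by omega) hX'
      rw [Walk.run, if_pos ha]
      refine ⟨r1, ?_⟩
      rw [r2]
      simp only [pathCost, List.map_cons, List.sum_cons, ← add_assoc]
      congr 1
      change st.cost + _ = _
      congr 1
      exact pointDist_congr hX'

end RAM

end

noncomputable section

namespace RAM

/-! ## Codes of integer vectors -/

/-- The first `N` entries of `Z`, written with the digits `Z k + H` in base `2 * H + 1`. -/
def code (H : ℤ) (Z : ℕ → ℤ) : ℕ → ℤ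
  | 0 => 0
  | N + 1 => code H Z N * (2 * H + 1) + (Z N + H)

theorem code_mem {H : ℤ} {Z : ℕ → ℤ} {N : ℕ} (hZ : ∀ k < N, |Z k| ≤ H) :
    0 ≤ code H Z N ∧ code H Z N < (2 * H + 1) ^ N := by
  induction N with
  | zero => simp [code]
  | succ N ih =>
    obtain ⟨h0, h1⟩ := ih fun k hk => hZ k (by omega)
    have h2 := abs_le.1 (hZ N (by omega))
    have hH : 0 ≤ H := by omega
    rw [code, pow_succ]
    constructor
    · have : 0 ≤ code H Z N * (2 * H + 1) := by positivity
      omega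
    · nlinarith

theorem code_inj {H : ℤ} {Z Z' : ℕ → ℤ} {N : ℕ} (hZ : ∀ k < N, |Z k| ≤ H)
    (hZ' : ∀ k < N, |Z' k| ≤ H) (h : code H Z N = code H Z' N) : ∀ k < N, Z k = Z' k := by
  induction N with
  | zero => intro k hk; omega
  | succ N ih =>
    have h2 := abs_le.1 (hZ N (by omega))
    have h3 := abs_le.1 (hZ' N (by omega))
    rw [code, code] at h
    -- Different leading parts contribute a difference of at least `2 * H + 1`, while the last
    -- digits differ by at most `2 * H`.
    have h4 : code H Z N = code H Z' N := by
      rcases lt_trichotomy (code H Z N) (code H Z' N) with hlt | heq | hlt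
      · nlinarith
      · exact heq
      · nlinarith
    intro k hk
    rcases Nat.lt_succ_iff_lt_or_eq.1 hk with hk | rfl
    · exact ih (fun k hk => hZ k (by omega)) (fun k hk => hZ' k (by omega)) h4 k hk
    · rw [h4] at h
      omega

theorem code_congr {H : ℤ} {Z Z' : ℕ → ℤ} {N : ℕ} (h : ∀ k < N, Z k = Z' k) :
    code H Z N = code H Z' N := by
  induction N with
  | zero => rfl
  | succ N ih => rw [code, code, ih fun k hk => h k (by omega), h N (by omega)]

/-! ## Dictionaries that consist of three integers -/

/-- The integers `G`, `D` and `A` are the values at `B` of polynomials `g`, `d` and `a` with the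
following property: `g` vanishes exactly at the keys of `f`, and at a key `x` the quotient of `a`
and `d` is the value `f x`. As `B - x` divides `g B - g x`, the value `g x` can be recovered
from `G`. The number `k` bounds the number of keys, and only arguments in `[0, U)` matter. -/
def IsDict (B U V : ℤ) (k : ℕ) (f : ℤ → Option ℕ) (G D A : ℤ) : Prop :=
  ∃ g d a : ℤ → ℤ, ∀ x, 0 ≤ x → x < U →
    (B - x ∣ G - g x ∧ B - x ∣ D - d x ∧ B - x ∣ A - a x) ∧
    (|g x| ≤ V ^ k ∧ |d x| ≤ V ^ k ∧ |a x| ≤ V ^ k) ∧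
    (f x = none → g x ≠ 0) ∧ (∀ i, f x = some i → g x = 0 ∧ d x ≠ 0 ∧ a x = i * d x)

variable {B U V : ℤ} {k : ℕ} {f : ℤ → Option ℕ} {G D A : ℤ}

theorem IsDict.empty : IsDict B U V 0 (fun _ => none) 1 0 0 :=
  ⟨fun _ => 1, fun _ => 0, fun _ => 0, fun x _ _ => by simp⟩

theorem IsDict.mono (h : IsDict B U V k f G D A) (hV : 1 ≤ V) {k' : ℕ} (hk : k ≤ k') :
    IsDict B U V k' f G D A := by
  obtain ⟨g, d, a, h⟩ := h
  have hp : V ^ k ≤ V ^ k' := pow_le_pow_right₀ hV hk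
  refine ⟨g, d, a, fun x h0 h1 => ?_⟩
  obtain ⟨h2, ⟨h3, h4, h5⟩, h6⟩ := h x h0 h1
  exact ⟨h2, ⟨h3.trans hp, h4.trans hp, h5.trans hp⟩, h6⟩

/-- As with a product and its derivative, `g` is multiplied by `x - y`, while `d` and `a` also
receive `g` and `i * g`. At an old key `g` vanishes, so `d` and `a` are scaled by the same nonzero
factor. At the new key only `g y` and `i * g y` remain, and `g y ≠ 0` because `y` was not a key. The
bounds grow by a factor of at most `U + n ≤ V`. -/
theorem IsDict.insert (h : IsDict B U V k f G D A) {n i : ℕ} (hV : U + n ≤ V) (hn : 1 ≤ n)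
    (hi : i ≤ n) {y : ℤ} (hy : 0 ≤ y) (hyU : y < U) (hf : f y = none) :
    IsDict B U V (k + 1) (Function.update f y (some i)) (G * (B - y)) (D * (B - y) + G)
      (A * (B - y) + i * G) := by
  obtain ⟨g, d, a, h⟩ := h
  refine ⟨fun x => g x * (x - y), fun x => d x * (x - y) + g x,
    fun x => a x * (x - y) + i * g x, fun x h0 h1 => ?_⟩
  obtain ⟨⟨g1, d1, a1⟩, ⟨g2, d2, a2⟩, h3, h4⟩ := h x h0 h1
  have hb : B - x ∣ (B - y) - (x - y) := ⟨1, by ring⟩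
  have hmul : ∀ {s t : ℤ}, B - x ∣ s - t → B - x ∣ s * (B - y) - t * (x - y) := by
    intro s t hst
    rw [show s * (B - y) - t * (x - y) = (s - t) * (B - y) + t * ((B - y) - (x - y)) by ring]
    exact (hst.mul_right (B - y)).add (hb.mul_left t)
  have hxy : |x - y| ≤ U := by rw [abs_le]; omega
  have hVk : 0 ≤ V ^ k := (abs_nonneg _).trans g2
  have hi' : (i : ℤ) ≤ n := by exact_mod_cast hi
  have hn' : (1 : ℤ) ≤ n := by exact_mod_cast hn
  have hbound : ∀ {s t : ℤ}, |s| ≤ V ^ k → |t| ≤ n * V ^ k → |s * (x - y) + t| ≤ V ^ (k + 1) := by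
    intro s t hs ht
    calc |s * (x - y) + t| ≤ |s| * |x - y| + |t| := by
          rw [← abs_mul]; exact abs_add_le _ _
      _ ≤ V ^ k * U + n * V ^ k := by gcongr
      _ = V ^ k * (U + n) := by ring
      _ ≤ V ^ k * V := by gcongr
      _ = V ^ (k + 1) := (pow_succ _ _).symm
  refine ⟨⟨hmul g1, ?_, ?_⟩, ⟨?_, ?_, ?_⟩, ?_, ?_⟩
  · rw [show D * (B - y) + G - (d x * (x - y) + g x) =
      (D * (B - y) - d x * (x - y)) + (G - g x) by ring]
    exact (hmul d1).add g1
  · rw [show A * (B - y) + i * G - (a x * (x - y) + i * g x) =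
      (A * (B - y) - a x * (x - y)) + i * (G - g x) by ring]
    exact (hmul a1).add (g1.mul_left (i : ℤ))
  · simpa using hbound (t := 0) g2 (by simpa using by positivity)
  · exact hbound d2 (g2.trans (le_mul_of_one_le_left hVk hn'))
  · refine hbound a2 ?_
    rw [abs_mul, Nat.abs_cast]
    gcongr
  · intro hx
    by_cases hxy : x = y
    · simp [hxy] at hx
    · rw [Function.update_of_ne hxy] at hx
      exact mul_ne_zero (h3 hx) (sub_ne_zero.2 hxy)
  · intro j hj
    by_cases hxy : x = y
    · subst hxy
      obtain rfl : i = j := by simpa using hj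
      simpa using h3 hf
    · rw [Function.update_of_ne hxy] at hj
      obtain ⟨e1, e2, e3⟩ := h4 j hj
      simp only [e1, e3, zero_mul, mul_zero, add_zero, true_and]
      exact ⟨mul_ne_zero e2 (sub_ne_zero.2 hxy), by ring⟩

/-- Modulo `B - y` the integer `G` is congruent to `g y`, whose absolute value is below the modulus,
so divisibility forces `g y = 0`. -/
theorem IsDict.emod_eq_zero_iff (h : IsDict B U V k f G D A) (hB : V ^ k < B - U) {y : ℤ}
    (hy : 0 ≤ y) (hyU : y < U) : G % (B - y) = 0 ↔ f y ≠ none := by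
  obtain ⟨g, d, a, h⟩ := h
  obtain ⟨⟨g1, -, -⟩, ⟨g2, -, -⟩, h3, h4⟩ := h y hy hyU
  rw [← Int.dvd_iff_emod_eq_zero]
  rw [show G = G - g y + g y by ring, dvd_add_right g1]
  constructor
  · intro hg hf
    refine h3 hf (Int.eq_zero_of_abs_lt_dvd hg ?_)
    omega
  · intro hf
    obtain ⟨i, hi⟩ := Option.ne_none_iff_exists'.1 hf
    rw [(h4 i hi).1]
    exact dvd_zero _

/-- The values `d y` and `a y` may be negative, and a remainder would not reveal their signs.
Multiplication by `d y` gives the nonnegative numbers `d y ^ 2` and `i * d y ^ 2`, which are below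
the modulus and hence equal to the remainders. This is why the exponent is `2 * k`. -/
theorem IsDict.lookup (h : IsDict B U V k f G D A) (hV : 1 ≤ V) (hB : V ^ (2 * k) < B - U)
    {y : ℤ} (hy : 0 ≤ y) (hyU : y < U) {i : ℕ} (hi : f y = some i) :
    0 < D * D % (B - y) ∧ A * D % (B - y) = i * (D * D % (B - y)) := by
  obtain ⟨g, d, a, h⟩ := h
  obtain ⟨⟨-, d1, a1⟩, ⟨-, d2, a2⟩, -, h4⟩ := h y hy hyU
  obtain ⟨-, hd, ha⟩ := h4 i hi
  have hmod : ∀ {s t s' t' : ℤ}, B - y ∣ s - s' → B - y ∣ t - t' → |s'| ≤ V ^ k →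
      |t'| ≤ V ^ k → 0 ≤ s' * t' → s * t % (B - y) = s' * t' := by
    intro s t s' t' hs ht hs' ht' h0
    have hlt : s' * t' < B - y := by
      calc s' * t' ≤ |s' * t'| := le_abs_self _
        _ = |s'| * |t'| := abs_mul _ _
        _ ≤ V ^ k * V ^ k := by gcongr
        _ = V ^ (2 * k) := by rw [two_mul, pow_add]
        _ < B - y := by omega
    rw [← Int.emod_eq_of_lt h0 hlt]
    refine (Int.modEq_iff_dvd.2 ?_).symm
    rw [show s * t - s' * t' = (s - s') * t + s' * (t - t') by ring]
    exact (hs.mul_right t).add (ht.mul_left s')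
  rw [hmod d1 d1 d2 d2 (mul_self_nonneg _), hmod a1 d1 a2 d2 ?_, ha]
  · exact ⟨mul_self_pos.2 hd, by ring⟩
  · rw [ha, mul_assoc]
    exact mul_nonneg (Nat.cast_nonneg _) (mul_self_nonneg _)

theorem sub_floor_mul (a : ℤ) {b : ℤ} (hb : 0 < b) :
    (a : ℝ) - ⌊(a : ℝ) / b⌋ * b = ((a % b : ℤ) : ℝ) := by
  have hb' : (0 : ℝ) < b := by exact_mod_cast hb
  have h : ⌊(a : ℝ) / b⌋ = a / b := by
    rw [Int.floor_eq_iff, le_div_iff₀ hb', div_lt_iff₀ hb']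
    have h1 := Int.emod_add_mul_ediv a b
    have h2 := Int.emod_nonneg a hb.ne'
    have h3 := Int.emod_lt_of_pos a hb
    constructor
    · have : a / b * b ≤ a := by linarith
      exact_mod_cast this
    · have : a < (a / b + 1) * b := by linarith
      exact_mod_cast this
  rw [h, Int.emod_def]
  push_cast
  ring

end RAM

end

noncomputable section

namespace RAM

/-! ## The programs

Registers `0` to `4` hold `n, m, d, ε, r`. The preprocessing computes
`5`: the grid width, `6`: `m * d`, `7`: a bound on `1 / ε`, `8`: the number of walks per curve,
`9`: the bound on digits, `10`: the bound on grid coordinates, `11`: the argument `B` of the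
dictionary, `13`: the bound `V` of the dictionary, `14`, `15`, `16`: the dictionary `A, D, G`,
`17`: the current curve, `18`: the current walk, `19`: the acceptance threshold.
Registers from `20` on are working space. Array `1` holds the grid curve or the query curve. -/

section Programs

open RAM.Expr RAM.Cmd

/-- The cell of the current coordinate of the input curve. -/
def inputCell : Expr := cell 0 (reg 17 * reg 6 + (reg 21 * reg 2 + reg 25))

/-- The index of the current coordinate of the grid curve. -/
def gridIndex : Expr := reg 22 * reg 2 + reg 25

/-- Draw the current coordinate of the grid curve. -/
def drawCmd : Cmd := block [
  assign 27 (floor (const 2 * reg 20)),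
  assign 20 (const 2 * reg 20 - reg 27),
  assign 28 (floor (reg 7 * reg 20 / (const 1 - reg 20))),
  assign 20 ((reg 20 * (reg 7 + reg 28) - reg 28) * (reg 7 + reg 28 + const 1) / reg 7),
  ifLe (reg 28) (reg 9) skip (assign 28 (const 0)),
  write 1 gridIndex
    (reg 5 * (floor (inputCell / reg 5) + (const 1 - const 2 * reg 27) * reg 28))]

/-- Process one coordinate of the current pair of points. -/
def coordCmd : Cmd := block [
  ifLe (const 1) (reg 23) drawCmd skip,
  assign 26 (reg 26 + (inputCell - cell 1 gridIndex) * (inputCell - cell 1 gridIndex)),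
  assign 25 (reg 25 + const 1)]

/-- Process the current pair of points. -/
def visitCmd : Cmd := block [
  assign 26 (const 0),
  assign 25 (const 0),
  whileLt (reg 25) (reg 2) coordCmd,
  assign 24 (reg 24 + sqrt (reg 26))]

/-- Proceed to the next pair of points. -/
def moveCmd : Cmd :=
  ifLe (reg 1) (reg 22 + const 1)
    (block [assign 21 (reg 21 + const 1), assign 23 (const 0)])
    (ifLe (reg 1) (reg 21 + const 1)
      (block [assign 22 (reg 22 + const 1), assign 23 (const 1)])
      (block [
        assign 27 (floor (const 3 * reg 20)),
        assign 20 (const 3 * reg 20 - reg 27),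
        ifLe (reg 27) (const 0)
          (block [assign 21 (reg 21 + const 1), assign 23 (const 0)])
          (ifLe (reg 27) (const 1)
            (block [assign 22 (reg 22 + const 1), assign 23 (const 1)])
            (block [assign 21 (reg 21 + const 1), assign 22 (reg 22 + const 1),
              assign 23 (const 1)]))]))

/-- Walk along an alignment. -/
def walkCmd : Cmd := whileLt (reg 21) (reg 1) (block [visitCmd, moveCmd])

/-- Prepare a walk, with source `t / W`. -/
def startCmd : Cmd := block [
  assign 20 (reg 18 / reg 8),
  assign 21 (const 0),
  assign 22 (const 0),
  assign 23 (const 1),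
  assign 24 (const 0)]

/-- Compute the code of the curve in array `1`. -/
def codeCmd : Cmd := block [
  assign 30 (const 0),
  assign 31 (const 0),
  whileLt (reg 31) (reg 6) (block [
    assign 30 (reg 30 * (const 2 * reg 10 + const 1) + (floor (cell 1 (reg 31) / reg 5) + reg 10)),
    assign 31 (reg 31 + const 1)])]

/-- The remainder of `e` modulo `f`. -/
def modExpr (e f : Expr) : Expr := e - floor (e / f) * f

/-- Insert the current curve under the computed code, unless the code is present. -/
def insertCmd : Cmd := block [
  assign 32 (reg 11 - reg 30),
  ifLe (modExpr (reg 16) (reg 32)) (const 0) skip (block [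
    assign 14 (reg 14 * reg 32 + reg 17 * reg 16),
    assign 15 (reg 15 * reg 32 + reg 16),
    assign 16 (reg 16 * reg 32)])]

/-- Perform a walk, and insert the current curve if the walk was cheap. -/
def trialCmd : Cmd := block [
  startCmd,
  walkCmd,
  codeCmd,
  ifLe (reg 24) (reg 19) insertCmd skip,
  assign 18 (reg 18 + const 1)]

/-- Perform all walks along all input curves. -/
def buildCmd : Cmd := block [
  assign 14 (const 0),
  assign 15 (const 0),
  assign 16 (const 1),
  assign 17 (const 0),
  whileLt (reg 17) (reg 0) (block [
    assign 18 (const 0),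
    whileLt (reg 18) (reg 8) trialCmd,
    assign 17 (reg 17 + const 1)])]

/-- The base of the number of walks per curve. -/
def walkBase : ℕ := 18 * 3 ^ 24

/-- Assign `e` to register `a` repeatedly, while register `20` counts from zero to `bound`. -/
def repeatCmd (a : ℕ) (bound e : Expr) : Cmd := block [
  assign 20 (const 0),
  whileLt (reg 20) bound (block [assign a e, assign 20 (reg 20 + const 1)])]

/-- Compute the parameters. -/
def paramCmd : Cmd := block [
  assign 5 (reg 3 * reg 4 / (const 8 * reg 1 * sqrt (reg 2))),
  assign 6 (reg 1 * reg 2),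
  assign 7 (floor (const 1 / reg 3) + const 1),
  assign 9 (const 11 * reg 6 * reg 7),
  assign 19 (reg 4 + reg 3 * reg 4 / const 2),
  assign 8 (const 1),
  repeatCmd 8 (reg 6) (reg 8 * (const walkBase * reg 7)),
  assign 10 (reg 9),
  repeatCmd 10 (reg 0 * reg 6)
    (reg 10 + floor (cell 0 (reg 20) / reg 5) * floor (cell 0 (reg 20) / reg 5)),
  assign 13 (const 1),
  repeatCmd 13 (reg 6) (reg 13 * (const 2 * reg 10 + const 1)),
  assign 13 (reg 13 + reg 0),
  assign 11 (const 2 * reg 13),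
  repeatCmd 11 (reg 0 * reg 8) (reg 11 * (reg 13 * reg 13))]

/-- The preprocessing. -/
def prepCmd : Cmd := block [paramCmd, buildCmd]

/-- Look up the code in the dictionary. -/
def lookupCmd : Cmd := block [
  assign 32 (reg 11 - reg 30),
  ifLe (reg 32) (const 0) skip (block [
    assign 33 (modExpr (reg 15 * reg 15) (reg 32)),
    ifLe (reg 33) (const 0) skip
      (assign 0 (modExpr (reg 14 * reg 15) (reg 32) / reg 33))])]

/-- The query. -/
def queryCmd : Cmd := block [codeCmd, lookupCmd]

end Programs

/-! ## Walks -/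

/-- The facts about the store on which the walks along input curve `i` rely. -/
structure WalkEnv (S : ℕ) (P : WalkParams) (n i : ℕ) (s : Store) : Prop where
  i_lt : i < n
  size : n * (P.m * P.d) ≤ S
  E_pos : 0 < P.E
  δ_pos : 0 < P.δ
  r1 : s.reg 1 = P.m
  r2 : s.reg 2 = P.d
  r5 : s.reg 5 = P.δ
  r6 : s.reg 6 = ((P.m * P.d : ℕ) : ℝ)
  r7 : s.reg 7 = P.E
  r9 : s.reg 9 = P.K
  r17 : s.reg 17 = i

theorem WalkEnv.congr {S : ℕ} {P : WalkParams} {n i : ℕ} {s s' : Store} (h : WalkEnv S P n i s)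
    (hs : ∀ x < 20, s'.reg x = s.reg x) : WalkEnv S P n i s' where
  __ := h
  r1 := by rw [hs _ (by norm_num), h.r1]
  r2 := by rw [hs _ (by norm_num), h.r2]
  r5 := by rw [hs _ (by norm_num), h.r5]
  r6 := by rw [hs _ (by norm_num), h.r6]
  r7 := by rw [hs _ (by norm_num), h.r7]
  r9 := by rw [hs _ (by norm_num), h.r9]
  r17 := by rw [hs _ (by norm_num), h.r17]

theorem index_lt {m d a l : ℕ} (ha : a < m) (hl : l < d) : a * d + l < m * d := by
  have : (a + 1) * d ≤ m * d := Nat.mul_le_mul_right _ ha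
  rw [Nat.succ_mul] at this
  omega

variable {S : ℕ} {P : WalkParams} {n i : ℕ} {s : Store}

theorem WalkEnv.eval_inputCell (h : WalkEnv S P n i s) {a l : ℕ} (ha : a < P.m) (hl : l < P.d)
    (h21 : s.reg 21 = a) (h25 : s.reg 25 = l) :
    inputCell.eval S s = some (s.mem 0 (i * (P.m * P.d) + (a * P.d + l))) := by
  refine eval_cell ((eval_add (eval_mul (eval_reg _) (eval_reg _)) (eval_add
    (eval_mul (eval_reg _) (eval_reg _)) (eval_reg _))).trans ?_)
    ((index_lt h.i_lt (index_lt ha hl)).trans_le h.size)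
  rw [h.r17, h.r6, h.r2, h21, h25]
  push_cast
  rfl

theorem WalkEnv.eval_gridIndex (h : WalkEnv S P n i s) {j l : ℕ}
    (h22 : s.reg 22 = j) (h25 : s.reg 25 = l) :
    gridIndex.eval S s = some ((j * P.d + l : ℕ) : ℝ) := by
  refine (eval_add (eval_mul (eval_reg _) (eval_reg _)) (eval_reg _)).trans ?_
  rw [h.r2, h22, h25]
  push_cast
  rfl

theorem WalkEnv.gridIndex_lt (h : WalkEnv S P n i s) {j l : ℕ} (hj : j < P.m) (hl : l < P.d) :
    j * P.d + l < S :=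
  (index_lt hj hl).trans_le
    ((Nat.le_mul_of_pos_left _ (Nat.zero_lt_of_lt h.i_lt)).trans h.size)

theorem drawCmd_spec (h : WalkEnv S P n i s) {a j l : ℕ} (ha : a < P.m) (hj : j < P.m)
    (hl : l < P.d) (h21 : s.reg 21 = a) (h22 : s.reg 22 = j) (h25 : s.reg 25 = l) :
    Term S drawCmd s 15 fun s' =>
      (∀ x, x ≠ 20 → x ≠ 27 → x ≠ 28 → s'.reg x = s.reg x) ∧
      s'.reg 20 = shift P.E (s.reg 20) ∧ s'.mem 0 = s.mem 0 ∧
      s'.mem 1 = Function.update (s.mem 1) (j * P.d + l)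
        (P.δ * ((⌊s.mem 0 (i * (P.m * P.d) + (a * P.d + l)) / P.δ⌋ +
          digit P.E P.K (s.reg 20) : ℤ) : ℝ)) := by
  have hE : (P.E : ℝ) ≠ 0 := by exact_mod_cast h.E_pos.ne'
  refine Term.assign_cons (v := (⌊2 * s.reg 20⌋ : ℤ))
    (eval_floor (eval_mul (eval_const 2) (eval_reg _))) ?_
  refine Term.assign_cons (v := 2 * s.reg 20 - ⌊2 * s.reg 20⌋)
    ((eval_sub (eval_mul (eval_const _) (eval_reg _)) (eval_reg _)).trans
      (by simp [reg_setReg])) ?_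
  refine Term.assign_cons (v := magnitude P.E (s.reg 20))
    ((eval_floor (eval_div (eval_mul (eval_reg _) (eval_reg _))
      (eval_sub (eval_const _) (eval_reg _)) ?_)).trans ?_) ?_
  -- The denominator is `1` minus a fractional part, hence positive.
  · simp only [reg_setReg]
    norm_num
    intro h0
    have := Int.fract_lt_one (2 * s.reg 20)
    linarith
  · simp [reg_setReg, h.r7, magnitude]
  refine Term.assign_cons (v := shift P.E (s.reg 20))
    ((eval_div (eval_mul (eval_sub (eval_mul (eval_reg _) (eval_add (eval_reg _) (eval_reg _)))
      (eval_reg _)) (eval_add (eval_add (eval_reg _) (eval_reg _)) (eval_const _)))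
      (eval_reg _) ?_).trans ?_) ?_
  · simp [reg_setReg, h.r7, hE]
  · simp [reg_setReg, h.r7, shift]
  refine (Term.cons (T₁ := 2) (T₂ := 3) (Term.mono (Q := fun s' =>
    (∀ x, x ≠ 20 → x ≠ 27 → x ≠ 28 → s'.reg x = s.reg x) ∧
    s'.reg 20 = shift P.E (s.reg 20) ∧ s'.mem = s.mem ∧
    s'.reg 27 = (⌊2 * s.reg 20⌋ : ℤ) ∧
    s'.reg 28 = ((if magnitude P.E (s.reg 20) ≤ P.K then magnitude P.E (s.reg 20) else 0 : ℤ) : ℝ))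
    ?_ le_rfl ?_)).mono (by norm_num) fun _ h => h
  · refine Term.ifLe (v := magnitude P.E (s.reg 20)) (w := P.K) ((eval_reg _).trans ?_)
      ((eval_reg _).trans ?_) (fun hle => ?_) fun hlt => ?_
    · simp [reg_setReg]
    · simp [reg_setReg, h.r9]
    · refine Term.skip ⟨?_, ?_, ?_, ?_, ?_⟩
      · intro x h1 h2 h3
        simp [reg_setReg, h1, h2, h3]
      · simp [reg_setReg]
      · simp [mem_setReg]
      · simp [reg_setReg]
      · rw [if_pos (by exact_mod_cast hle)]
        simp [reg_setReg]
    · refine Term.assign (eval_const 0) ⟨?_, ?_, ?_, ?_, ?_⟩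
      · intro x h1 h2 h3
        simp [reg_setReg, h1, h2, h3]
      · simp [reg_setReg]
      · simp [mem_setReg]
      · simp [reg_setReg]
      · rw [if_neg (by rw [not_le]; exact_mod_cast hlt)]
        simp [reg_setReg]
  · rintro s' ⟨e, e20, em, e27, e28⟩
    have h' : WalkEnv S P n i s' := h.congr fun x hx => e x (by omega) (by omega) (by omega)
    have e5 := h'.r5
    have e21 : s'.reg 21 = a := by rw [e _ (by norm_num) (by norm_num) (by norm_num), h21]
    have e22 : s'.reg 22 = j := by rw [e _ (by norm_num) (by norm_num) (by norm_num), h22]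
    have e25 : s'.reg 25 = l := by rw [e _ (by norm_num) (by norm_num) (by norm_num), h25]
    refine Term.write_cons (h'.eval_gridIndex e22 e25) (h.gridIndex_lt hj hl)
      (eval_mul (eval_reg _) (eval_add (eval_floor (eval_div (h'.eval_inputCell ha hl e21 e25)
        (eval_reg _) (by rw [e5]; exact h.δ_pos.ne')))
        (eval_mul (eval_sub (eval_const _) (eval_mul (eval_const _) (eval_reg _)))
        (eval_reg _)))) ?_
    refine Term.nil ⟨by simpa only [reg_setCell] using e, e20, ?_, ?_⟩
    · simp [mem_setCell, em]
    · rw [mem_setCell, if_pos rfl, e5, e27, e28, em]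
      unfold digit
      push_cast
      rfl

end RAM

end

/-! ### Simulation of walks by the machine. -/

noncomputable section

namespace RAM

/-- The coordinates of curve `i` in array `0`. -/
def curveOf (P : WalkParams) (i : ℕ) (s : Store) (k : ℕ) : ℝ := s.mem 0 (i * (P.m * P.d) + k)

/-- The store `s` represents the walk `st`, and otherwise agrees with `s₀`. -/
structure Sim (s₀ : Store) (st : Walk) (s : Store) : Prop where
  low : ∀ x < 20, s.reg x = s₀.reg x
  mem : s.mem 0 = s₀.mem 0
  r20 : s.reg 20 = st.y
  r21 : s.reg 21 = st.a
  r22 : s.reg 22 = st.j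
  r23 : s.reg 23 = if st.fresh then 1 else 0
  r24 : s.reg 24 = st.cost
  X : s.mem 1 = st.X

/-- The store `s` represents the walk `st` when `l` coordinates have been processed. -/
structure CoordInv (P : WalkParams) (i : ℕ) (s₀ : Store) (st : Walk) (l : ℕ) (s : Store) :
    Prop where
  low : ∀ x < 20, s.reg x = s₀.reg x
  mem : s.mem 0 = s₀.mem 0
  r20 : s.reg 20 = st.source P l
  r21 : s.reg 21 = st.a
  r22 : s.reg 22 = st.j
  r23 : s.reg 23 = if st.fresh then 1 else 0
  r24 : s.reg 24 = st.cost
  r25 : s.reg 25 = l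
  r26 : s.reg 26 = ∑ k ∈ Finset.range l, (curveOf P i s₀ (st.a * P.d + k) -
    st.draw P (curveOf P i s₀) P.d (st.j * P.d + k)) ^ 2
  X : s.mem 1 = st.draw P (curveOf P i s₀) l

theorem Walk.draw_succ (P : WalkParams) (p : ℕ → ℝ) (st : Walk) (l : ℕ)
    (hf : st.fresh = true) :
    st.draw P p (l + 1) = Function.update (st.draw P p l) (st.j * P.d + l)
      (P.δ * ((⌊p (st.a * P.d + l) / P.δ⌋ + digit P.E P.K (st.source P l) : ℤ) : ℝ)) := by
  funext k
  simp only [Walk.draw, Walk.source, hf, if_true]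
  by_cases hk : k = st.j * P.d + l
  · subst hk
    rw [Function.update_self, if_pos ⟨by omega, by omega⟩, Nat.add_sub_cancel_left]
  · rw [Function.update_of_ne hk]
    by_cases h : st.j * P.d ≤ k ∧ k < st.j * P.d + l
    · rw [if_pos h, if_pos ⟨h.1, by omega⟩]
    · rw [if_neg h, if_neg (by omega)]

/-- The machine reads a coordinate as soon as it is written, whereas `CoordInv` refers to the
completed point; later writes go to other cells. -/
theorem Walk.draw_index (P : WalkParams) (p : ℕ → ℝ) (st : Walk) {l : ℕ} (hl : l < P.d) :
    st.draw P p (l + 1) (st.j * P.d + l) = st.draw P p P.d (st.j * P.d + l) := by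
  unfold Walk.draw
  split_ifs
  · simp [hl]
  · rfl

variable {S : ℕ} {P : WalkParams} {n i : ℕ} {s s₀ : Store}

theorem coordCmd_spec (h₀ : WalkEnv S P n i s₀) {st : Walk} {l : ℕ} (ha : st.a < P.m)
    (hj : st.j < P.m) (hl : l < P.d) (hs : CoordInv P i s₀ st l s) :
    Term S coordCmd s 25 (CoordInv P i s₀ st (l + 1)) := by
  have h := h₀.congr hs.low
  refine (Term.cons (T₁ := 16) (T₂ := 5) (Term.mono (Q := fun s' =>
    (∀ x, x ≠ 20 → x ≠ 27 → x ≠ 28 → s'.reg x = s.reg x) ∧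
      s'.reg 20 = st.source P (l + 1) ∧ s'.mem 0 = s.mem 0 ∧
      s'.mem 1 = st.draw P (curveOf P i s₀) (l + 1)) ?_ le_rfl ?_)).mono (by norm_num)
    fun _ h => h
  · refine Term.ifLe (v := 1) (w := s.reg 23) ((eval_const 1).trans (by simp)) (eval_reg _)
      (fun hle => ?_) fun hlt => ?_
    · have hf : st.fresh = true := by
        rw [hs.r23] at hle
        by_contra hf
        rw [if_neg hf] at hle
        norm_num at hle
      refine (drawCmd_spec h ha hj hl hs.r21 hs.r22 hs.r25).mono le_rfl ?_
      rintro s' ⟨e, e20, em, eX⟩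
      refine ⟨e, ?_, em, ?_⟩
      · rw [e20, hs.r20]
        simp [Walk.source, hf, Function.iterate_succ_apply']
      · rw [eX, hs.X, hs.mem, hs.r20, Walk.draw_succ _ _ _ _ hf]
        rfl
    · have hf : st.fresh = false := by
        rw [hs.r23] at hlt
        by_contra hf
        rw [if_pos (by simpa using hf)] at hlt
        exact lt_irrefl _ hlt
      refine Term.skip ⟨fun _ _ _ _ => rfl, ?_, rfl, ?_⟩
      · rw [hs.r20]; simp [Walk.source, hf]
      · rw [hs.X]; simp [Walk.draw, hf]
  · rintro s' ⟨e, e20, em, eX⟩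
    have h' : WalkEnv S P n i s' := h.congr fun x hx => e x (by omega) (by omega) (by omega)
    have e21 : s'.reg 21 = st.a := by
      rw [e _ (by norm_num) (by norm_num) (by norm_num), hs.r21]
    have e22 : s'.reg 22 = st.j := by
      rw [e _ (by norm_num) (by norm_num) (by norm_num), hs.r22]
    have e23 := (e 23 (by norm_num) (by norm_num) (by norm_num)).trans hs.r23
    have e24 := (e 24 (by norm_num) (by norm_num) (by norm_num)).trans hs.r24
    have e25 : s'.reg 25 = l := by
      rw [e _ (by norm_num) (by norm_num) (by norm_num), hs.r25]
    have e26 := (e 26 (by norm_num) (by norm_num) (by norm_num)).trans hs.r26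
    have hdiff := eval_sub (h'.eval_inputCell ha hl e21 e25)
      (eval_cell (a := 1) (h'.eval_gridIndex e22 e25) (h.gridIndex_lt hj hl))
    refine Term.assign_cons (eval_add (eval_reg _) (eval_mul hdiff hdiff)) ?_
    refine Term.assign_cons (eval_add (eval_reg _) (eval_const 1)) ?_
    refine Term.nil ⟨?_, ?_, ?_, ?_, ?_, ?_, ?_, ?_, ?_, ?_⟩
    · intro x hx
      rw [← hs.low x hx, ← e x (by omega) (by omega) (by omega), reg_setReg, if_neg (by omega),
        reg_setReg, if_neg (by omega)]
    · rw [← hs.mem, ← em]; rfl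
    · simpa [reg_setReg] using e20
    · simpa [reg_setReg] using e21
    · simpa [reg_setReg] using e22
    · simpa [reg_setReg] using e23
    · simpa [reg_setReg] using e24
    · simp [reg_setReg, e25]
    · simp only [reg_setReg]
      norm_num
      rw [e26, Finset.sum_range_succ, eX, em, hs.mem, Walk.draw_index _ _ _ hl, ← sq]
      rfl
    · exact eX

theorem visitCmd_spec (h₀ : WalkEnv S P n i s₀) {st : Walk} (ha : st.a < P.m)
    (hj : st.j < P.m) (hs : Sim s₀ st s) :
    Term S visitCmd s (26 * P.d + 9) (Sim s₀ (st.visit P (curveOf P i s₀))) := by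
  refine Term.mono (T₁ := (P.d * (25 + 1) + 1 + 3 + 1) + 2 + 2) ?_ (by omega) fun _ h => h
  refine Term.assign_cons (eval_const 0) (Term.assign_cons (eval_const 0) ?_)
  refine Term.cons (T₁ := P.d * (25 + 1) + 1) (T₂ := 3) ((Term.for_loop (CoordInv P i s₀ st) P.d 25 (fun _ _ h => h.r25)
    (fun _ s h => ?_) (fun l s hl h => coordCmd_spec h₀ ha hj hl h) ?_).mono le_rfl ?_)
  · exact (eval_reg _).trans (by rw [h.low _ (by norm_num), h₀.r2])
  · refine ⟨?_, hs.mem, ?_, ?_, ?_, ?_, ?_, ?_, ?_, ?_⟩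
    · intro x hx
      rw [← hs.low x hx, reg_setReg, if_neg (by omega), reg_setReg, if_neg (by omega)]
    · simp [reg_setReg, hs.r20, Walk.source]
    · simp [reg_setReg, hs.r21]
    · simp [reg_setReg, hs.r22]
    · simp [reg_setReg, hs.r23]
    · simp [reg_setReg, hs.r24]
    · simp [reg_setReg]
    · simp [reg_setReg]
    · change s.mem 1 = _
      rw [hs.X]
      unfold Walk.draw
      split_ifs
      · funext k
        rw [if_neg (by omega)]
      · rfl
  · intro s' hs'
    refine Term.assign_cons (eval_add (eval_reg _) (eval_sqrt (eval_reg _) ?_)) (Term.nil ?_)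
    · rw [hs'.r26]
      positivity
    · refine ⟨?_, hs'.mem, ?_, ?_, ?_, ?_, ?_, ?_⟩
      · intro x hx
        rw [← hs'.low x hx, reg_setReg, if_neg (by omega)]
      · simp [reg_setReg, hs'.r20, Walk.visit]
      · simp [reg_setReg, hs'.r21, Walk.visit]
      · simp [reg_setReg, hs'.r22, Walk.visit]
      · exact (reg_setReg _ _ _).trans hs'.r23
      · simp [reg_setReg, hs'.r24, hs'.r26, Walk.visit, pointDist]
      · exact hs'.X

theorem Sim.setReg {st : Walk} (hs : Sim s₀ st s) {a j : ℕ} {fresh : Bool} {y : ℝ} {s' : Store}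
    (hlow : ∀ x < 20, s'.reg x = s.reg x) (hmem : s'.mem = s.mem) (h20 : s'.reg 20 = y)
    (h21 : s'.reg 21 = a) (h22 : s'.reg 22 = j) (h23 : s'.reg 23 = if fresh then 1 else 0)
    (h24 : s'.reg 24 = s.reg 24) :
    Sim s₀ { st with a := a, j := j, fresh := fresh, y := y } s' :=
  ⟨fun x hx => (hlow x hx).trans (hs.low x hx), by rw [hmem, hs.mem], h20, h21, h22, h23,
    by rw [h24, hs.r24], by rw [hmem, hs.X]⟩

theorem moveCmd_spec (h₀ : WalkEnv S P n i s₀) {st : Walk} (hs : Sim s₀ st s) :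
    Term S moveCmd s 20 (Sim s₀ (st.move P.m)) := by
  have h := h₀.congr hs.low
  have cast_le : ∀ k : ℕ, ((P.m : ℝ) ≤ k + (1 : ℕ)) ↔ P.m ≤ k + 1 := fun k => by
    exact_mod_cast Iff.rfl
  refine Term.ifLe (T := 19) (eval_reg _) (eval_add (eval_reg _) (eval_const 1)) (fun hle => ?_)
    fun hlt => ?_
  · rw [h.r1, hs.r22, cast_le] at hle
    refine Term.assign_cons (eval_add (eval_reg _) (eval_const 1)) (Term.assign_cons
      (eval_const 0) (Term.nil ?_))
    rw [Walk.move, if_pos hle]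
    refine hs.setReg (fun x hx => ?_) rfl ?_ ?_ ?_ ?_ ?_
    · rw [reg_setReg, if_neg (by omega), reg_setReg, if_neg (by omega)]
    all_goals simp [reg_setReg, hs.r20, hs.r21, hs.r22]
  rw [← not_le, h.r1, hs.r22, cast_le] at hlt
  refine Term.ifLe (T := 18) (eval_reg _) (eval_add (eval_reg _) (eval_const 1)) (fun hle => ?_)
    fun hlt' => ?_
  · rw [h.r1, hs.r21, cast_le] at hle
    refine Term.assign_cons (eval_add (eval_reg _) (eval_const 1)) (Term.assign_cons
      (eval_const 1) (Term.nil ?_))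
    rw [Walk.move, if_neg hlt, if_pos hle]
    refine hs.setReg (fun x hx => ?_) rfl ?_ ?_ ?_ ?_ ?_
    · rw [reg_setReg, if_neg (by omega), reg_setReg, if_neg (by omega)]
    all_goals simp [reg_setReg, hs.r20, hs.r21, hs.r22]
  rw [← not_le, h.r1, hs.r21, cast_le] at hlt'
  refine Term.assign_cons (v := (⌊3 * st.y⌋ : ℤ))
    ((eval_floor (eval_mul (eval_const 3) (eval_reg _))).trans (by rw [hs.r20]; rfl)) ?_
  refine Term.assign_cons (v := 3 * st.y - ⌊3 * st.y⌋)
    ((eval_sub (eval_mul (eval_const _) (eval_reg _)) (eval_reg _)).trans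
      (by simp [reg_setReg, hs.r20])) ?_
  refine (Term.cons (T₁ := 11) (T₂ := 1) (Term.mono (T₁ := 11) ?_ le_rfl
    fun s' hs' => Term.nil hs')).mono (by norm_num) fun _ h => h
  refine Term.ifLe (v := (⌊3 * st.y⌋ : ℤ)) (w := 0) ((eval_reg _).trans (by simp [reg_setReg]))
    ((eval_const 0).trans (by simp)) (fun hle => ?_) fun hlt'' => ?_
  · have hle' : ⌊3 * st.y⌋ ≤ 0 := by exact_mod_cast hle
    refine Term.assign_cons (eval_add (eval_reg _) (eval_const 1)) (Term.assign_cons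
      (eval_const 0) (Term.nil ?_))
    rw [Walk.move, if_neg hlt, if_neg hlt', if_pos hle']
    refine hs.setReg (fun x hx => ?_) rfl ?_ ?_ ?_ ?_ ?_
    · iterate 4 rw [reg_setReg, if_neg (by omega)]
    all_goals simp [reg_setReg, hs.r21, hs.r22]
  have hlt₀ : ¬ ⌊3 * st.y⌋ ≤ 0 := by rw [not_le]; exact_mod_cast hlt''
  refine Term.ifLe (v := (⌊3 * st.y⌋ : ℤ)) (w := 1) ((eval_reg _).trans (by simp [reg_setReg]))
    ((eval_const 1).trans (by simp)) (fun hle => ?_) fun hlt₁ => ?_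
  · have hle' : ⌊3 * st.y⌋ ≤ 1 := by exact_mod_cast hle
    refine Term.assign_cons (eval_add (eval_reg _) (eval_const 1)) (Term.assign_cons
      (eval_const 1) (Term.nil ?_))
    rw [Walk.move, if_neg hlt, if_neg hlt', if_neg hlt₀, if_pos hle']
    refine hs.setReg (fun x hx => ?_) rfl ?_ ?_ ?_ ?_ ?_
    · iterate 4 rw [reg_setReg, if_neg (by omega)]
    all_goals simp [reg_setReg, hs.r21, hs.r22]
  · have hlt₁' : ¬ ⌊3 * st.y⌋ ≤ 1 := by rw [not_le]; exact_mod_cast hlt₁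
    refine Term.assign_cons (eval_add (eval_reg _) (eval_const 1)) (Term.assign_cons
      (eval_add (eval_reg _) (eval_const 1)) (Term.assign_cons
      (eval_const 1) (Term.nil ?_)))
    rw [Walk.move, if_neg hlt, if_neg hlt', if_neg hlt₀, if_neg hlt₁']
    refine hs.setReg (fun x hx => ?_) rfl ?_ ?_ ?_ ?_ ?_
    · iterate 5 rw [reg_setReg, if_neg (by omega)]
    all_goals simp [reg_setReg, hs.r21, hs.r22]

/-- The bound on rounds is only required while `st.a < m`, so that the induction also covers the
store after the last pair. The last move advances `a` alone, so `st.j < m` persists. -/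
theorem walkCmd_spec (h₀ : WalkEnv S P n i s₀) (f : ℕ) {st : Walk} (ha : st.a ≤ P.m)
    (hj : st.j < P.m) (hf : st.a < P.m → 2 * P.m ≤ st.a + st.j + f + 1) (h0 : 0 ≤ st.y)
    (h1 : st.y < 1) (hs : Sim s₀ st s) :
    Term S walkCmd s (f * (26 * P.d + 34) + 1) (Sim s₀ (st.run P (curveOf P i s₀) f)) := by
  have hr1 : ∀ {s st}, Sim s₀ st s → (Expr.reg 1).eval S s = some (P.m : ℝ) := fun h =>
    (eval_reg _).trans (by rw [h.low _ (by norm_num), h₀.r1])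
  have hr21 : ∀ {s st}, Sim s₀ st s → (Expr.reg 21).eval S s = some (st.a : ℝ) := fun h =>
    (eval_reg _).trans (by rw [h.r21])
  have hdone : ∀ {f s st}, Sim s₀ st s → st.a = P.m →
      Term S walkCmd s (f * (26 * P.d + 34) + 1) (Sim s₀ (st.run P (curveOf P i s₀) f)) := by
    intro f s st hs ha
    have hrun : st.run P (curveOf P i s₀) f = st := by
      cases f with
      | zero => rfl
      | succ f => rw [Walk.run, if_neg (by omega)]
    rw [hrun]
    exact Term.while_done (hr21 hs) (hr1 hs) (by rw [ha]) hs
  induction f generalizing s st with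
  | zero => exact hdone hs (by omega)
  | succ f ih =>
    rcases ha.eq_or_lt with ha' | ha'
    · exact hdone hs ha'
    have hy : 0 ≤ (st.visit P (curveOf P i s₀)).y ∧ (st.visit P (curveOf P i s₀)).y < 1 := by
      change 0 ≤ st.source P P.d ∧ st.source P P.d < 1
      unfold Walk.source
      split_ifs
      · exact iterate_shift_mem h₀.E_pos h0 h1 _
      · exact ⟨h0, h1⟩
    obtain ⟨-, -, ey, ey', -, hm⟩ := Walk.move_spec (st := st.visit P (curveOf P i s₀))
      hj ha' hy.1 hy.2
    have hvj : (st.visit P (curveOf P i s₀)).j = st.j := rfl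
    have hva : (st.visit P (curveOf P i s₀)).a = st.a := rfl
    have hjm : ((st.visit P (curveOf P i s₀)).move P.m).j < P.m := by
      obtain ⟨e1, e2, e3⟩ | ⟨e1, -⟩ := hm
      · unfold Walk.move
        rw [if_pos e1.ge]
        exact hj
      · exact e1
    rw [Walk.run, if_pos ha']
    refine (Term.while_step (hr21 hs) (hr1 hs) (by exact_mod_cast ha')
      (Term.cons ((visitCmd_spec h₀ ha' hj hs).mono le_rfl fun s' hs' =>
        Term.cons ((moveCmd_spec h₀ hs').mono le_rfl fun s'' hs'' => Term.nil (T := 0)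
          (ih (by omega) hjm (by omega) ey ey' hs''))))).mono ?_ fun _ h => h
    rw [add_mul f 1 (26 * P.d + 34)]
    omega

end RAM

end

noncomputable section

namespace RAM

/-! ## Codes and the dictionary -/

variable {S : ℕ} {P : WalkParams} {n : ℕ} {s s₀ : Store}

theorem codeCmd_spec {N : ℕ} {δ : ℝ} {H : ℤ} (hN : N ≤ S) (hδ : 0 < δ) (h5 : s.reg 5 = δ)
    (h6 : s.reg 6 = N) (h10 : s.reg 10 = H) :
    Term S codeCmd s (6 * N + 7) fun s' =>
      (∀ x, x < 30 → s'.reg x = s.reg x) ∧ s'.mem = s.mem ∧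
      s'.reg 30 = code H (fun k => ⌊s.mem 1 k / δ⌋) N := by
  refine Term.mono (T₁ := (N * (5 + 1) + 1) + 1 + 1 + 2 + 2) ?_ (by omega) fun _ h => h
  refine Term.assign_cons (eval_const 0) (Term.assign_cons (eval_const 0) ?_)
  refine Term.cons (T₁ := N * (5 + 1) + 1) (T₂ := 1) ((Term.for_loop (fun k s' =>
    (∀ x, x < 30 → s'.reg x = s.reg x) ∧ s'.mem = s.mem ∧ s'.reg 31 = k ∧
      s'.reg 30 = code H (fun k => ⌊s.mem 1 k / δ⌋) k) N 31 (fun _ _ h => h.2.2.1)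
    (fun _ s' h => (eval_reg _).trans (by rw [h.1 _ (by norm_num), h6])) ?_ ?_).mono le_rfl
    fun s' h => Term.nil ⟨h.1, h.2.1, h.2.2.2⟩)
  · rintro k s' hk ⟨e, em, e31, e30⟩
    have e5 := (e 5 (by norm_num)).trans h5
    have e10 := (e 10 (by norm_num)).trans h10
    refine Term.assign_cons (v := code H (fun k => ⌊s.mem 1 k / δ⌋) (k + 1))
      ((eval_add (eval_mul (eval_reg _) (eval_add (eval_mul (eval_const _) (eval_reg _))
        (eval_const _))) (eval_add (eval_floor (eval_div (eval_cell (k := k)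
          ((eval_reg _).trans (by rw [e31])) (hk.trans_le hN)) (eval_reg _)
          (by rw [e5]; exact hδ.ne'))) (eval_reg _))).trans ?_)
      (Term.assign_cons (eval_add (eval_reg _) (eval_const 1)) (Term.nil ⟨?_, em, ?_, ?_⟩))
    · rw [e30, e10, em, e5, code]
      push_cast
      rfl
    · intro x hx
      rw [← e x hx, reg_setReg, if_neg (by omega), reg_setReg, if_neg (by omega)]
    · simp [reg_setReg, e31]
    · simp [reg_setReg]
  · refine ⟨fun x hx => ?_, rfl, ?_, ?_⟩
    · rw [reg_setReg, if_neg (by omega), reg_setReg, if_neg (by omega)]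
    · simp [reg_setReg]
    · simp [reg_setReg, code]

theorem eval_modExpr {e f : Expr} {v w : ℤ} (he : e.eval S s = some (v : ℝ))
    (hf : f.eval S s = some (w : ℝ)) (hw : 0 < w) :
    (modExpr e f).eval S s = some ((v % w : ℤ) : ℝ) := by
  refine (eval_sub he (eval_mul (eval_floor (eval_div he hf ?_)) hf)).trans ?_
  · exact_mod_cast hw.ne'
  · rw [sub_floor_mul _ hw]

/-- The registers `14`, `15`, `16` of `s` hold a dictionary with content `f`. -/
def Holds (B U V : ℤ) (k : ℕ) (f : ℤ → Option ℕ) (s : Store) : Prop :=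
  ∃ G D A : ℤ, IsDict B U V k f G D A ∧ s.reg 14 = A ∧ s.reg 15 = D ∧ s.reg 16 = G

variable {B U V : ℤ} {k : ℕ} {f : ℤ → Option ℕ}

theorem Holds.congr {s' : Store} (h : Holds B U V k f s)
    (hs : ∀ x, 14 ≤ x → x ≤ 16 → s'.reg x = s.reg x) : Holds B U V k f s' := by
  obtain ⟨G, D, A, h, h14, h15, h16⟩ := h
  exact ⟨G, D, A, h, by rw [hs _ (by norm_num) (by norm_num), h14],
    by rw [hs _ (by norm_num) (by norm_num), h15], by rw [hs _ (by norm_num) (by norm_num), h16]⟩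

/-- The exponent `k` increases even if the key is already present, so it simply counts the walks.
Keeping the older entry is harmless, since any accepted curve is a valid answer. -/
theorem insertCmd_spec {i : ℕ} {y : ℤ} (h : Holds B U V k f s) (hV : U + n ≤ V) (hn : 1 ≤ n)
    (hi : i ≤ n) (hB : V ^ k < B - U) (hy : 0 ≤ y) (hyU : y < U) (h11 : s.reg 11 = B)
    (h17 : s.reg 17 = i) (h30 : s.reg 30 = y) :
    Term S insertCmd s 12 fun s' =>
      (∀ x, x < 20 → x ≠ 14 → x ≠ 15 → x ≠ 16 → s'.reg x = s.reg x) ∧ s'.mem = s.mem ∧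
      Holds B U V (k + 1) (if f y = none then Function.update f y (some i) else f) s' := by
  obtain ⟨G, D, A, hd, h14, h15, h16⟩ := h
  have hU : 1 ≤ V := by omega
  have hM : 0 < B - y := by
    have : 0 < V ^ k := by positivity
    omega
  refine Term.assign_cons (v := ((B - y : ℤ) : ℝ))
    ((eval_sub (eval_reg _) (eval_reg _)).trans (by rw [h11, h30]; push_cast; rfl)) ?_
  refine Term.cons (T₁ := 8) (T₂ := 1) (Term.mono (T₁ := 8) ?_ le_rfl
    fun s' hs' => Term.nil hs')
  refine Term.ifLe (v := ((G % (B - y) : ℤ) : ℝ)) (w := 0)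
    (eval_modExpr ((eval_reg _).trans (by simp [reg_setReg, h16]))
      ((eval_reg _).trans (by simp [reg_setReg])) hM) ((eval_const 0).trans (by simp))
    (fun hle => ?_) fun hlt => ?_
  · have h0 : G % (B - y) = 0 :=
      le_antisymm (by exact_mod_cast hle) (Int.emod_nonneg _ hM.ne')
    rw [hd.emod_eq_zero_iff hB hy hyU] at h0
    refine Term.skip ⟨fun x hx _ _ _ => ?_, rfl, ?_⟩
    · rw [reg_setReg, if_neg (by omega)]
    · rw [if_neg h0]
      exact ⟨G, D, A, hd.mono hU (Nat.le_succ k), by simp [reg_setReg, h14],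
        by simp [reg_setReg, h15], by simp [reg_setReg, h16]⟩
  · have h0 : ¬ f y ≠ none := by
      rw [← hd.emod_eq_zero_iff hB hy hyU]
      intro h
      rw [h] at hlt
      simp at hlt
    rw [not_not] at h0
    refine Term.assign_cons (eval_add (eval_mul (eval_reg _) (eval_reg _))
      (eval_mul (eval_reg _) (eval_reg _))) ?_
    refine Term.assign_cons (eval_add (eval_mul (eval_reg _) (eval_reg _)) (eval_reg _)) ?_
    refine Term.assign_cons (eval_mul (eval_reg _) (eval_reg _)) ?_
    refine Term.nil ⟨fun x hx h14 h15 h16 => ?_, rfl, ?_⟩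
    · iterate 4 rw [reg_setReg, if_neg (by omega)]
    · rw [if_pos h0]
      refine ⟨_, _, _, hd.insert hV hn hi hy hyU h0, ?_, ?_, ?_⟩
      · simp [reg_setReg, h14, h16, h17]
      · simp [reg_setReg, h15, h16]
      · simp [reg_setReg, h16]

/-- Nothing is assumed about the range of `y`: a query far from all input curves may have a code
outside `[0, U)` and must still halt. The two tests protect the divisions, and the answer matters
only for keys. -/
theorem lookupCmd_spec {y : ℤ} (h : Holds B U V k f s) (hV : 1 ≤ V)
    (hB : V ^ (2 * k) < B - U) (h11 : s.reg 11 = B) (h30 : s.reg 30 = y) :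
    Term S lookupCmd s 12 fun s' =>
      (∀ x, x < 20 → x ≠ 0 → s'.reg x = s.reg x) ∧
      (0 ≤ y → y < U → ∀ i, f y = some i → s'.reg 0 = i) := by
  obtain ⟨G, D, A, hd, h14, h15, h16⟩ := h
  have hM : y < U → 0 < B - y := by
    have : 0 < V ^ (2 * k) := by positivity
    omega
  refine Term.assign_cons (v := ((B - y : ℤ) : ℝ))
    ((eval_sub (eval_reg _) (eval_reg _)).trans (by rw [h11, h30]; push_cast; rfl)) ?_
  refine Term.cons (T₁ := 8) (T₂ := 1) (Term.mono (T₁ := 8) ?_ le_rfl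
    fun s' hs' => Term.nil hs')
  refine Term.ifLe (v := ((B - y : ℤ) : ℝ)) (w := 0) ((eval_reg _).trans (by simp [reg_setReg]))
    ((eval_const 0).trans (by simp)) (fun hle => ?_) fun hlt => ?_
  · refine Term.skip ⟨fun x hx _ => by rw [reg_setReg, if_neg (by omega)], fun _ hyU => ?_⟩
    have := hM hyU
    have : B - y ≤ 0 := by exact_mod_cast hle
    omega
  have hpos : 0 < B - y := by exact_mod_cast hlt
  refine Term.assign_cons (v := ((D * D % (B - y) : ℤ) : ℝ))
    (eval_modExpr ((eval_mul (eval_reg _) (eval_reg _)).trans (by simp [reg_setReg, h15]))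
      ((eval_reg _).trans (by simp [reg_setReg])) hpos) ?_
  refine Term.cons (T₁ := 2) (T₂ := 1 + 1) (Term.mono (T₁ := 2) ?_ le_rfl
    fun s' hs' => Term.nil hs')
  refine Term.ifLe (v := ((D * D % (B - y) : ℤ) : ℝ)) (w := 0)
    ((eval_reg _).trans (by simp [reg_setReg])) ((eval_const 0).trans (by simp))
    (fun hle => ?_) fun hlt' => ?_
  · refine Term.skip ⟨fun x hx _ => ?_, fun hy hyU i hi => ?_⟩
    · iterate 2 rw [reg_setReg, if_neg (by omega)]
    · have := (hd.lookup hV hB hy hyU hi).1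
      have : D * D % (B - y) ≤ 0 := by exact_mod_cast hle
      omega
  · refine Term.assign (eval_div (eval_modExpr (v := A * D) (w := B - y)
      ((eval_mul (eval_reg _) (eval_reg _)).trans (by simp [reg_setReg, h14, h15]))
      ((eval_reg _).trans (by simp [reg_setReg])) hpos) (eval_reg _) ?_)
      ⟨fun x hx hx0 => ?_, fun hy hyU i hi => ?_⟩
    · simpa [reg_setReg] using hlt'.ne'
    · iterate 3 rw [reg_setReg, if_neg (by omega)]
    · have h2 := (hd.lookup hV hB hy hyU hi).2
      simp only [reg_setReg, if_true]
      rw [h2, Int.cast_mul, mul_div_assoc, div_self hlt'.ne']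
      simp

/-! ## The construction of the dictionary -/

/-- The parameters that the construction of the dictionary relies on. -/
structure BuildEnv (S : ℕ) (P : WalkParams) (n W : ℕ) (H B V : ℤ) (thr : ℝ) (s : Store) :
    Prop where
  n_pos : 1 ≤ n
  m_pos : 1 ≤ P.m
  W_pos : 0 < W
  size : n * (P.m * P.d) ≤ S
  E_pos : 0 < P.E
  δ_pos : 0 < P.δ
  le_H : ∀ i < n, ∀ k < P.m * P.d, |⌊curveOf P i s k / P.δ⌋| + P.K ≤ H
  le_V : (2 * H + 1) ^ (P.m * P.d) + n ≤ V
  lt_B : V ^ (2 * (n * W)) < B - (2 * H + 1) ^ (P.m * P.d)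
  r0 : s.reg 0 = n
  r1 : s.reg 1 = P.m
  r2 : s.reg 2 = P.d
  r5 : s.reg 5 = P.δ
  r6 : s.reg 6 = ((P.m * P.d : ℕ) : ℝ)
  r7 : s.reg 7 = P.E
  r8 : s.reg 8 = W
  r9 : s.reg 9 = P.K
  r10 : s.reg 10 = H
  r11 : s.reg 11 = B
  r19 : s.reg 19 = thr

/-- Under the code `y`, the input curve `j` may be stored. -/
def Valid (P : WalkParams) (H : ℤ) (thr : ℝ) (s₀ : Store) (j : ℕ) (y : ℤ) : Prop :=
  ∃ X : ℕ → ℝ, (∀ k < P.m * P.d, ∃ z : ℤ, |z| ≤ H ∧ X k = P.δ * z) ∧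
    code H (fun k => ⌊X k / P.δ⌋) (P.m * P.d) = y ∧
    ∃ τ : List (Fin P.m × Fin P.m), Path P.m 0 0 τ ∧ pathCost P.d (curveOf P j s₀) X τ ≤ thr

/-- The walk number `t` along the input curve `i` is cheap and yields the code `y`. -/
def Hit (P : WalkParams) (W : ℕ) (H : ℤ) (thr : ℝ) (s₀ : Store) (i t : ℕ) (y : ℤ) : Prop :=
  ∀ X, ((Walk.start (t / W) X).run P (curveOf P i s₀) (2 * P.m)).cost ≤ thr ∧
    code H (fun k => ⌊((Walk.start (t / W) X).run P (curveOf P i s₀) (2 * P.m)).X k / P.δ⌋)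
      (P.m * P.d) = y

/-- The state of the construction before walk `t` along the input curve `i`. -/
structure BuildInv (P : WalkParams) (n W : ℕ) (H B V : ℤ) (thr : ℝ) (s₀ : Store) (i t : ℕ)
    (s : Store) : Prop where
  low : ∀ x, x < 14 ∨ x = 19 → s.reg x = s₀.reg x
  mem : s.mem 0 = s₀.mem 0
  r17 : s.reg 17 = i
  r18 : s.reg 18 = t
  dict : ∃ f, Holds B ((2 * H + 1) ^ (P.m * P.d)) V (i * W + t) f s ∧
    (∀ y j, f y = some j → j < n ∧ Valid P H thr s₀ j y) ∧
    ∀ i' t', t' < W → i' < i ∨ (i' = i ∧ t' < t) → ∀ y, Hit P W H thr s₀ i' t' y → f y ≠ none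

variable {W : ℕ} {H : ℤ} {thr : ℝ}

theorem BuildEnv.one_le_V (h : BuildEnv S P n W H B V thr s) (hd : 1 ≤ P.d) :
    0 ≤ H ∧ 1 ≤ V := by
  have h0 := h.le_H 0 h.n_pos 0 (Nat.mul_pos h.m_pos hd)
  have hH : 0 ≤ H := le_trans (by positivity) h0
  have : 0 < (2 * H + 1) ^ (P.m * P.d) := by positivity
  have := h.le_V
  exact ⟨hH, by omega⟩

theorem trialCmd_spec (h₀ : BuildEnv S P n W H B V thr s₀) (hd : 1 ≤ P.d) {i t : ℕ} (hi : i < n)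
    (ht : t < W) (hs : BuildInv P n W H B V thr s₀ i t s) :
    Term S trialCmd s (200 * (P.m * P.d)) (BuildInv P n W H B V thr s₀ i (t + 1)) := by
  have hm := h₀.m_pos
  have hmd : P.m ≤ P.m * P.d := Nat.le_mul_of_pos_right _ hd
  have hW : (0 : ℝ) < W := by exact_mod_cast h₀.W_pos
  have hV := h₀.one_le_V hd
  have hN : P.m * P.d ≤ S :=
    (Nat.le_mul_of_pos_left _ h₀.n_pos).trans h₀.size
  have henv : WalkEnv S P n i s := by
    refine ⟨hi, h₀.size, h₀.E_pos, h₀.δ_pos, ?_, ?_, ?_, ?_, ?_, ?_, hs.r17⟩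
    · rw [hs.low _ (by norm_num), h₀.r1]
    · rw [hs.low _ (by norm_num), h₀.r2]
    · rw [hs.low _ (by norm_num), h₀.r5]
    · rw [hs.low _ (by norm_num), h₀.r6]
    · rw [hs.low _ (by norm_num), h₀.r7]
    · rw [hs.low _ (by norm_num), h₀.r9]
  have hcurve : curveOf P i s = curveOf P i s₀ := by
    funext k
    rw [curveOf, curveOf, hs.mem]
  have hy0 : (0 : ℝ) ≤ t / W := by positivity
  have hy1 : (t / W : ℝ) < 1 := by
    rw [div_lt_one hW]
    exact_mod_cast ht
  set fin := (Walk.start (t / W) (s.mem 1)).run P (curveOf P i s₀) (2 * P.m) with hfin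
  have hsound := Walk.run_sound (p := curveOf P i s₀) h₀.E_pos (h₀.le_H i hi) (2 * P.m)
    (Walk.start (t / W) (s.mem 1)) hm hm (by simp [Walk.start]) hy0 hy1
    (by intro k hk; simp [Walk.start, Walk.drawn] at hk)
  rw [← hfin] at hsound
  obtain ⟨-, hX, τ, hτ, hcost⟩ := hsound
  have hcost' : fin.cost = pathCost P.d (curveOf P i s₀) fin.X τ := by
    rw [hcost]
    simp [Walk.start]
  obtain ⟨y, hy⟩ : ∃ y, code H (fun k => ⌊fin.X k / P.δ⌋) (P.m * P.d) = y := ⟨_, rfl⟩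
  obtain ⟨hy0', hyU⟩ : 0 ≤ y ∧ y < (2 * H + 1) ^ (P.m * P.d) := by
    rw [← hy]
    refine code_mem fun k hk => ?_
    obtain ⟨z, hz, he⟩ := hX k hk
    rw [he, mul_div_cancel_left₀ _ h₀.δ_pos.ne', Int.floor_intCast]
    exact hz
  -- `Hit` speaks of all initial contents of array `1`, hence also of what the previous walk left
  -- there.
  have hhit : ∀ y', Hit P W H thr s₀ i t y' → fin.cost ≤ thr ∧ y' = y := fun y' h =>
    ⟨(h _).1, (h _).2.symm.trans hy⟩
  obtain ⟨f, hf, hfs, hfc⟩ := hs.dict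
  refine Term.mono (T₁ := 11 + ((2 * P.m * (26 * P.d + 34) + 1) + ((6 * (P.m * P.d) + 7) +
    (13 + (0 + 1 + 2) + 1) + 1) + 1) + 1) ?_ ?_ fun _ h => h
  swap
  · have : 2 * P.m * (26 * P.d + 34) = 52 * (P.m * P.d) + 68 * P.m := by ring
    omega
  refine Term.cons (Term.mono (Q := Sim s (Walk.start (t / W) (s.mem 1))) (T₁ := 11) ?_ le_rfl
    fun s₁ hs₁ => ?_)
  · refine Term.assign_cons (eval_div (eval_reg _) (eval_reg _) ?_) (Term.assign_cons
      (eval_const 0) (Term.assign_cons (eval_const 0) (Term.assign_cons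
      (eval_const 1) (Term.assign_cons (eval_const 0) (Term.nil ?_)))))
    · rw [hs.low _ (by norm_num), h₀.r8]
      exact hW.ne'
    · refine ⟨fun x hx => ?_, rfl, ?_, ?_, ?_, ?_, ?_, rfl⟩
      · iterate 5 rw [reg_setReg, if_neg (by omega)]
      · have h8 := (hs.low 8 (by norm_num)).trans h₀.r8
        simp [reg_setReg, h8, hs.r18, Walk.start]
      all_goals simp [reg_setReg, Walk.start]
  refine Term.cons ((walkCmd_spec henv (2 * P.m)
    (st := Walk.start (t / W) (s.mem 1)) (zero_le : 0 ≤ P.m) hm (fun _ => by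
    simp [Walk.start]) hy0 hy1 hs₁).mono le_rfl fun s₂ hs₂ => ?_)
  rw [hcurve, ← hfin] at hs₂
  refine Term.cons (T₁ := 6 * (P.m * P.d) + 7) (T₂ := 13 + (0 + 1 + 2) + 1)
    ((codeCmd_spec (N := P.m * P.d) (δ := P.δ) (H := H) hN h₀.δ_pos ?_ ?_ ?_).mono
    le_rfl ?_)
  · rw [hs₂.low _ (by norm_num), hs.low _ (by norm_num), h₀.r5]
  · rw [hs₂.low _ (by norm_num), hs.low _ (by norm_num), h₀.r6]
  · rw [hs₂.low _ (by norm_num), hs.low _ (by norm_num), h₀.r10]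
  rintro s₃ ⟨e, em, e30⟩
  have e₃ : ∀ x < 20, s₃.reg x = s.reg x := fun x hx => by
    rw [e x (by omega), hs₂.low x hx]
  rw [hs₂.X, hy] at e30
  have hf₃ : Holds B ((2 * H + 1) ^ (P.m * P.d)) V (i * W + t) f s₃ :=
    hf.congr fun x h1 h2 => e₃ x (by omega)
  have e24 : s₃.reg 24 = fin.cost := by rw [e _ (by norm_num), hs₂.r24]
  refine Term.cons (T₁ := 13) (T₂ := 0 + 1 + 2) (Term.mono (Q := fun s₄ =>
      (∀ x, x < 20 → x ≠ 14 → x ≠ 15 → x ≠ 16 → s₄.reg x = s.reg x) ∧ s₄.mem 0 = s.mem 0 ∧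
      ∃ f, Holds B ((2 * H + 1) ^ (P.m * P.d)) V (i * W + (t + 1)) f s₄ ∧
        (∀ y j, f y = some j → j < n ∧ Valid P H thr s₀ j y) ∧
        ∀ i' t', t' < W → i' < i ∨ (i' = i ∧ t' < t + 1) → ∀ y, Hit P W H thr s₀ i' t' y →
          f y ≠ none) ?_ (le_refl 13) ?_)
  · have hmem : s₃.mem 0 = s.mem 0 := by rw [em, hs₂.mem]
    refine Term.ifLe (v := fin.cost) (w := thr) ((eval_reg _).trans (by rw [e24]))
      ((eval_reg _).trans ?_) (fun hle => ?_) fun hlt => ?_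
    · rw [e₃ _ (by norm_num), hs.low _ (by norm_num), h₀.r19]
    · have hkW : i * W + t ≤ n * W := by
        have : (i + 1) * W ≤ n * W := Nat.mul_le_mul_right _ hi
        rw [Nat.succ_mul] at this
        omega
      refine (insertCmd_spec hf₃ h₀.le_V h₀.n_pos hi.le ?_ hy0' hyU ?_ ?_ e30).mono le_rfl ?_
      · refine lt_of_le_of_lt (pow_le_pow_right₀ hV.2 ?_) h₀.lt_B
        omega
      · rw [e₃ _ (by norm_num), hs.low _ (by norm_num), h₀.r11]
      · rw [e₃ _ (by norm_num), hs.r17]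
      rintro s₄ ⟨e₄, em₄, hf₄⟩
      refine ⟨fun x hx h1 h2 h3 => (e₄ x hx h1 h2 h3).trans (e₃ x hx), by rw [em₄, hmem],
        _, hf₄, ?_, ?_⟩
      · intro y' j hj
        split_ifs at hj with hfy
        · by_cases hyy : y' = y
          · subst hyy
            obtain rfl : i = j := by simpa using hj
            exact ⟨hi, fin.X, hX, hy, τ, hτ, by rwa [← hcost']⟩
          · rw [Function.update_of_ne hyy] at hj
            exact hfs y' j hj
        · exact hfs y' j hj
      · intro i' t' ht' hit y' hh
        have hold : f y' ≠ none ∨ y' = y := by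
          by_cases hlast : i' = i ∧ t' = t
          · obtain ⟨rfl, rfl⟩ := hlast
            exact Or.inr (hhit y' hh).2
          · exact Or.inl (hfc i' t' ht' (by omega) y' hh)
        split_ifs with hfy
        · by_cases hyy : y' = y
          · simp [hyy]
          · rw [Function.update_of_ne hyy]
            exact hold.resolve_right hyy
        · rcases hold with h | rfl
          · exact h
          · exact hfy
    · obtain ⟨G, D, A, hd', h'⟩ := hf₃
      refine (Term.skip (T := 11) ⟨fun x hx _ _ _ => e₃ x hx, hmem, f,
        ⟨G, D, A, hd'.mono hV.2 (by omega), h'⟩, hfs, ?_⟩)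
      intro i' t' ht' hit y' hh
      by_cases hlast : i' = i ∧ t' = t
      · obtain ⟨rfl, rfl⟩ := hlast
        exact absurd (hhit y' hh).1 (not_le.2 hlt)
      · exact hfc i' t' ht' (by omega) y' hh
  · rintro s₄ ⟨e₄, em₄, f', hf', hs', hc'⟩
    refine Term.assign_cons (eval_add (eval_reg _) (eval_const 1)) (Term.nil ⟨?_, ?_, ?_, ?_,
      f', ?_, hs', hc'⟩)
    · intro x hx
      rw [reg_setReg, if_neg (by omega), e₄ x (by omega) (by omega) (by omega) (by omega),
        hs.low x hx]
    · rw [mem_setReg, em₄, hs.mem]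
    · rw [reg_setReg, if_neg (by norm_num), e₄ _ (by norm_num) (by norm_num) (by norm_num)
        (by norm_num), hs.r17]
    · rw [reg_setReg, if_pos rfl, e₄ _ (by norm_num) (by norm_num) (by norm_num)
        (by norm_num), hs.r18]
      push_cast
      rfl
    · exact hf'.congr fun x h1 h2 => by rw [reg_setReg, if_neg (by omega)]

/-- Between two input curves the walk counter, register `18`, is stale. The invariant of the outer
loop therefore describes the store after its reset. -/
theorem buildCmd_spec (h₀ : BuildEnv S P n W H B V thr s₀) (hd : 1 ≤ P.d) :
    Term S buildCmd s₀ (n * (W * (200 * (P.m * P.d) + 1) + 8) + 11)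
      fun s => BuildInv P n W H B V thr s₀ n 0 (s.setReg 18 0) := by
  have hV := h₀.one_le_V hd
  refine Term.mono (T₁ := (n * ((W * (200 * (P.m * P.d) + 1) + 1 + (0 + 1 + 2) + 1 + 2) + 1) + 1) +
    1 + 1 + 2 + 2 + 2 + 2) ?_ (le_of_eq (by ring)) fun _ h => h
  refine Term.assign_cons (eval_const 0) (Term.assign_cons (eval_const 0) (Term.assign_cons
    (eval_const 1) (Term.assign_cons (eval_const 0) ?_)))
  refine Term.cons (T₁ := n * ((W * (200 * (P.m * P.d) + 1) + 1 + (0 + 1 + 2) + 1 + 2) + 1) + 1)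
    (T₂ := 1) ((Term.for_loop (fun i s => BuildInv P n W H B V thr s₀ i 0 (s.setReg 18 0)) n 17
      ?_ ?_ ?_ ?_).mono le_rfl fun s hs => Term.nil hs)
  · intro i s hs
    have := hs.r17
    rwa [reg_setReg, if_neg (by norm_num)] at this
  · intro i s hs
    have := hs.low 0 (by norm_num)
    rw [reg_setReg, if_neg (by norm_num)] at this
    exact (eval_reg _).trans (by rw [this, h₀.r0])
  · intro i s hi hs
    refine Term.assign_cons (v := 0) ((eval_const 0).trans (by simp)) ?_
    refine Term.cons (T₁ := W * (200 * (P.m * P.d) + 1) + 1) (T₂ := 0 + 1 + 2)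
      ((Term.for_loop (BuildInv P n W H B V thr s₀ i) W 18 (fun _ _ h => h.r18)
        (fun _ s h => (eval_reg _).trans (by rw [h.low _ (by norm_num), h₀.r8]))
        (fun t s ht h => trialCmd_spec h₀ hd hi ht h) hs).mono le_rfl fun s₁ h₁ => ?_)
    refine Term.assign_cons (eval_add (eval_reg _) (eval_const 1)) (Term.nil ⟨?_, h₁.mem, ?_, ?_, ?_⟩)
    · intro x hx
      rw [← h₁.low x hx, reg_setReg, if_neg (by omega), reg_setReg, if_neg (by omega)]
    · simp [reg_setReg, h₁.r17]
    · simp [reg_setReg]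
    · obtain ⟨f, hf, hs, hc⟩ := h₁.dict
      refine ⟨f, ?_, hs, fun i' t' ht' h => hc i' t' ht' (by omega)⟩
      rw [add_zero, Nat.succ_mul]
      exact hf.congr fun x h1 h2 => by
        rw [reg_setReg, if_neg (by omega), reg_setReg, if_neg (by omega)]
  · refine ⟨?_, rfl, ?_, ?_, fun _ => none, ⟨1, 0, 0, ?_, ?_, ?_, ?_⟩, ?_, ?_⟩
    · intro x hx
      iterate 5 rw [reg_setReg, if_neg (by omega)]
    · simp [reg_setReg]
    · simp [reg_setReg]
    · simpa using IsDict.empty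
    · simp [reg_setReg]
    · simp [reg_setReg]
    · simp [reg_setReg]
    · simp
    · intro i' t' _ h
      omega

end RAM

end

noncomputable section

namespace RAM

/-! ## The parameters -/

variable {S : ℕ} {s : Store}

theorem repeatCmd_spec {a N : ℕ} {bound e : Expr} (ha : a ≠ 20) (g : ℕ → ℝ) (h0 : s.reg a = g 0)
    (hb : ∀ s' : Store, (∀ x, x ≠ 20 → x ≠ a → s'.reg x = s.reg x) →
      bound.eval S s' = some (N : ℝ))
    (he : ∀ (k : ℕ) (s' : Store), k < N → (∀ x, x ≠ 20 → x ≠ a → s'.reg x = s.reg x) →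
      s'.mem = s.mem → s'.reg 20 = k → s'.reg a = g k → e.eval S s' = some (g (k + 1))) :
    Term S (repeatCmd a bound e) s (6 * N + 5) fun s' =>
      (∀ x, x ≠ 20 → x ≠ a → s'.reg x = s.reg x) ∧ s'.mem = s.mem ∧ s'.reg a = g N := by
  refine Term.mono (T₁ := (N * (5 + 1) + 1) + 1 + 1 + 2) ?_ (by omega) fun _ h => h
  refine Term.assign_cons (eval_const 0) ?_
  refine Term.cons (T₁ := N * (5 + 1) + 1) (T₂ := 1) ((Term.for_loop (fun k s' =>
    (∀ x, x ≠ 20 → x ≠ a → s'.reg x = s.reg x) ∧ s'.mem = s.mem ∧ s'.reg 20 = k ∧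
      s'.reg a = g k) N 20 (fun _ _ h => h.2.2.1)
    (fun _ s' h => hb s' h.1) ?_ ?_).mono le_rfl
    fun s' h => Term.nil ⟨h.1, h.2.1, h.2.2.2⟩)
  · rintro k s' hk ⟨h1, h2, h3, h4⟩
    refine Term.assign_cons (he k s' hk h1 h2 h3 h4) (Term.assign_cons
      (eval_add (eval_reg _) (eval_const 1)) (Term.nil ⟨fun x hx hx' => ?_, h2, ?_, ?_⟩))
    · rw [reg_setReg, if_neg hx, reg_setReg, if_neg hx', h1 x hx hx']
    · simp [reg_setReg, h3, ha.symm]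
    · simp [reg_setReg, ha]
  · refine ⟨fun x hx _ => ?_, rfl, ?_, ?_⟩
    · rw [reg_setReg, if_neg hx]
    · simp [reg_setReg]
    · simp [reg_setReg, ha, h0]

section

variable (n m d : ℕ) (ε r : ℝ) (A : ℕ → ℝ)

/-- A natural number between `1 / ε` and `2 / ε`. -/
def invEps (ε : ℝ) : ℕ := ⌊1 / ε⌋₊ + 1

/-- The parameters of the walks. -/
def walkParams : WalkParams where
  m := m
  d := d
  E := invEps ε
  K := 11 * (m * d) * invEps ε
  δ := ε * r / (8 * m * Real.sqrt d)

/-- The number of walks per curve. -/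
def walkCount : ℕ := (walkBase * invEps ε) ^ (m * d)

/-- The bound on grid coordinates, when `N` input coordinates have been considered. -/
def gridBound (N : ℕ) : ℤ :=
  (11 * (m * d) * invEps ε : ℕ) +
    ∑ k ∈ Finset.range N, ⌊A k / (ε * r / (8 * m * Real.sqrt d))⌋ ^ 2

/-- The bound on the values of the polynomials behind the dictionary. -/
def valueBound (N : ℕ) : ℤ := (2 * gridBound m d ε r A N + 1) ^ (m * d) + n

end

/-- This permits a bound on all grid coordinates to be computed as a sum of squares, without
absolute values or maxima. -/
theorem abs_le_sq (z : ℤ) : |z| ≤ z ^ 2 := by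
  rcases eq_or_ne z 0 with rfl | hz
  · simp
  · rw [← sq_abs]
    exact le_self_pow₀ (Int.one_le_abs hz) two_ne_zero

theorem paramCmd_spec {n m d : ℕ} {ε r : ℝ} {A : ℕ → ℝ} (hn : 1 ≤ n) (hm : 1 ≤ m) (hd : 1 ≤ d)
    (hε : 0 < ε) (hr : 0 < r) (h0 : s.reg 0 = n) (h1 : s.reg 1 = m) (h2 : s.reg 2 = d)
    (h3 : s.reg 3 = ε) (h4 : s.reg 4 = r) (hA : s.mem 0 = A) :
    Term (n * (m * d)) paramCmd s (12 * (m * d) + 6 * (n * (m * d)) + 6 * (n * walkCount m d ε) + 50)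
      fun s' => s'.mem = s.mem ∧
        BuildEnv (n * (m * d)) (walkParams m d ε r) n (walkCount m d ε)
          (gridBound m d ε r A (n * (m * d)))
          (2 * valueBound n m d ε r A (n * (m * d)) *
            (valueBound n m d ε r A (n * (m * d)) * valueBound n m d ε r A (n * (m * d))) ^
              (n * walkCount m d ε))
          (valueBound n m d ε r A (n * (m * d))) (r + ε * r / 2) s' := by
  have hmR : (0 : ℝ) < m := by exact_mod_cast hm
  have hdR : (0 : ℝ) < d := by exact_mod_cast hd
  set δ : ℝ := ε * r / (8 * m * Real.sqrt d) with hδ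
  have hδ0 : 0 < δ := by positivity
  obtain ⟨E, hE⟩ : ∃ E, invEps ε = E := ⟨_, rfl⟩
  have hEfl : (⌊1 / ε⌋ : ℝ) + 1 = E := by
    rw [← hE, invEps]
    have := natCast_floor_eq_intCast_floor (R := ℝ) (a := 1 / ε) (by positivity)
    rw [Nat.cast_add, this]
    simp
  obtain ⟨W, hW⟩ : ∃ W, walkCount m d ε = W := ⟨_, rfl⟩
  obtain ⟨G, hG⟩ : ∃ G, gridBound m d ε r A = G := ⟨_, rfl⟩
  have hG0 : ∀ N, (11 * (m * d) * E : ℕ) ≤ G N := by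
    intro N
    rw [← hG, gridBound, hE]
    have : 0 ≤ ∑ k ∈ Finset.range N, ⌊A k / (ε * r / (8 * m * Real.sqrt d))⌋ ^ 2 := by positivity
    omega
  have hG1 : ∀ N, G (N + 1) = G N + ⌊A N / δ⌋ ^ 2 := by
    intro N
    rw [← hG, gridBound, gridBound, Finset.sum_range_succ, ← add_assoc]
  obtain ⟨V, hV⟩ : ∃ V, valueBound n m d ε r A (n * (m * d)) = V := ⟨_, rfl⟩
  rw [hW, hV]
  refine Term.mono (T₁ := ((6 * (m * d) + 5) + (((6 * (n * (m * d)) + 5) + (((6 * (m * d) + 5) +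
    (((6 * (n * W) + 5) + 1 + 1) + 2 + 2) + 1) + 2) + 1) + 2) + 1) + 2 + 2 + 2 + 2 + 2 + 2) ?_
    (by omega) fun _ h => h
  refine Term.assign_cons (v := δ) ((eval_div (eval_mul (eval_reg _) (eval_reg _))
    (eval_mul (eval_mul (eval_const _) (eval_reg _)) (eval_sqrt (eval_reg _) ?_)) ?_).trans ?_) ?_
  · rw [h2]; positivity
  · rw [h1, h2]; positivity
  · rw [h1, h2, h3, h4, hδ]; norm_num
  refine Term.assign_cons (v := ((m * d : ℕ) : ℝ)) ((eval_mul (eval_reg _) (eval_reg _)).trans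
    (by simp [reg_setReg, h1, h2])) ?_
  refine Term.assign_cons (v := E) ((eval_add (eval_floor (eval_div (eval_const _) (eval_reg _)
    ?_)) (eval_const _)).trans ?_) ?_
  · simp [reg_setReg, h3, hε.ne']
  · rw [← hEfl]
    simp [reg_setReg, h3]
  refine Term.assign_cons (v := ((11 * (m * d) * E : ℕ) : ℝ))
    ((eval_mul (eval_mul (eval_const _) (eval_reg _)) (eval_reg _)).trans
    (by simp [reg_setReg])) ?_
  refine Term.assign_cons (v := r + ε * r / 2) ((eval_add (eval_reg _) (eval_div (eval_mul
    (eval_reg _) (eval_reg _)) (eval_const _) (by norm_num))).trans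
    (by simp [reg_setReg, h3, h4])) ?_
  refine Term.assign_cons (v := 1) ((eval_const 1).trans (by simp)) ?_
  obtain ⟨s₁, hs₁, m₁⟩ : ∃ s₁ : Store, s₁ = ((((((s.setReg 5 δ).setReg 6 ((m * d : ℕ) : ℝ)).setReg 7
    (E : ℝ)).setReg 9 ((11 * (m * d) * E : ℕ) : ℝ)).setReg 19 (r + ε * r / 2)).setReg 8 1) ∧
    s₁.mem = s.mem := ⟨_, rfl, rfl⟩
  rw [← hs₁]
  have a0 : s₁.reg 0 = n := by simp [hs₁, reg_setReg, h0]
  have a1 : s₁.reg 1 = m := by simp [hs₁, reg_setReg, h1]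
  have a2 : s₁.reg 2 = d := by simp [hs₁, reg_setReg, h2]
  have a5 : s₁.reg 5 = δ := by simp [hs₁, reg_setReg]
  have a6 : s₁.reg 6 = ((m * d : ℕ) : ℝ) := by simp [hs₁, reg_setReg]
  have a7 : s₁.reg 7 = E := by simp [hs₁, reg_setReg]
  have a8 : s₁.reg 8 = 1 := by simp [hs₁, reg_setReg]
  have a9 : s₁.reg 9 = ((11 * (m * d) * E : ℕ) : ℝ) := by simp [hs₁, reg_setReg]
  have a19 : s₁.reg 19 = r + ε * r / 2 := by simp [hs₁, reg_setReg]
  clear_value δ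
  clear hs₁
  refine Term.cons (T₁ := 6 * (m * d) + 5) ((repeatCmd_spec (N := m * d) (by norm_num)
    (fun k => ((walkBase * E : ℕ) : ℝ) ^ k) (by simpa using a8) ?_ ?_).mono le_rfl ?_)
  · intro s' h
    exact (eval_reg _).trans (by rw [h _ (by norm_num) (by norm_num), a6])
  · intro k s' _ h _ _ h8
    refine (eval_mul (eval_reg _) (eval_mul (eval_const _) (eval_reg _))).trans ?_
    rw [h8, h _ (by norm_num) (by norm_num), a7, pow_succ]
    push_cast
    rfl
  rintro s₂ ⟨f₂, m₂, b8⟩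
  have b8' : s₂.reg 8 = W := by
    rw [b8, ← hW, walkCount, hE]
    push_cast
    rfl
  refine Term.assign_cons (v := ((11 * (m * d) * E : ℕ) : ℝ)) ((eval_reg _).trans
    (by rw [f₂ _ (by norm_num) (by norm_num), a9])) ?_
  refine Term.cons (T₁ := 6 * (n * (m * d)) + 5) ((repeatCmd_spec (N := n * (m * d)) (by norm_num)
    (fun k => (G k : ℝ)) ?_ ?_ ?_).mono le_rfl ?_)
  · simp [reg_setReg, ← hG, gridBound, hE]
  · intro s' h
    refine (eval_mul (eval_reg _) (eval_reg _)).trans ?_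
    rw [h _ (by norm_num) (by norm_num), h _ (by norm_num) (by norm_num), reg_setReg,
      if_neg (by norm_num), reg_setReg, if_neg (by norm_num), f₂ _ (by norm_num) (by norm_num),
      f₂ _ (by norm_num) (by norm_num), a0, a6]
    push_cast
    rfl
  · intro k s' hk h hmem h20 h10
    have hfl : (Expr.floor (Expr.cell 0 (Expr.reg 20) / Expr.reg 5)).eval (n * (m * d)) s' =
        some ((⌊A k / δ⌋ : ℤ) : ℝ) := by
      have h5 : s'.reg 5 = δ := by
        rw [h _ (by norm_num) (by norm_num), reg_setReg, if_neg (by norm_num),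
          f₂ _ (by norm_num) (by norm_num), a5]
      refine (eval_floor (eval_div (eval_cell (k := k) ((eval_reg _).trans (by rw [h20])) hk)
        (eval_reg _) (by rw [h5]; exact hδ0.ne'))).trans ?_
      rw [h5, hmem, mem_setReg, m₂, m₁, hA]
    refine (eval_add (eval_reg _) (eval_mul hfl hfl)).trans ?_
    rw [h10, hG1]
    push_cast
    rw [sq]
  rintro s₃ ⟨f₃, m₃, b10⟩
  have g₃ : ∀ x, x ≠ 20 → x ≠ 10 → x ≠ 8 → s₃.reg x = s₁.reg x := fun x h1 h2 h3 => by
    rw [f₃ x h1 h2, reg_setReg, if_neg h2, f₂ x h1 h3]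
  have c8 : s₃.reg 8 = W := by
    rw [f₃ _ (by norm_num) (by norm_num), reg_setReg, if_neg (by norm_num), b8']
  refine Term.assign_cons (v := 1) ((eval_const 1).trans (by simp)) ?_
  refine Term.cons (T₁ := 6 * (m * d) + 5) ((repeatCmd_spec (N := m * d) (by norm_num)
    (fun k => (((2 * G (n * (m * d)) + 1) ^ k : ℤ) : ℝ)) ?_ ?_ ?_).mono le_rfl ?_)
  · simp [reg_setReg]
  · intro s' h
    refine (eval_reg _).trans ?_
    rw [h _ (by norm_num) (by norm_num), reg_setReg, if_neg (by norm_num),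
      g₃ _ (by norm_num) (by norm_num) (by norm_num), a6]
  · intro k s' _ h _ _ h13
    refine (eval_mul (eval_reg _) (eval_add (eval_mul (eval_const _) (eval_reg _))
      (eval_const _))).trans ?_
    rw [h13, h _ (by norm_num) (by norm_num), reg_setReg, if_neg (by norm_num), b10, pow_succ]
    push_cast
    rfl
  rintro s₄ ⟨f₄, m₄, b13⟩
  have g₄ : ∀ x, x ≠ 20 → x ≠ 13 → s₄.reg x = s₃.reg x := fun x h1 h2 => by
    rw [f₄ x h1 h2, reg_setReg, if_neg h2]
  have hVdef : (2 * G (n * (m * d)) + 1) ^ (m * d) + n = V := by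
    rw [← hV, valueBound, hG]
  have d0 : s₄.reg 0 = n := by
    rw [g₄ _ (by norm_num) (by norm_num), g₃ _ (by norm_num) (by norm_num) (by norm_num), a0]
  refine Term.assign_cons (v := (V : ℝ)) ((eval_add (eval_reg _) (eval_reg _)).trans ?_) ?_
  · rw [b13, d0, ← hVdef]
    push_cast
    rfl
  refine Term.assign_cons (v := ((2 * V : ℤ) : ℝ)) ((eval_mul (eval_const _) (eval_reg _)).trans
    (by simp [reg_setReg])) ?_
  refine Term.cons (T₁ := 6 * (n * W) + 5) (T₂ := 1) ((repeatCmd_spec (N := n * W) (by norm_num)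
    (fun k => ((2 * V * (V * V) ^ k : ℤ) : ℝ)) ?_ ?_ ?_).mono le_rfl ?_)
  · simp [reg_setReg]
  · intro s' h
    refine (eval_mul (eval_reg _) (eval_reg _)).trans ?_
    rw [h _ (by norm_num) (by norm_num), h _ (by norm_num) (by norm_num)]
    simp only [reg_setReg]
    norm_num
    rw [d0, g₄ _ (by norm_num) (by norm_num), c8]
  · intro k s' _ h _ _ h11
    refine (eval_mul (eval_reg _) (eval_mul (eval_reg _) (eval_reg _))).trans ?_
    rw [h11, h _ (by norm_num) (by norm_num), reg_setReg, if_neg (by norm_num), reg_setReg,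
      if_pos rfl, pow_succ]
    push_cast
    rw [mul_assoc]
  rintro s₅ ⟨f₅, m₅, b11⟩
  have g₅ : ∀ x, x ≠ 20 → x ≠ 11 → x ≠ 13 → s₅.reg x = s₃.reg x := fun x h1 h2 h3 => by
    rw [f₅ x h1 h2, reg_setReg, if_neg h2, reg_setReg, if_neg h3, g₄ x h1 h3]
  have k₅ : ∀ x, x ≠ 20 → x ≠ 11 → x ≠ 13 → x ≠ 10 → x ≠ 8 → s₅.reg x = s₁.reg x :=
    fun x h1 h2 h3 h4 h5 => by rw [g₅ x h1 h2 h3, g₃ x h1 h4 h5]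
  have hmem : s₅.mem = s.mem := by
    rw [m₅, mem_setReg, mem_setReg, m₄, mem_setReg, m₃, mem_setReg, m₂, m₁]
  have hGpos : 0 ≤ G (n * (m * d)) := le_trans (by positivity) (hG0 _)
  have hV1 : 1 ≤ V := by
    have : 0 < (2 * G (n * (m * d)) + 1) ^ (m * d) := by positivity
    omega
  have hEpos : 0 < E := hE ▸ Nat.succ_pos _
  have eG : gridBound m d ε r A (n * (m * d)) = G (n * (m * d)) := by rw [hG]
  rw [eG]
  refine Term.nil ⟨hmem, ⟨hn, hm, ?_, le_rfl, Nat.succ_pos _, ?_, ?_, hVdef.le, ?_, ?_, ?_, ?_, ?_, ?_,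
    ?_, ?_, ?_, ?_, ?_, ?_⟩⟩
  · rw [← hW, walkCount, hE]
    have : 0 < walkBase := by unfold walkBase; positivity
    positivity
  · change 0 < ε * r / (8 * m * Real.sqrt d)
    rw [← hδ]; exact hδ0
  · intro i hi k hk
    change k < m * d at hk
    change |⌊s₅.mem 0 (i * (m * d) + k) / (ε * r / (8 * m * Real.sqrt d))⌋| +
      ((11 * (m * d) * invEps ε : ℕ) : ℤ) ≤ G (n * (m * d))
    rw [hmem, hA, ← hδ, ← hG, gridBound, ← hδ, add_comm]
    have h1 := Finset.single_le_sum (f := fun k => ⌊A k / δ⌋ ^ 2) (fun _ _ => sq_nonneg _)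
      (Finset.mem_range.2 (index_lt hi hk))
    have h2 := abs_le_sq ⌊A (i * (m * d) + k) / δ⌋
    linarith
  -- Of the two copies of `V * V ^ (2 * n * W)` in `B`, one dominates the power on the left and the
  -- other one exceeds the range of the codes.
  · change V ^ (2 * (n * W)) < 2 * V * (V * V) ^ (n * W) - (2 * G (n * (m * d)) + 1) ^ (m * d)
    have h1 : (V * V) ^ (n * W) = V ^ (2 * (n * W)) := by rw [pow_mul V 2, sq]
    have h2 : 1 ≤ V ^ (2 * (n * W)) := one_le_pow₀ hV1
    have h3 : (2 * G (n * (m * d)) + 1) ^ (m * d) < V := by omega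
    rw [h1]
    nlinarith
  · rw [k₅ _ (by norm_num) (by norm_num) (by norm_num) (by norm_num) (by norm_num), a0]
  · rw [k₅ _ (by norm_num) (by norm_num) (by norm_num) (by norm_num) (by norm_num), a1]; rfl
  · rw [k₅ _ (by norm_num) (by norm_num) (by norm_num) (by norm_num) (by norm_num), a2]; rfl
  · rw [k₅ _ (by norm_num) (by norm_num) (by norm_num) (by norm_num) (by norm_num), a5, hδ]; rfl
  · rw [k₅ _ (by norm_num) (by norm_num) (by norm_num) (by norm_num) (by norm_num), a6]; rfl
  · rw [k₅ _ (by norm_num) (by norm_num) (by norm_num) (by norm_num) (by norm_num), a7, ← hE]; rfl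
  · rw [g₅ _ (by norm_num) (by norm_num) (by norm_num), c8]
  · rw [k₅ _ (by norm_num) (by norm_num) (by norm_num) (by norm_num) (by norm_num), a9, ← hE]; rfl
  · rw [g₅ _ (by norm_num) (by norm_num) (by norm_num), b10]
  · rw [b11]
  · rw [k₅ _ (by norm_num) (by norm_num) (by norm_num) (by norm_num) (by norm_num), a19]

end RAM

end

noncomputable section

namespace RAM

/-! ## Rounded curves -/

/-- Point `j` of the curve with coordinates `X`. -/
def pointOf (d : ℕ) (X : ℕ → ℝ) (j : ℕ) : EuclideanSpace ℝ (Fin d) :=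
  WithLp.toLp 2 fun l => X (j * d + l)

theorem pointDist_eq_dist (d : ℕ) (p X : ℕ → ℝ) (j a : ℕ) :
    pointDist d p X j a = dist (pointOf d X j) (pointOf d p a) := by
  rw [EuclideanSpace.dist_eq, pointDist, Finset.sum_range]
  congr 1
  refine Finset.sum_congr rfl fun l _ => ?_
  rw [Real.dist_eq, sq_abs]
  simp only [pointOf]
  ring

theorem dist_pointOf_le {d : ℕ} {X Y : ℕ → ℝ} {j : ℕ} {δ : ℝ} (hδ : 0 ≤ δ)
    (h : ∀ l < d, |X (j * d + l) - Y (j * d + l)| ≤ δ) :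
    dist (pointOf d X j) (pointOf d Y j) ≤ δ * Real.sqrt d := by
  rw [EuclideanSpace.dist_eq]
  refine Real.sqrt_le_iff.2 ⟨by positivity, ?_⟩
  rw [mul_pow, Real.sq_sqrt (Nat.cast_nonneg _)]
  calc ∑ l : Fin d, dist (pointOf d X j l) (pointOf d Y j l) ^ 2 ≤ ∑ _l : Fin d, δ ^ 2 := by
        refine Finset.sum_le_sum fun l _ => ?_
        have := h l l.2
        rw [Real.dist_eq]
        gcongr
        exact this
    _ = δ ^ 2 * d := by simp [mul_comm]

theorem pathCost_le_add {m d : ℕ} {p X Y : ℕ → ℝ} {δ : ℝ} (hδ : 0 ≤ δ)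
    (h : ∀ k < m * d, |X k - Y k| ≤ δ) (τ : List (Fin m × Fin m)) :
    pathCost d p X τ ≤ pathCost d p Y τ + τ.length * (δ * Real.sqrt d) := by
  induction τ with
  | nil => simp [pathCost]
  | cons q τ ih =>
    simp only [pathCost, List.map_cons, List.sum_cons, List.length_cons] at ih ⊢
    have h1 : pointDist d p X q.1 q.2 ≤ pointDist d p Y q.1 q.2 + δ * Real.sqrt d := by
      rw [pointDist_eq_dist, pointDist_eq_dist, add_comm]
      refine (dist_triangle _ (pointOf d Y q.1) _).trans ?_
      gcongr
      exact dist_pointOf_le hδ fun l hl => h _ (index_lt q.1.2 hl)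
    push_cast
    linarith

theorem abs_floor_sub_floor_le (x y : ℝ) : |((⌊x⌋ - ⌊y⌋ : ℤ) : ℝ)| ≤ |x - y| + 1 := by
  have h1 := Int.floor_le x
  have h2 := Int.lt_floor_add_one x
  have h3 := Int.floor_le y
  have h4 := Int.lt_floor_add_one y
  have h5 := le_abs_self (x - y)
  have h6 := neg_abs_le (x - y)
  push_cast
  rw [abs_le]
  constructor <;> linarith

/-- Cauchy–Schwarz bounds the sum of the coordinate differences by `√d` times the Euclidean
distance, and the floors add at most one per coordinate. -/
theorem sum_abs_floor_le {d : ℕ} {p q : ℕ → ℝ} {δ : ℝ} (hδ : 0 < δ) (j a : ℕ) :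
    ∑ l ∈ Finset.range d, |((⌊q (j * d + l) / δ⌋ - ⌊p (a * d + l) / δ⌋ : ℤ) : ℝ)| ≤
      Real.sqrt d / δ * pointDist d p q j a + d := by
  have h1 : ∑ l ∈ Finset.range d, |p (a * d + l) - q (j * d + l)| ≤
      Real.sqrt d * pointDist d p q j a := by
    rw [pointDist, ← Real.sqrt_mul (Nat.cast_nonneg _)]
    refine Real.le_sqrt_of_sq_le ?_
    have := sq_sum_le_card_mul_sum_sq (s := Finset.range d)
      (f := fun l => |p (a * d + l) - q (j * d + l)|)
    simpa using this
  calc _ ≤ ∑ l ∈ Finset.range d, (|p (a * d + l) - q (j * d + l)| / δ + 1) := by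
        refine Finset.sum_le_sum fun l _ => (abs_floor_sub_floor_le _ _).trans_eq ?_
        rw [← sub_div, abs_div, abs_of_pos hδ, abs_sub_comm]
    _ = (∑ l ∈ Finset.range d, |p (a * d + l) - q (j * d + l)|) / δ + d := by
        rw [Finset.sum_add_distrib, Finset.sum_div]
        simp
    _ ≤ (Real.sqrt d * pointDist d p q j a) / δ + d := by gcongr
    _ = _ := by ring

theorem exists_path {m : ℕ} (hm : 1 ≤ m) : ∃ τ, Path m 0 0 τ := by
  have key : ∀ k j, j + k + 1 = m → ∃ τ, Path m j j τ := by
    intro k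
    induction k with
    | zero => exact fun j hj => ⟨_, Path.last (by omega) (by omega) (by omega) (by omega)⟩
    | succ k ih =>
      intro j hj
      obtain ⟨τ, hτ⟩ := ih (j + 1) (by omega)
      exact ⟨_, Path.cons (by omega) (by omega) (Or.inr (Or.inr ⟨rfl, rfl⟩)) hτ⟩
  exact key (m - 1) 0 (by omega)

theorem pathCost_eq_dtwCost {m d : ℕ} {p q : ℕ → ℝ} {Q C : Curve m d}
    (hq : ∀ (j : Fin m) (l : Fin d), q (j * d + l) = Q j l)
    (hp : ∀ (a : Fin m) (l : Fin d), p (a * d + l) = C a l) (τ : List (Fin m × Fin m)) :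
    pathCost d p q τ = dtwCost Q C τ := by
  unfold pathCost dtwCost
  congr 1
  refine List.map_congr_left fun x _ => ?_
  rw [pointDist_eq_dist]
  congr 1
  · ext l
    exact hq _ _
  · ext l
    exact hp _ _

/-- The strict inequality makes it unnecessary to know that the infimum is attained; the slack `ε *
r / 4` pays for it later. -/
theorem exists_path_of_dtw_lt {m d : ℕ} (hm : 1 ≤ m) {Q C : Curve m d} {x : ℝ}
    (h : dtw Q C < x) : ∃ τ, Path m 0 0 τ ∧ dtwCost Q C τ < x := by
  obtain ⟨τ₀, hτ₀⟩ := exists_path hm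
  obtain ⟨_, ⟨τ, hτ, rfl⟩, hx⟩ := exists_lt_of_csInf_lt
    (s := {x | ∃ τ, IsAlignment τ ∧ x = dtwCost Q C τ}) ⟨_, τ₀, hτ₀.isAlignment, rfl⟩ h
  exact ⟨τ, path_of_isAlignment hτ, hx⟩

theorem dtw_le_dtwCost {m d : ℕ} {Q C : Curve m d} {τ : List (Fin m × Fin m)}
    (hτ : Path m 0 0 τ) : dtw Q C ≤ dtwCost Q C τ := by
  refine csInf_le ⟨0, ?_⟩ ⟨τ, hτ.isAlignment, rfl⟩
  rintro _ ⟨τ, -, rfl⟩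
  refine List.sum_nonneg fun x hx => ?_
  obtain ⟨q, -, rfl⟩ := List.mem_map.1 hx
  exact dist_nonneg

/-! ## Near neighbors are found -/

/-- All factors are bounded by `(m * d)`-th powers. Per coordinate, the inverse weight is at most
`9` for the moves (at most `2 * m` factors `3`), times `2 * E * exp 4` for the digits, times `exp
20` for their sizes. Since `exp 1 ≤ 3`, the product is at most `18 * 3 ^ 24 * E = walkBase * E`. -/
theorem one_le_weight_mul {m d E len : ℕ} {x : ℝ} (hd : 1 ≤ d) (hE : 0 < E) (hlen : len ≤ 2 * m)
    (hx : x ≤ 20 * (m * d)) :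
    1 ≤ (3⁻¹ : ℝ) ^ len * (((2 * E : ℝ)⁻¹ * Real.exp (-(4 / E))) ^ d) ^ m * Real.exp (-x) *
      ((walkBase * E) ^ (m * d) : ℕ) := by
  have hE' : (1 : ℝ) ≤ E := by exact_mod_cast hE
  have h3 : Real.exp 1 ≤ 3 := by linarith [Real.exp_one_lt_d9]
  have h24 : Real.exp 24 ≤ 3 ^ 24 := by
    calc Real.exp 24 = Real.exp 1 ^ 24 := by rw [← Real.exp_nat_mul]; norm_num
      _ ≤ 3 ^ 24 := by gcongr
  have e1 : (9⁻¹ : ℝ) ^ (m * d) ≤ 3⁻¹ ^ len := by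
    calc (9⁻¹ : ℝ) ^ (m * d) ≤ 9⁻¹ ^ m :=
          pow_le_pow_of_le_one (by norm_num) (by norm_num) (Nat.le_mul_of_pos_right _ hd)
      _ = 3⁻¹ ^ (2 * m) := by rw [pow_mul]; norm_num
      _ ≤ 3⁻¹ ^ len := pow_le_pow_of_le_one (by norm_num) (by norm_num) hlen
  have e2 : Real.exp (-20) ^ (m * d) ≤ Real.exp (-x) := by
    rw [← Real.exp_nat_mul]
    refine Real.exp_le_exp.2 ?_
    push_cast
    linarith
  have e3 : Real.exp (-4) ≤ Real.exp (-(4 / E)) := by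
    refine Real.exp_le_exp.2 (neg_le_neg ?_)
    rw [div_le_iff₀ (by positivity)]
    linarith
  have e4 : (1 : ℝ) ≤ 9⁻¹ * ((2 * E : ℝ)⁻¹ * Real.exp (-4)) * Real.exp (-20) * (walkBase * E) := by
    have : Real.exp (-4) * Real.exp (-20) = (Real.exp 24)⁻¹ := by
      rw [← Real.exp_add, ← Real.exp_neg]
      norm_num
    calc (1 : ℝ) ≤ (Real.exp 24)⁻¹ * 3 ^ 24 := by
          rw [inv_mul_eq_div, le_div_iff₀ (Real.exp_pos _)]
          linarith
      _ = 9⁻¹ * ((2 * E : ℝ)⁻¹ * Real.exp (-4)) * Real.exp (-20) * (walkBase * E) := by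
          rw [← this]
          unfold walkBase
          push_cast
          field_simp
          norm_num
  calc (1 : ℝ) ≤ (9⁻¹ * ((2 * E : ℝ)⁻¹ * Real.exp (-4)) * Real.exp (-20) * (walkBase * E)) ^ (m * d) :=
        one_le_pow₀ e4
    _ = 9⁻¹ ^ (m * d) * (((2 * E : ℝ)⁻¹ * Real.exp (-4)) ^ d) ^ m * Real.exp (-20) ^ (m * d) *
        ((walkBase * E) ^ (m * d) : ℕ) := by
        rw [← pow_mul, mul_comm d m]
        push_cast
        simp only [mul_pow]
    _ ≤ _ := by gcongr

variable {S : ℕ} {P : WalkParams} {n : ℕ} {s₀ : Store} {W : ℕ} {H B V : ℤ} {ε r : ℝ}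

/-- The error budget: an alignment of the query of cost below `r + ε * r / 4` costs at most `r + ε *
r / 2` after rounding, so its walk is accepted. Conversely, a stored curve has an alignment of cost
at most `r + ε * r / 2` to the rounded query, hence of cost at most `r + 3 * ε * r / 4` to the query
itself. -/
theorem exists_neighbor (h₀ : BuildEnv S P n W H B V (r + ε * r / 2) s₀) (hd : 1 ≤ P.d)
    (hε : 0 < ε) (hr : 0 < r) (hδ : P.δ = ε * r / (8 * P.m * Real.sqrt P.d))
    (hE : 1 / ε ≤ P.E) (hK : P.K = 11 * (P.m * P.d) * P.E)
    (hW : W = (walkBase * P.E) ^ (P.m * P.d)) {C : Fin n → Curve P.m P.d}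
    (hC : ∀ (i : Fin n) (a : Fin P.m) (l : Fin P.d), curveOf P i s₀ (a * P.d + l) = C i a l)
    {f : ℤ → Option ℕ} (hfs : ∀ y j, f y = some j → j < n ∧ Valid P H (r + ε * r / 2) s₀ j y)
    (hfc : ∀ i t, i < n → t < W → ∀ y, Hit P W H (r + ε * r / 2) s₀ i t y → f y ≠ none)
    {Q : Curve P.m P.d} {q : ℕ → ℝ}
    (hq : ∀ (j : Fin P.m) (l : Fin P.d), q (j * P.d + l) = Q j l) {i : Fin n}
    (hi : dtw Q (C i) ≤ r) :
    0 ≤ code H (fun k => ⌊q k / P.δ⌋) (P.m * P.d) ∧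
    code H (fun k => ⌊q k / P.δ⌋) (P.m * P.d) < (2 * H + 1) ^ (P.m * P.d) ∧
    ∃ j : Fin n, f (code H (fun k => ⌊q k / P.δ⌋) (P.m * P.d)) = some (j : ℕ) ∧
      dtw Q (C j) ≤ (1 + ε) * r := by
  have hm := h₀.m_pos
  have hδ0 := h₀.δ_pos
  have hmR : (1 : ℝ) ≤ P.m := by exact_mod_cast hm
  have hdR : (1 : ℝ) ≤ P.d := by exact_mod_cast hd
  have hER : (1 : ℝ) ≤ P.E := by exact_mod_cast h₀.E_pos
  have hsd : 0 < Real.sqrt P.d := Real.sqrt_pos.2 (by linarith)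
  have hεE : 1 ≤ ε * P.E := by
    rw [div_le_iff₀ hε] at hE
    linarith
  have hround : 2 * P.m * (P.δ * Real.sqrt P.d) = ε * r / 4 := by
    rw [hδ]; field_simp; norm_num
  have hscale : Real.sqrt P.d / P.δ = 8 * (P.m * P.d) / (ε * r) := by
    rw [hδ]
    field_simp
    rw [Real.sq_sqrt (by positivity)]
  have hlen : ∀ {τ : List (Fin P.m × Fin P.m)}, Path P.m 0 0 τ →
      τ.length * (P.δ * Real.sqrt P.d) ≤ ε * r / 4 := by
    intro τ hτ
    rw [← hround]
    have := hτ.length_le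
    have h : (τ.length : ℝ) ≤ 2 * P.m := by
      have : τ.length ≤ 2 * P.m := by omega
      exact_mod_cast this
    gcongr
  set Z : ℕ → ℤ := fun k => ⌊q k / P.δ⌋ with hZ
  have hgrid : ∀ k, |P.δ * Z k - q k| ≤ P.δ := by
    intro k
    have h1 : (Z k : ℝ) ≤ q k / P.δ := Int.floor_le _
    have h2 : q k / P.δ < Z k + 1 := Int.lt_floor_add_one _
    rw [le_div_iff₀ hδ0] at h1
    rw [div_lt_iff₀ hδ0] at h2
    rw [abs_le]
    constructor <;> linarith
  obtain ⟨τ, hτ, hcost⟩ := exists_path_of_dtw_lt hm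
    (hi.trans_lt (show r < r + ε * r / 4 by have : 0 < ε * r := mul_pos hε hr; linarith))
  rw [← pathCost_eq_dtwCost hq (hC i)] at hcost
  have hsum : (τ.map fun x => pointDist P.d (curveOf P i s₀) q x.1 x.2).sum < r + ε * r / 4 := hcost
  -- As `1 ≤ ε * E`, the factor `8 * (r + ε * r / 4)` is at most `10 * ε * r * E`. A further `d ≤ m
  -- * d * E` for rounding explains the digit bound `11 * m * d * E`.
  have hμ : Real.sqrt P.d / P.δ *
      (τ.map fun x => pointDist P.d (curveOf P i s₀) q x.1 x.2).sum ≤ 10 * (P.m * P.d) * P.E := by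
    have hεr : 0 < ε * r := mul_pos hε hr
    have h1 : r ≤ ε * P.E * r := le_mul_of_one_le_left hr.le hεE
    have h2 : ε * r ≤ ε * r * P.E := le_mul_of_one_le_right hεr.le hER
    rw [hscale, div_mul_eq_mul_div, div_le_iff₀ hεr]
    calc _ ≤ (P.m * P.d : ℝ) * (8 * (r + ε * r / 4)) := by
          rw [mul_comm (8 : ℝ), mul_assoc]
          gcongr
      _ ≤ (P.m * P.d : ℝ) * (10 * (ε * r * P.E)) := by
          refine mul_le_mul_of_nonneg_left ?_ (by positivity)
          linarith
      _ = _ := by ring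
  have hfair := Walk.run_complete (P := P) (p := curveOf P i s₀) h₀.E_pos Z
    (fun j a => pointDist P.d (curveOf P i s₀) q j a) (μ := Real.sqrt P.d / P.δ)
    (fun j a => mul_nonneg (by positivity) (Real.sqrt_nonneg _))
    (fun j _ a _ => sum_abs_floor_le hδ0 j a) hτ (by
      rw [hK]
      push_cast
      have : (P.d : ℝ) ≤ P.m * P.d * P.E := by
        have h1 : (P.d : ℝ) ≤ P.m * P.d := le_mul_of_one_le_left (by positivity) hmR
        exact h1.trans (le_mul_of_one_le_right (by positivity) hER)
      linarith) true
  rw [if_pos rfl, show P.m - 1 - 0 + 1 = P.m by omega] at hfair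
  obtain ⟨t, ht, hrun⟩ := hfair.exists_grid h₀.W_pos (by
    rw [hW]
    refine one_le_weight_mul hd h₀.E_pos (by have := hτ.length_le; omega) ?_
    rw [div_le_iff₀ (by positivity), mul_assoc]
    linarith)
  have hrun' : ∀ X, _ := fun X => hrun (2 * P.m) (Walk.start (t / W) X) rfl rfl rfl rfl (by omega)
    (by intro k hk; simp [Walk.start, Walk.drawn] at hk)
  have hfloor : ∀ z : ℤ, ⌊P.δ * (z : ℝ) / P.δ⌋ = z := fun z => by
    rw [mul_div_cancel_left₀ _ hδ0.ne', Int.floor_intCast]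
  have hhit : Hit P W H (r + ε * r / 2) s₀ i t (code H Z (P.m * P.d)) := by
    intro X
    obtain ⟨h1, h2⟩ := hrun' X
    refine ⟨?_, code_congr fun k hk => ?_⟩
    · rw [h2]
      have h3 := pathCost_le_add (d := P.d) (p := curveOf P i s₀) hδ0.le (fun k _ => hgrid k) τ
      have h4 := hlen hτ
      change 0 + _ ≤ _
      linarith
    · rw [h1 k hk, hfloor]
  -- The coordinates of the rounded query are bounded because a walk produces them, and walks stay
  -- within `H`.
  have hZH : ∀ k < P.m * P.d, |Z k| ≤ H := by
    intro k hk
    obtain ⟨-, hX, -⟩ := Walk.run_sound (p := curveOf P i s₀) h₀.E_pos (h₀.le_H i i.2) (2 * P.m)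
      (Walk.start (t / W) q) hm hm (by simp [Walk.start])
      (show (0 : ℝ) ≤ t / W by positivity)
      (show (t / W : ℝ) < 1 by
        rw [div_lt_one (by exact_mod_cast h₀.W_pos)]
        exact_mod_cast ht)
      (by intro k hk; simp [Walk.start, Walk.drawn] at hk)
    obtain ⟨z, hz, he⟩ := hX k hk
    rw [(hrun' q).1 k hk] at he
    have : (Z k : ℝ) = z := mul_left_cancel₀ hδ0.ne' he
    rwa [show Z k = z by exact_mod_cast this]
  obtain ⟨c0, c1⟩ := code_mem hZH
  refine ⟨c0, c1, ?_⟩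
  obtain ⟨j, hj⟩ := Option.ne_none_iff_exists'.1 (hfc i t i.2 ht _ hhit)
  obtain ⟨hjn, X, hX, hcode, τ', hτ', hcost'⟩ := hfs _ j hj
  refine ⟨⟨j, hjn⟩, hj, ?_⟩
  -- Codes within the bound `H` are injective, so the grid curve that justified the stored entry is
  -- the rounded query.
  have hXZ : ∀ k < P.m * P.d, X k = P.δ * Z k := by
    have h1 := code_inj (Z := fun k => ⌊X k / P.δ⌋) (fun k hk => by
      obtain ⟨z, hz, he⟩ := hX k hk
      rwa [he, hfloor]) hZH hcode
    intro k hk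
    obtain ⟨z, hz, he⟩ := hX k hk
    have h2 := h1 k hk
    rw [he, hfloor] at h2
    rw [he, h2]
  refine (dtw_le_dtwCost hτ').trans ?_
  rw [← pathCost_eq_dtwCost hq (hC ⟨j, hjn⟩)]
  have h3 := pathCost_le_add (p := curveOf P j s₀) (X := q) (Y := X) hδ0.le (fun k hk => by
    rw [hXZ k hk, abs_sub_comm]
    exact hgrid k) τ'
  have h4 := hlen hτ'
  have : 0 < ε * r := mul_pos hε hr
  change pathCost P.d (curveOf P j s₀) q τ' ≤ _
  linarith

end RAM

end

noncomputable section

namespace RAM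

/-! ## The data structure -/

theorem curveArray_apply {m d : ℕ} (Q : Curve m d) (old : ℕ → ℝ) (j : Fin m) (l : Fin d) :
    curveArray Q old (j * d + l) = Q j l := by
  have h : (j : ℕ) * d + l < m * d := index_lt j.2 l.2
  have e : (⟨j * d + l, h⟩ : Fin (m * d)) = finProdFinEquiv (j, l) := by
    ext
    simp [finProdFinEquiv, mul_comm, add_comm]
  rw [curveArray, dif_pos h, e, Equiv.symm_apply_apply]

theorem inputArray_apply {n m d : ℕ} (C : Fin n → Curve m d) (i : Fin n) (a : Fin m)
    (l : Fin d) : inputArray C (i * (m * d) + (a * d + l)) = C i a l := by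
  have h' : (a : ℕ) * d + l < m * d := index_lt a.2 l.2
  have h : (i : ℕ) * (m * d) + (a * d + l) < n * (m * d) := index_lt i.2 h'
  have e : (⟨i * (m * d) + (a * d + l), h⟩ : Fin (n * (m * d))) =
      finProdFinEquiv (i, ⟨a * d + l, h'⟩) := by
    ext
    simp [finProdFinEquiv, mul_comm, add_comm]
  rw [inputArray, dif_pos h, e, Equiv.symm_apply_apply]
  exact curveArray_apply _ _ _ _

theorem invEps_bounds {ε : ℝ} (hε : 0 < ε) (hε' : ε ≤ 1) :
    1 / ε ≤ invEps ε ∧ (invEps ε : ℝ) ≤ 2 / ε := by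
  have h1 := Nat.lt_floor_add_one (1 / ε)
  have h2 := Nat.floor_le (show 0 ≤ 1 / ε by positivity)
  have h3 : 1 ≤ 1 / ε := by rwa [le_div_iff₀ hε, one_mul]
  unfold invEps
  push_cast
  refine ⟨h1.le, ?_⟩
  rw [show (2 : ℝ) / ε = 1 / ε + 1 / ε by ring]
  linarith

/-- The store `s` contains the finished dictionary; `s₀` is the store after the parameters have
been computed. -/
structure QueryInv (P : WalkParams) (n W : ℕ) (H B V : ℤ) (thr : ℝ) (s₀ s : Store) : Prop where
  r5 : s.reg 5 = P.δ
  r6 : s.reg 6 = ((P.m * P.d : ℕ) : ℝ)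
  r10 : s.reg 10 = H
  r11 : s.reg 11 = B
  dict : ∃ f, Holds B ((2 * H + 1) ^ (P.m * P.d)) V (n * W) f s ∧
    (∀ y j, f y = some j → j < n ∧ Valid P H thr s₀ j y) ∧
    ∀ i t, i < n → t < W → ∀ y, Hit P W H thr s₀ i t y → f y ≠ none

variable {S : ℕ} {P : WalkParams} {n : ℕ} {s s₀ : Store} {W : ℕ} {H B V : ℤ} {thr ε r : ℝ}

theorem BuildInv.queryInv (h₀ : BuildEnv S P n W H B V thr s₀)
    (h : BuildInv P n W H B V thr s₀ n 0 (s.setReg 18 0)) :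
    QueryInv P n W H B V thr s₀ s := by
  have low : ∀ x < 14, s.reg x = s₀.reg x := fun x hx => by
    rw [← h.low x (Or.inl hx), reg_setReg, if_neg (by omega)]
  obtain ⟨f, hf, hs, hc⟩ := h.dict
  refine ⟨by rw [low _ (by norm_num), h₀.r5], by rw [low _ (by norm_num), h₀.r6],
    by rw [low _ (by norm_num), h₀.r10], by rw [low _ (by norm_num), h₀.r11], f,
    hf.congr fun x h1 h2 => ?_, hs, fun i t hi ht => hc i t ht (Or.inl hi)⟩
  rw [reg_setReg, if_neg (by omega)]

/-- The answer overwrites `n` in register `0`, which queries do not read; `QueryInv` leaves this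
register out and so survives any number of queries. -/
theorem queryCmd_spec (h₀ : BuildEnv S P n W H B V (r + ε * r / 2) s₀) (hd : 1 ≤ P.d)
    (hε : 0 < ε) (hr : 0 < r) (hδ : P.δ = ε * r / (8 * P.m * Real.sqrt P.d))
    (hE : 1 / ε ≤ P.E) (hK : P.K = 11 * (P.m * P.d) * P.E)
    (hW : W = (walkBase * P.E) ^ (P.m * P.d)) {C : Fin n → Curve P.m P.d}
    (hC : ∀ (i : Fin n) (a : Fin P.m) (l : Fin P.d), curveOf P i s₀ (a * P.d + l) = C i a l)
    (hs : QueryInv P n W H B V (r + ε * r / 2) s₀ s) (Q : Curve P.m P.d) :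
    Term S queryCmd (loadQuery Q s) (6 * (P.m * P.d) + 22) fun s' =>
      QueryInv P n W H B V (r + ε * r / 2) s₀ s' ∧ CorrectAnswer dtw C ε r Q s' := by
  have hV := h₀.one_le_V hd
  obtain ⟨f, hf, hfs, hfc⟩ := hs.dict
  refine Term.mono (T₁ := (6 * (P.m * P.d) + 7) + (12 + (0 + 1) + 1) + 1) ?_ (by omega)
    fun _ h => h
  refine Term.cons (T₁ := 6 * (P.m * P.d) + 7) (T₂ := 12 + (0 + 1) + 1) ((codeCmd_spec
    (s := loadQuery Q s) ((Nat.le_mul_of_pos_left _ h₀.n_pos).trans h₀.size) h₀.δ_pos hs.r5 hs.r6 hs.r10).mono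
    le_rfl ?_)
  rintro s₁ ⟨e₁, -, h30⟩
  refine Term.cons (T₁ := 12) (T₂ := 0 + 1) ((lookupCmd_spec
    (hf.congr fun x _ h2 => e₁ x (by omega)) hV.2 h₀.lt_B
    ((e₁ _ (by norm_num)).trans hs.r11) h30).mono le_rfl ?_)
  rintro s₂ ⟨e₂, h0⟩
  have e : ∀ x, x < 20 → x ≠ 0 → s₂.reg x = s.reg x := fun x h1 h2 =>
    (e₂ x h1 h2).trans (e₁ x (by omega))
  refine Term.nil ⟨⟨(e _ (by norm_num) (by norm_num)).trans hs.r5,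
    (e _ (by norm_num) (by norm_num)).trans hs.r6,
    (e _ (by norm_num) (by norm_num)).trans hs.r10,
    (e _ (by norm_num) (by norm_num)).trans hs.r11, f,
    hf.congr fun x h1 h2 => e x (by omega) (by omega), hfs, hfc⟩, ?_⟩
  rintro ⟨i, hi⟩
  obtain ⟨c0, c1, j, hj, hdist⟩ := exists_neighbor h₀ hd hε hr hδ hE hK hW hC hfs hfc
    (Q := Q) (q := (loadQuery Q s).mem 1) (fun j l => by
      simp only [loadQuery, Function.update_self]
      exact curveArray_apply _ _ _ _) hi
  exact ⟨j, h0 c0 c1 j hj, hdist⟩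

theorem prepCmd_spec {n m d : ℕ} {ε r : ℝ} (hn : 1 ≤ n) (hm : 1 ≤ m) (hd : 1 ≤ d)
    (hε : 0 < ε) (hr : 0 < r) (C : Fin n → Curve m d) :
    ∃ H B V s₀, BuildEnv (n * (m * d)) (walkParams m d ε r) n (walkCount m d ε) H B V
        (r + ε * r / 2) s₀ ∧ s₀.mem 0 = inputArray C ∧
      Term (n * (m * d)) prepCmd (inputStore C ε r) (300 * (n * (m * d) * walkCount m d ε))
        (QueryInv (walkParams m d ε r) n (walkCount m d ε) H B V (r + ε * r / 2) s₀) := by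
  obtain ⟨t, ht, s₀, ⟨hmem, h₀⟩, hr₁⟩ := paramCmd_spec (s := inputStore C ε r) hn hm hd hε hr
    rfl rfl rfl rfl rfl rfl
  refine ⟨_, _, _, s₀, h₀, by rw [hmem]; rfl, ?_⟩
  refine (Term.cons (T₂ := (n * (walkCount m d ε * (200 * (m * d) + 1) + 8) + 11) + (0 + 1) + 1)
    ⟨t, ht, s₀, ?_, hr₁⟩).mono ?_ fun _ h => h
  · exact Term.cons (T₁ := n * (walkCount m d ε * (200 * (m * d) + 1) + 8) + 11)
      (T₂ := 0 + 1) ((buildCmd_spec h₀ hd).mono le_rfl fun s hs => Term.nil (hs.queryInv h₀))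
  · have hW : 1 ≤ walkCount m d ε := h₀.W_pos
    have hN : 1 ≤ m * d := Nat.mul_pos hm hd
    generalize walkCount m d ε = W at *
    generalize m * d = N at *
    have h1 : n * (N * W) = n * N * W := (mul_assoc _ _ _).symm
    have h2 : N ≤ n * N := Nat.le_mul_of_pos_left _ hn
    have h3 : n * N ≤ n * N * W := Nat.le_mul_of_pos_right _ hW
    have h4 : n * W ≤ n * N * W := Nat.mul_le_mul_right _ (Nat.le_mul_of_pos_right _ hN)
    have h5 : n ≤ n * N := Nat.le_mul_of_pos_right _ hN
    have h6 : n * (W * (200 * N + 1) + 8) = 200 * (n * N * W) + n * W + 8 * n := by ring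
    omega

/-- The factors `N ≤ 2 ^ N` and `300 ≤ 300 ^ N` are absorbed into the base. The exponent `m * d`
already suffices, and it may be raised to `m * (d + 1)` because the base is at least one. -/
theorem walkCount_le {m d : ℕ} {ε : ℝ} (hd : 1 ≤ d) (hε : 0 < ε) (hε' : ε ≤ 1) {N : ℕ}
    (hN : N = m * d) (hN1 : 1 ≤ N) :
    (300 * (N * walkCount m d ε) : ℝ) ≤ ((1200 * walkBase : ℕ) / ε) ^ (m * (d + 1)) := by
  subst hN
  have hE := (invEps_bounds hε hε').2
  have h2 : ((m * d : ℕ) : ℝ) ≤ 2 ^ (m * d) := by exact_mod_cast (Nat.lt_two_pow_self).le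
  have h3 : (300 : ℝ) ≤ 300 ^ (m * d) := le_self_pow₀ (by norm_num) (by omega)
  have hb : (1 : ℝ) ≤ walkBase := by unfold walkBase; norm_num
  have h4 : (1 : ℝ) ≤ (1200 * walkBase : ℕ) / ε := by
    rw [le_div_iff₀ hε]
    push_cast
    nlinarith
  have h5 : m * d ≤ m * (d + 1) := Nat.mul_le_mul_left _ (Nat.le_succ d)
  refine le_trans ?_ (pow_le_pow_right₀ h4 h5)
  calc (300 * ((m * d : ℕ) * walkCount m d ε) : ℝ)
      ≤ 300 ^ (m * d) * (2 ^ (m * d) * (walkBase * (2 / ε)) ^ (m * d)) := by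
        unfold walkCount
        push_cast at h2 ⊢
        gcongr
    _ = ((1200 * walkBase : ℕ) / ε) ^ (m * d) := by
        rw [← mul_pow, ← mul_pow]
        congr 1
        push_cast
        ring

/-- The two programs solve the approximate near-neighbor problem. -/
theorem solvesANNC_dtw {n m d : ℕ} {ε r : ℝ} (hn : 1 ≤ n) (hm : 1 ≤ m) (hd : 1 ≤ d)
    (hε : 0 < ε) (hε' : ε ≤ 1) (hr : 0 < r) (C : Fin n → Curve m d) :
    ∃ S : ℕ, (S : ℝ) ≤ n * ((1200 * walkBase : ℕ) / ε) ^ (m * (d + 1)) ∧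
      SolvesANNC dtw prepCmd queryCmd C ε r S
        (ENNReal.ofReal (n * ((1200 * walkBase : ℕ) / ε) ^ (m * (d + 1))))
        (1200 * walkBase * (m * d)) := by
  refine ⟨n * (m * d), ?_, ?_⟩
  all_goals
    have hN : 1 ≤ m * d := Nat.mul_pos hm hd
    have hle := walkCount_le (m := m) hd hε hε' rfl hN
    obtain ⟨H, B, V, s₀, h₀, hmem, hprep⟩ := prepCmd_spec hn hm hd hε hr C
    have hW : (1 : ℝ) ≤ walkCount m d ε := by exact_mod_cast h₀.W_pos
  · push_cast [Nat.cast_mul] at hle ⊢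
    gcongr
    refine le_trans ?_ hle
    have : (0 : ℝ) ≤ m * d := by positivity
    nlinarith
  · refine ⟨hprep.expectedTime_le.trans ?_, ?_⟩
    · rw [← ENNReal.ofReal_natCast]
      refine ENNReal.ofReal_le_ofReal ?_
      calc ((300 * (n * (m * d) * walkCount m d ε) : ℕ) : ℝ)
          = n * (300 * ((m * d : ℕ) * walkCount m d ε)) := by push_cast; ring
        _ ≤ _ := by gcongr
    · have hquery : ∀ {s}, QueryInv (walkParams m d ε r) n (walkCount m d ε) H B V
          (r + ε * r / 2) s₀ s → ∀ Q : Curve m d, Term (n * (m * d)) queryCmd (loadQuery Q s)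
            (1200 * walkBase * (m * d)) fun s' =>
              QueryInv (walkParams m d ε r) n (walkCount m d ε) H B V (r + ε * r / 2) s₀ s' ∧
              CorrectAnswer dtw C ε r Q s' := fun hs Q =>
        (queryCmd_spec (P := walkParams m d ε r) h₀ hd hε hr rfl (invEps_bounds hε hε').1 rfl rfl
          (C := C) (fun i a l => by
            rw [curveOf, hmem]
            exact inputArray_apply C i a l) hs Q).mono
          (by
            change 6 * (m * d) + 22 ≤ _
            have : 28 * (m * d) ≤ 1200 * walkBase * (m * d) :=
              Nat.mul_le_mul_right _ (by unfold walkBase; norm_num)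
            omega) fun _ h => h
      -- The invariant holds after the preprocessing and is passed on by every query.
      have hinv : ∀ s, IsDataStructure (n * (m * d)) prepCmd queryCmd C ε r s →
          QueryInv (walkParams m d ε r) n (walkCount m d ε) H B V (r + ε * r / 2) s₀ s := by
        intro s hs
        induction hs with
        | built t s h => exact hprep.of_mem_support h
        | queried t Q s s' _ h ih => exact ((hquery ih Q).of_mem_support h).1
      intro s hs Q c hc
      obtain ⟨s', hs', heq⟩ := (hquery (hinv s hs) Q).steps_eq
      rw [queryStart, heq _ le_rfl] at hc
      exact ⟨s', by simpa using hc, hs'.2⟩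

end RAM

end

theorem theorem5p4 :
    ∃ (prep query : RAM.Cmd) (c : ℕ), ∀ (n m d : ℕ) (ε r : ℝ),
      1 ≤ n → 1 ≤ m → 1 ≤ d → 0 < ε → ε ≤ 1 → 0 < r → ∀ C : Fin n → Curve m d,
        ∃ S : ℕ, (S : ℝ) ≤ n * (c / ε) ^ (m * (d + 1)) ∧
          SolvesANNC dtw prep query C ε r S
            (ENNReal.ofReal (n * (c / ε) ^ (m * (d + 1)))) (c * (m * d)) :=
  ⟨RAM.prepCmd, RAM.queryCmd, 1200 * RAM.walkBase, fun _ _ _ _ _ hn hm hd hε hε' hr C =>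
    RAM.solvesANNC_dtw hn hm hd hε hε' hr C⟩
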